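/- For integers $q\ge 1$, $N\ge 1$, $a,b,c$ put \[ S_q(N;a,b,c)=\sum_{\substack{c<n\le c+N\\ (n,q)=1}}e_q(an^{*}+bn),\qquad e_q(v)=e^{2\pi i v/q},\qquad nn^{*}\equiv 1\pmod q , \] and let $d=\prod_{p\mid q}p$ be the product of the distinct primes dividing $q$. Theorem 2. Let $0<\delta<0.1$ be fixed and put \[ \gamma_1=1200\,\delta^{-2}\bigl(\log(1/\delta)\bigr)^{2/3},\qquad \gamma=201^{-4}\,\delta^{6}\bigl(\log(1/\delta)\bigr)^{2}. \] There is a $q_0(\delta)$ such that for all integers $q\ge q_0(\delta)$ and all integers $N$ with \[ \max\bigl(d^{\,2+\delta},\,e^{\gamma_1(\log q)^{2/3}}\bigr)\le N\le q^{\delta/20}, \] and for all integers $a,b,c$ with $(a,q)=1$, one has \[ |S_q(N;a,b,c)|<N\exp\Bigl(-\gamma\,\frac{(\log N)^{3}}{(\log q)^{2}}\Bigr). \] -/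

import Mathlib

namespace ShortKloosterman

/-- The kernel `d = ∏_{p ∣ q} p` of `q`, the product of the distinct primes dividing `q`. -/
def kernel (q : ℕ) : ℕ := ∏ p ∈ q.primeFactors, p

/-- The additive character `e_q(v) = exp (2 π i v / q)`. -/
noncomputable def e (q : ℕ) (v : ℤ) : ℂ :=
  Complex.exp (2 * (Real.pi : ℂ) * Complex.I * (v : ℂ) / (q : ℂ))

/-- The residue `n*` (represented in `0, …, q - 1`) with `n n* ≡ 1 (mod q)`,
for `n` coprime to `q ≥ 1`. -/
def invMod (q : ℕ) (n : ℤ) : ℤ := (((n : ZMod q)⁻¹).val : ℤ)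

/-- `invMod` has its defining property. -/
theorem mul_invMod (q : ℕ) (hq : 1 ≤ q) (n : ℤ) (hn : Int.gcd n (q : ℤ) = 1) :
    n * invMod q n ≡ 1 [ZMOD (q : ℤ)] := by
  have : NeZero q := ⟨by omega⟩
  rw [← ZMod.intCast_eq_intCast_iff]
  have hu : IsUnit (n : ZMod q) :=
    (ZMod.coe_int_isUnit_iff_isCoprime n q).2 (Int.isCoprime_iff_gcd_eq_one.2 hn).symm
  rw [invMod, Int.cast_mul, Int.cast_natCast, ZMod.natCast_zmod_val, Int.cast_one]
  exact ZMod.mul_inv_of_unit _ hu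

/-- The incomplete Kloosterman sum
`S_q(N; a, b, c) = ∑_{c < n ≤ c + N, (n, q) = 1} e_q(a n* + b n)`. -/
noncomputable def S (q N : ℕ) (a b c : ℤ) : ℂ :=
  ∑ n ∈ (Finset.Ioc c (c + (N : ℤ))).filter (fun n => Int.gcd n (q : ℤ) = 1),
    e q (a * invMod q n + b * n)

/-- `γ₁ = 1200 δ⁻² (log (1/δ))^{2/3}`. -/
noncomputable def gamma1 (δ : ℝ) : ℝ :=
  1200 * (δ ^ 2)⁻¹ * (Real.log (1 / δ)) ^ ((2 : ℝ) / 3)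

/-- `γ = 201⁻⁴ δ⁶ (log (1/δ))²`. -/
noncomputable def gamma (δ : ℝ) : ℝ :=
  ((201 : ℝ) ^ 4)⁻¹ * δ ^ 6 * (Real.log (1 / δ)) ^ 2

end ShortKloosterman

/-!
The proof is Vinogradov's method, applied to a modulus `q` whose kernel `d` is small.

Let `D` be a multiple of `d` with `q ∣ D ^ (k + 1)`. Averaging over the shifts `n ↦ n + D x y`
with `0 ≤ x, y < X`, `X ≈ N ^ (1 / 4)`, costs `O(D X ²)` (`norm_sum_le_of_shift`). Since `D` is
nilpotent modulo `q`, the inverse of `n + D x y` is a finite geometric series, so the phase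
becomes a polynomial of degree `k` in `x y` (`exists_phase`). Its coefficients of degree `j ≥ 2`
have denominator exactly `q / gcd (D ^ j, q)`, for every `a` and `n` coprime to `q`.

For such a bilinear polynomial sum, Hölder's inequality in `x` and in `y` brings in the mean value
`J_{s,k}(X)` twice and leaves, for each degree `j`, the sum `∑_μ |∑_l ψ (a_j l μ)|` over ranges of
length about `X ^ j` (`norm_bilinear_pow_le`). For a coefficient with denominator `Q` it is
smaller than the trivial bound by a factor of about `min (√Q) (X ^ j / √Q)`
(`dualSum_le_of_order`). The mean value is bounded by Vinogradov's mean value theorem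
`meanValue_le`, proved by Linnik's `p`-adic method: modulo a prime `p > k`, Newton's identities
show that `k` incongruent unknowns are determined by their power sums modulo `p ^ k`, up to
`k ^ k` choices (`card_psum_modEq_le`). Since a residue class is an affine image of a shorter
interval, this gives a recursion (`meanValue_recursion`), and induction on the number of variables
brings the exponent of `X` down to `2 s - k (k + 1) / 2 + (k (k + 1) / 2) (1 - 1 / k) ^ l`.

It remains to choose `k` so that many degrees save (`exists_degree_and_window`). Write `q = N ^ R`
and `D = d E`, where for `q = ∏ p ^ v` and exponent `r = k + 1` the excess `E` is
`∏ p ^ (⌈v / r⌉ - 1)`. Let `k ≥ 16 R` be minimal such that `E ≤ N ^ (δ / 8)`; with `d ^ (2 + δ) ≤ N`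
this gives `D ≤ N ^ (1 / 2 - δ / 9)`, so the shifts are admissible. If `k = ⌈16 R⌉`, then
`q / D ^ j` is still a positive power of `N` for `j` slightly above `2 R`, and these degrees save a
factor `N ^ (c δ ² R ²)` in total. If `k` is larger, then the excess for the exponent `k` is large,
which means that a large part of `q` comes from primes with `v > k`. Such primes survive in
`q / gcd (D ^ j, q)` for all `j ≤ (k + 1) / 4`, the degrees from `3 R` on save `N ^ (c δ k ²)`, and
`δ k ≤ 8 R`. In both cases the lower bound for `log N` makes the constants, which are
`exp (O(k ⁴ log ² (1 / δ)))`, negligible (`bilinearConst_mul_le`), and after the root of order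
`4 s ²`, `s = O(k ² log (1 / δ))`, the saving exceeds the one claimed.
-/

open Finset

/-! ### Additive energies of maps -/

namespace Vinogradov

/-- The number of pairs `(x, y)` in `B × B` with `F x = F y`, that is, the additive energy of `F`
on `B`. -/
def collisions {β H : Type*} [DecidableEq H] (B : Finset β) (F : β → H) : ℕ :=
  #{z ∈ B ×ˢ B | F z.1 = F z.2}

section Collisions

variable {β β' H H' : Type*} [DecidableEq H] [DecidableEq H']

/-- An injection under which equalities of values of `F` persist does not decrease the energy. -/
theorem collisions_le_of_injOn {B : Finset β} {B' : Finset β'} {F : β → H} {F' : β' → H'}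
    (g : β → β') (hg : ∀ x ∈ B, g x ∈ B') (hinj : Set.InjOn g B)
    (hF : ∀ x ∈ B, ∀ y ∈ B, F x = F y → F' (g x) = F' (g y)) :
    collisions B F ≤ collisions B' F' := by
  refine card_le_card_of_injOn (fun z => (g z.1, g z.2)) ?_ ?_
  · rintro ⟨x, y⟩ h
    simp only [coe_filter, mem_product, Set.mem_ofPred_eq] at h ⊢
    exact ⟨⟨hg x h.1.1, hg y h.1.2⟩, hF x h.1.1 y h.1.2 h.2⟩
  · rintro ⟨x, y⟩ h ⟨x', y'⟩ h' heq
    simp only [coe_filter, mem_product, Set.mem_ofPred_eq] at h h'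
    simp only [Prod.mk.injEq] at heq ⊢
    exact ⟨hinj h.1.1 h'.1.1 heq.1, hinj h.1.2 h'.1.2 heq.2⟩

theorem collisions_le_card_sq (B : Finset β) (F : β → H) : collisions B F ≤ #B ^ 2 := by
  rw [sq, ← card_product]
  exact card_filter_le _ _

/-- Solutions of `F x = G y`, counted by the common value. -/
theorem card_sol_eq_sum (B C : Finset β) (F G : β → H) (U : Finset H) (hU : ∀ x ∈ B, F x ∈ U) :
    #{z ∈ B ×ˢ C | F z.1 = G z.2} = ∑ h ∈ U, #{x ∈ B | F x = h} * #{x ∈ C | G x = h} := by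
  rw [card_eq_sum_card_fiberwise (f := fun z => F z.1) (t := U)]
  · refine sum_congr rfl fun h _ => ?_
    rw [← card_product]
    congr 1
    ext ⟨x, y⟩
    simp only [mem_filter, mem_product]
    constructor
    · rintro ⟨⟨⟨a, b⟩, c⟩, rfl⟩
      exact ⟨⟨a, rfl⟩, b, c.symm⟩
    · rintro ⟨⟨a, rfl⟩, b, c⟩
      exact ⟨⟨⟨a, b⟩, c.symm⟩, rfl⟩
  · rintro ⟨x, y⟩ h
    simp only [coe_filter, mem_product, Set.mem_ofPred_eq] at h
    exact hU x h.1.1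

/-- Among all representation counts of a difference, the one of `0` is the largest. -/
theorem card_shifted_le_collisions [AddCommGroup H] (B : Finset β) (F : β → H) (c : H) :
    #{z ∈ B ×ˢ B | F z.1 = F z.2 + c} ≤ collisions B F := by
  classical
  set U := B.image F ∪ B.image fun x => F x + c with hUdef
  have hU : ∀ x ∈ B, F x ∈ U := fun x hx => mem_union_left _ (mem_image_of_mem _ hx)
  have hU' : ∀ x ∈ B, F x + c ∈ U := fun x hx =>
    mem_union_right _ (mem_image_of_mem (fun x => F x + c) hx)
  have h1 := card_sol_eq_sum B B F (fun x => F x + c) U hU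
  have h2 := card_sol_eq_sum B B F F U hU
  have h3 := card_sol_eq_sum B B (fun x => F x + c) (fun x => F x + c) U hU'
  simp only [add_left_inj] at h3
  have key : 2 * #{z ∈ B ×ˢ B | F z.1 = F z.2 + c} ≤ 2 * collisions B F := by
    rw [two_mul (collisions B F)]
    nth_rw 1 [collisions, h2]
    rw [collisions, h3, h1, mul_sum, ← sum_add_distrib]
    refine sum_le_sum fun h _ => ?_
    nlinarith [two_mul_le_add_sq (#{x ∈ B | F x = h}) (#{x ∈ B | F x + c = h})]
  omega

/-- Covering a set by `#T` pieces costs a factor `#T` in the energy (Cauchy–Schwarz). -/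
theorem collisions_cover_le {τ : Type*} (B : Finset β) (F : β → H) (T : Finset τ)
    (Bt : τ → Finset β) (hcov : ∀ x ∈ B, ∃ t ∈ T, x ∈ Bt t) :
    collisions B F ≤ #T * ∑ t ∈ T, collisions (Bt t) F := by
  classical
  set U := B.image F ∪ T.biUnion fun t => (Bt t).image F
  have hU : ∀ x ∈ B, F x ∈ U := fun x hx => mem_union_left _ (mem_image_of_mem _ hx)
  have hUt : ∀ t ∈ T, ∀ x ∈ Bt t, F x ∈ U := fun t ht x hx =>
    mem_union_right _ (mem_biUnion.2 ⟨t, ht, mem_image_of_mem _ hx⟩)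
  have h1 := card_sol_eq_sum B B F F U hU
  have h2 : ∀ t ∈ T, collisions (Bt t) F
      = ∑ h ∈ U, #{x ∈ Bt t | F x = h} * #{x ∈ Bt t | F x = h} := fun t ht =>
    card_sol_eq_sum (Bt t) (Bt t) F F U (hUt t ht)
  rw [collisions, h1, sum_congr rfl h2, sum_comm, mul_sum]
  refine sum_le_sum fun h _ => ?_
  have h3 : #{x ∈ B | F x = h} ≤ ∑ t ∈ T, #{x ∈ Bt t | F x = h} := by
    refine le_trans (card_le_card ?_) card_biUnion_le
    intro x hx
    simp only [mem_filter, mem_biUnion] at hx ⊢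
    obtain ⟨t, ht, hxt⟩ := hcov x hx.1
    exact ⟨t, ht, hxt, hx.2⟩
  have h4 : (∑ t ∈ T, #{x ∈ Bt t | F x = h}) ^ 2 ≤ #T * ∑ t ∈ T, #{x ∈ Bt t | F x = h} ^ 2 := by
    have := sq_sum_le_card_mul_sum_sq (s := T) (f := fun t => (#{x ∈ Bt t | F x = h} : ℤ))
    exact_mod_cast this
  calc _ ≤ (∑ t ∈ T, #{x ∈ Bt t | F x = h}) ^ 2 := by rw [sq]; exact Nat.mul_le_mul h3 h3
    _ ≤ _ := by simpa only [sq] using h4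

theorem collisions_union_le [DecidableEq β] (B C : Finset β) (F : β → H) :
    collisions (B ∪ C) F ≤ 2 * (collisions B F + collisions C F) := by
  have := collisions_cover_le (B ∪ C) F (univ : Finset Bool) (fun b => cond b B C) (by
    intro x hx
    rcases mem_union.1 hx with h | h
    · exact ⟨true, mem_univ _, h⟩
    · exact ⟨false, mem_univ _, h⟩)
  simpa using this

end Collisions

section Characters

/-- Parseval's identity for the energy of a map into a finite abelian group. -/
theorem collisions_mul_card_eq {β H : Type*} [DecidableEq H] [AddCommGroup H] [Fintype H]
    (B : Finset β) (F : β → H) :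
    (collisions B F : ℝ) * Fintype.card H
      = ∑ ψ : AddChar H ℂ, ‖∑ x ∈ B, ψ (F x)‖ ^ 2 := by
  have h : ((collisions B F : ℂ)) * Fintype.card H
      = ∑ ψ : AddChar H ℂ, ((‖∑ x ∈ B, ψ (F x)‖ ^ 2 : ℝ) : ℂ) := by
    have h1 : ∀ ψ : AddChar H ℂ, ((‖∑ x ∈ B, ψ (F x)‖ ^ 2 : ℝ) : ℂ)
        = ∑ z ∈ B ×ˢ B, ψ (F z.1 - F z.2) := by
      intro ψ
      push_cast
      rw [← Complex.mul_conj', map_sum, sum_mul_sum, sum_product]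
      refine sum_congr rfl fun x _ => sum_congr rfl fun y _ => ?_
      rw [sub_eq_add_neg, AddChar.map_add_eq_mul, AddChar.map_neg_eq_conj]
    simp_rw [h1]
    rw [sum_comm]
    simp_rw [AddChar.sum_apply_eq_ite, sub_eq_zero]
    rw [← sum_filter, sum_const, nsmul_eq_mul, collisions]
  exact_mod_cast h

theorem addChar_map_sum {ι H : Type*} [AddCommGroup H] (ψ : AddChar H ℂ) (s : Finset ι)
    (f : ι → H) : ψ (∑ i ∈ s, f i) = ∏ i ∈ s, ψ (f i) := by
  classical
  induction s using Finset.induction_on with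
  | empty => simp
  | insert a s ha ih => rw [sum_insert ha, prod_insert ha, AddChar.map_add_eq_mul, ih]

/-- The case of a finite value group of `collisions_prod_le`: the character sum over a product set
factors, and the arithmetic-geometric mean inequality replaces Hölder's. -/
theorem collisions_prod_le_of_fintype {β α ι H : Type*} [DecidableEq H] [AddCommGroup H]
    [Fintype H] [Fintype ι] [DecidableEq ι] [Nonempty ι] (B : Finset β) (A : ι → Finset α)
    (Φ : β → H) (φ : α → H) (K : ℕ)
    (hK : ∀ i, collisions (B ×ˢ Fintype.piFinset fun _ : ι => A i)
      (fun z => Φ z.1 + ∑ j, φ (z.2 j)) ≤ K) :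
    collisions (B ×ˢ Fintype.piFinset A) (fun z => Φ z.1 + ∑ j, φ (z.2 j)) ≤ K := by
  have hfac : ∀ (A : ι → Finset α) (ψ : AddChar H ℂ),
      ∑ z ∈ B ×ˢ Fintype.piFinset A, ψ (Φ z.1 + ∑ j, φ (z.2 j))
        = (∑ x ∈ B, ψ (Φ x)) * ∏ i, ∑ a ∈ A i, ψ (φ a) := by
    intro A ψ
    rw [prod_univ_sum, sum_mul_sum, sum_product]
    refine sum_congr rfl fun x _ => sum_congr rfl fun u _ => ?_
    rw [AddChar.map_add_eq_mul, addChar_map_sum]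
  have hpt : ∀ ψ : AddChar H ℂ, ‖∏ i, ∑ a ∈ A i, ψ (φ a)‖ ^ 2
      ≤ (Fintype.card ι : ℝ)⁻¹ * ∑ i, ‖∏ _j : ι, ∑ a ∈ A i, ψ (φ a)‖ ^ 2 := by
    intro ψ
    have hn : (Fintype.card ι : ℝ) ≠ 0 := by simp
    have := Real.geom_mean_le_arith_mean_weighted univ (fun _ : ι => (Fintype.card ι : ℝ)⁻¹)
      (fun i => (‖∑ a ∈ A i, ψ (φ a)‖ ^ 2) ^ Fintype.card ι) (fun _ _ => by positivity)
      (by simp) (fun _ _ => by positivity)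
    rw [← mul_sum] at this
    refine le_trans (le_of_eq ?_) (this.trans (le_of_eq ?_))
    · rw [norm_prod, ← prod_pow]
      refine prod_congr rfl fun i _ => ?_
      rw [← Real.rpow_natCast _ (Fintype.card ι), ← Real.rpow_mul (by positivity),
        mul_inv_cancel₀ hn, Real.rpow_one]
    · congr 1
      refine sum_congr rfl fun i _ => ?_
      rw [prod_const, norm_pow, card_univ, ← pow_mul, ← pow_mul, mul_comm]
  have hcard : (0 : ℝ) < Fintype.card H := by exact_mod_cast Fintype.card_pos
  have hcι : (0 : ℝ) < Fintype.card ι := by exact_mod_cast Fintype.card_pos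
  have main : (collisions (B ×ˢ Fintype.piFinset A) (fun z => Φ z.1 + ∑ j, φ (z.2 j)) : ℝ)
      * Fintype.card H ≤ K * Fintype.card H := by
    rw [collisions_mul_card_eq]
    calc _ ≤ ∑ ψ : AddChar H ℂ, (Fintype.card ι : ℝ)⁻¹ *
          ∑ i, ‖∑ z ∈ B ×ˢ Fintype.piFinset (fun _ : ι => A i),
            ψ (Φ z.1 + ∑ j, φ (z.2 j))‖ ^ 2 := by
          refine sum_le_sum fun ψ _ => ?_
          simp_rw [hfac, norm_mul, mul_pow]
          rw [← mul_sum]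
          calc _ ≤ ‖∑ x ∈ B, ψ (Φ x)‖ ^ 2 * _ :=
                mul_le_mul_of_nonneg_left (hpt ψ) (by positivity)
            _ = _ := by ring
      _ = (Fintype.card ι : ℝ)⁻¹ * ∑ i, (collisions (B ×ˢ Fintype.piFinset fun _ : ι => A i)
            (fun z => Φ z.1 + ∑ j, φ (z.2 j)) : ℝ) * Fintype.card H := by
          rw [← mul_sum, sum_comm]
          simp_rw [collisions_mul_card_eq]
      _ ≤ (Fintype.card ι : ℝ)⁻¹ * ∑ _i : ι, (K : ℝ) * Fintype.card H := by
          gcongr with i _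
          exact hK i
      _ = _ := by
          rw [sum_const, card_univ, nsmul_eq_mul]
          field_simp
  exact_mod_cast le_of_mul_le_mul_right main hcard

/-- A finite set of integer vectors stays separated modulo some `M`, so that characters of finite
groups suffice to count solutions of systems over `ℤ`. -/
theorem exists_modulus_injOn {κ : Type*} [Fintype κ] (W : Finset (κ → ℤ)) :
    ∃ M : ℕ, 0 < M ∧ Set.InjOn (fun w : κ → ℤ => fun j => (w j : ZMod M)) W := by
  refine ⟨1 + ∑ w ∈ W, ∑ w' ∈ W, ∑ j, (w j - w' j).natAbs, by omega, ?_⟩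
  intro w hw w' hw' h
  funext j
  have hj := congrFun h j
  simp only at hj
  rw [ZMod.intCast_eq_intCast_iff_dvd_sub] at hj
  by_contra hne
  have h1 : (w j - w' j).natAbs ≤ ∑ j, (w j - w' j).natAbs :=
    single_le_sum (f := fun j => (w j - w' j).natAbs) (fun _ _ => Nat.zero_le _) (mem_univ j)
  have h2 : ∑ j, (w j - w' j).natAbs ≤ ∑ w' ∈ W, ∑ j, (w j - w' j).natAbs :=
    single_le_sum (f := fun w' => ∑ j, (w j - w' j).natAbs) (fun _ _ => Nat.zero_le _) hw'
  have h3 : ∑ w' ∈ W, ∑ j, (w j - w' j).natAbs ≤ ∑ w ∈ W, ∑ w' ∈ W, ∑ j, (w j - w' j).natAbs :=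
    single_le_sum (f := fun w => ∑ w' ∈ W, ∑ j, (w j - w' j).natAbs)
      (fun _ _ => Nat.zero_le _) hw
  have hdvd := Int.natAbs_dvd_natAbs.2 hj
  rw [Int.natAbs_natCast, ← Int.natAbs_neg, neg_sub] at hdvd
  have := Nat.le_of_dvd (by omega) hdvd
  omega

/-- Hölder's inequality for energies: a product of different sets has at most the largest of the
energies obtained by repeating one of them. -/
theorem collisions_prod_le {β α ι κ : Type*} [Fintype κ] [DecidableEq κ] [Fintype ι]
    [DecidableEq ι] [Nonempty ι] (B : Finset β) (A : ι → Finset α)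
    (Φ : β → κ → ℤ) (φ : α → κ → ℤ) (K : ℕ)
    (hK : ∀ i, collisions (B ×ˢ Fintype.piFinset fun _ : ι => A i)
      (fun z => Φ z.1 + ∑ j, φ (z.2 j)) ≤ K) :
    collisions (B ×ˢ Fintype.piFinset A) (fun z => Φ z.1 + ∑ j, φ (z.2 j)) ≤ K := by
  classical
  obtain ⟨M, hM, hinj⟩ := exists_modulus_injOn
    (univ.biUnion fun i => (B ×ˢ Fintype.piFinset fun _ : ι => A i).image
      (fun z => Φ z.1 + ∑ j, φ (z.2 j)))
  have : NeZero M := ⟨hM.ne'⟩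
  let ρ : (κ → ℤ) →+ (κ → ZMod M) :=
    { toFun := fun w j => (w j : ZMod M)
      map_zero' := by ext; simp
      map_add' := by intros; ext; simp }
  have hρ : ∀ z : β × (ι → α), ρ (Φ z.1) + ∑ j, ρ (φ (z.2 j)) = ρ (Φ z.1 + ∑ j, φ (z.2 j)) := by
    intro z
    rw [map_add, map_sum]
  have h1 := collisions_prod_le_of_fintype B A (fun x => ρ (Φ x)) (fun a => ρ (φ a)) K (by
    intro i
    refine le_trans ?_ (hK i)
    refine collisions_le_of_injOn id (fun x hx => hx) (Set.injOn_id _) ?_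
    intro x hx y hy hxy
    rw [hρ, hρ] at hxy
    refine hinj ?_ ?_ hxy
    · exact mem_coe.2 (mem_biUnion.2 ⟨i, mem_univ _, mem_image_of_mem _ hx⟩)
    · exact mem_coe.2 (mem_biUnion.2 ⟨i, mem_univ _, mem_image_of_mem _ hy⟩))
  refine le_trans ?_ h1
  refine collisions_le_of_injOn id (fun x hx => hx) (Set.injOn_id _) ?_
  intro x hx y hy hxy
  rw [hρ, hρ]
  exact congrArg ρ hxy

end Characters

end Vinogradov

/-! ### Newton's identities and Linnik's lemma -/

namespace Vinogradov

section Newton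

/-- If `1, …, #σ` are invertible, the power sums determine the elementary symmetric functions
(Newton's identities). -/
theorem esymm_eq_of_psum_eq {σ R : Type*} [Fintype σ] [CommRing R]
    (hu : ∀ j : ℕ, 1 ≤ j → j ≤ Fintype.card σ → IsUnit (j : R)) (x y : σ → R)
    (h : ∀ j, 1 ≤ j → j ≤ Fintype.card σ → ∑ i, x i ^ j = ∑ i, y i ^ j) (j : ℕ)
    (hj : j ≤ Fintype.card σ) :
    MvPolynomial.aeval x (MvPolynomial.esymm σ R j)
      = MvPolynomial.aeval y (MvPolynomial.esymm σ R j) := by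
  induction j using Nat.strong_induction_on with
  | _ j ih =>
    rcases Nat.eq_zero_or_pos j with rfl | hpos
    · simp
    have hN : ∀ z : σ → R, (j : R) * MvPolynomial.aeval z (MvPolynomial.esymm σ R j)
        = (-1) ^ (j + 1) * ∑ a ∈ antidiagonal j with a.1 < j,
          (-1) ^ a.1 * MvPolynomial.aeval z (MvPolynomial.esymm σ R a.1) * ∑ i, z i ^ a.2 := by
      intro z
      have := congrArg (MvPolynomial.aeval z) (MvPolynomial.mul_esymm_eq_sum σ R j)
      simpa [MvPolynomial.psum] using this
    refine (hu j hpos hj).mul_left_cancel ?_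
    rw [hN x, hN y]
    congr 1
    refine sum_congr rfl fun a ha => ?_
    simp only [mem_filter, HasAntidiagonal.mem_antidiagonal] at ha
    rw [ih a.1 ha.2 (by omega), h a.2 (by omega) (by omega)]

/-- If the power sums of `x` and `y` agree, `∏ (t - x i)` and `∏ (t - y i)` are the same polynomial,
which therefore vanishes at each `y a`. -/
theorem prod_sub_eq_zero_of_psum_eq {σ R : Type*} [Fintype σ] [CommRing R]
    (hu : ∀ j : ℕ, 1 ≤ j → j ≤ Fintype.card σ → IsUnit (j : R)) (x y : σ → R)
    (h : ∀ j, 1 ≤ j → j ≤ Fintype.card σ → ∑ i, x i ^ j = ∑ i, y i ^ j) (a : σ) :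
    ∏ i, (y a - x i) = 0 := by
  have hP : ∀ z : σ → R, ∏ i, (y a - z i) = ∑ j ∈ range (Fintype.card σ + 1),
      (-1) ^ j * (MvPolynomial.aeval z (MvPolynomial.esymm σ R j)
        * y a ^ (Fintype.card σ - j)) := by
    intro z
    have := congrArg (Polynomial.eval (y a))
      (Multiset.prod_X_sub_X_eq_sum_esymm (univ.val.map z))
    simp only [Multiset.map_map, Multiset.card_map, Polynomial.eval_finsetSum,
      Polynomial.eval_mul, Polynomial.eval_pow, Polynomial.eval_neg, Polynomial.eval_one,
      Polynomial.eval_C, Polynomial.eval_X] at this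
    simp_rw [MvPolynomial.aeval_esymm_eq_multiset_esymm]
    rw [show Multiset.card (univ : Finset σ).val = Fintype.card σ from rfl] at this
    rw [← this, Polynomial.eval_multiset_prod, Multiset.map_map]
    exact congrArg Multiset.prod (Multiset.map_congr rfl fun i _ => by simp)
  have hxy : ∏ i, (y a - x i) = ∏ i, (y a - y i) := by
    rw [hP x, hP y]
    refine sum_congr rfl fun j hj => ?_
    rw [esymm_eq_of_psum_eq hu x y h j (by simpa [Nat.lt_succ_iff] using hj)]
  rw [hxy]
  exact prod_eq_zero (mem_univ a) (sub_self _)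

end Newton

section Linnik

/-- If a prime power divides a product of integers of which at most one is divisible by the prime,
it divides one of the factors. -/
theorem exists_pow_dvd_of_pow_dvd_prod {ι : Type*} (s : Finset ι) (f : ι → ℤ) (p n : ℕ)
    (hp : p.Prime) (hn : 0 < n) (hdis : ∀ i ∈ s, ∀ j ∈ s, (p : ℤ) ∣ f i → (p : ℤ) ∣ f j → i = j)
    (h : (p : ℤ) ^ n ∣ ∏ i ∈ s, f i) : ∃ i ∈ s, (p : ℤ) ^ n ∣ f i := by
  classical
  have hpi : Prime (p : ℤ) := Nat.prime_iff_prime_int.1 hp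
  obtain ⟨i, hi, hpf⟩ := hpi.exists_mem_finset_dvd ((dvd_pow_self _ hn.ne').trans h)
  refine ⟨i, hi, ?_⟩
  rw [← mul_prod_erase s f hi] at h
  refine IsCoprime.dvd_of_dvd_mul_right ?_ h
  refine IsCoprime.pow_left (IsCoprime.prod_right fun j hj => ?_)
  rw [mem_erase] at hj
  exact (Prime.coprime_iff_not_dvd hpi).2 fun hd => hj.1 (hdis j hj.2 i hi hd hpf)

/-- If `x` is pairwise incongruent modulo `p` and shares its power sums modulo `p ^ k` with `y`,
every entry of `y` is congruent modulo `p ^ k` to an entry of `x`. -/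
theorem exists_modEq_of_psum_modEq (k p : ℕ) (hp : p.Prime) (hk : 0 < k) (hkp : k < p)
    (x y : Fin k → ℤ) (hx : ∀ i j, (p : ℤ) ∣ x i - x j → i = j)
    (h : ∀ j, 1 ≤ j → j ≤ k → (p : ℤ) ^ k ∣ ∑ i, x i ^ j - ∑ i, y i ^ j) (a : Fin k) :
    ∃ i, (p : ℤ) ^ k ∣ y a - x i := by
  have hz := prod_sub_eq_zero_of_psum_eq (R := ZMod (p ^ k)) (σ := Fin k)
    (fun j h1 h2 => by
      rw [Fintype.card_fin] at h2
      rw [ZMod.isUnit_iff_coprime]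
      refine Nat.Coprime.pow_right _ (Nat.Coprime.symm ((Nat.Prime.coprime_iff_not_dvd hp).2 ?_))
      exact Nat.not_dvd_of_pos_of_lt h1 (by omega))
    (fun i => (x i : ZMod (p ^ k))) (fun i => (y i : ZMod (p ^ k)))
    (fun j h1 h2 => by
      rw [Fintype.card_fin] at h2
      have := h j h1 h2
      rw [← Nat.cast_pow, ← ZMod.intCast_zmod_eq_zero_iff_dvd] at this
      push_cast at this
      exact sub_eq_zero.1 this) a
  have hdvd : (p : ℤ) ^ k ∣ ∏ i, (y a - x i) := by
    rw [← Nat.cast_pow, ← ZMod.intCast_zmod_eq_zero_iff_dvd]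
    push_cast
    exact hz
  obtain ⟨i, -, hi⟩ := exists_pow_dvd_of_pow_dvd_prod univ (fun i => y a - x i) p k hp hk
    (fun i _ j _ h1 h2 => hx i j (by
      have := dvd_sub h2 h1
      simpa using this)) hdvd
  exact ⟨i, hi⟩

/-- Linnik's lemma: the number of `k`-tuples, pairwise incongruent modulo `p` and confined to
residue representatives modulo `p ^ k`, whose `j`-th shifted power sum is prescribed modulo `p ^ j`
for `1 ≤ j ≤ k`. -/
theorem card_psum_modEq_le (k p X : ℕ) (hp : p.Prime) (hk : 0 < k) (hkp : k < p)
    (hX : X ≤ p ^ k) (r : ℤ) (c : Fin k → ℤ) (B : Finset (Fin k → ℤ))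
    (hB : ∀ x ∈ B, (∀ i, x i ∈ Ico (0 : ℤ) X) ∧ ∀ i j, (p : ℤ) ∣ x i - x j → i = j)
    (hc : ∀ x ∈ B, ∀ j : Fin k,
      (p : ℤ) ^ (j.val + 1) ∣ ∑ i, (x i - r) ^ (j.val + 1) - c j) :
    #B ≤ k ^ k * p ^ (k * (k - 1) / 2) := by
  classical
  have hp0 : (0 : ℤ) < p := by exact_mod_cast hp.pos
  set W : Finset (Fin k → ℕ) := Fintype.piFinset fun j : Fin k => range (p ^ (k - (j.val + 1)))
  let w : (Fin k → ℤ) → Fin k → ℕ := fun x j =>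
    (((∑ i, (x i - r) ^ (j.val + 1) - c j) / (p : ℤ) ^ (j.val + 1)) %
      (p : ℤ) ^ (k - (j.val + 1))).toNat
  have hw : ∀ x ∈ B, w x ∈ W := by
    intro x _
    rw [Fintype.mem_piFinset]
    intro j
    rw [mem_range]
    have h1 := Int.emod_lt_of_pos ((∑ i, (x i - r) ^ (j.val + 1) - c j) / (p : ℤ) ^ (j.val + 1))
      (pow_pos hp0 (k - (j.val + 1)))
    have h2 := Int.emod_nonneg ((∑ i, (x i - r) ^ (j.val + 1) - c j) / (p : ℤ) ^ (j.val + 1))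
      (pow_pos hp0 (k - (j.val + 1))).ne'
    zify
    rw [Int.toNat_of_nonneg h2]
    exact h1
  have hWcard : #W = p ^ (k * (k - 1) / 2) := by
    rw [Fintype.card_piFinset]
    simp only [card_range]
    rw [prod_pow_eq_pow_sum]
    congr 1
    rw [← Finset.sum_range_id, ← Fin.sum_univ_eq_sum_range (fun i => i) k]
    refine Fintype.sum_equiv Fin.revPerm _ _ fun i => ?_
    simp [Fin.val_rev]
  have hfib : ∀ v ∈ W, #{x ∈ B | w x = v} ≤ k ^ k := by
    intro v _
    rcases (filter (fun x => w x = v) B).eq_empty_or_nonempty with he | ⟨x₀, hx₀⟩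
    · rw [he]; simp
    rw [mem_filter] at hx₀
    have hroot : ∀ x ∈ ({x ∈ B | w x = v} : Finset _), ∀ a, ∃ i, x a = x₀ i := by
      intro x hx a
      rw [mem_filter] at hx
      obtain ⟨i, hi⟩ := exists_modEq_of_psum_modEq k p hp hk hkp (fun i => x₀ i - r)
        (fun i => x i - r) (fun i j hij => (hB x₀ hx₀.1).2 i j (by simpa using hij)) (by
          intro j h1 h2
          obtain ⟨j, rfl⟩ : ∃ j', j = j' + 1 := ⟨j - 1, by omega⟩
          have hv := congrFun (hx₀.2.trans hx.2.symm) ⟨j, by omega⟩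
          simp only [w] at hv
          have hpp := pow_pos hp0 (k - (j + 1))
          have hv' := congrArg (Nat.cast (R := ℤ)) hv
          rw [Int.toNat_of_nonneg (Int.emod_nonneg _ hpp.ne'),
            Int.toNat_of_nonneg (Int.emod_nonneg _ hpp.ne')] at hv'
          obtain ⟨u, hu⟩ := hc x₀ hx₀.1 ⟨j, by omega⟩
          obtain ⟨u', hu'⟩ := hc x hx.1 ⟨j, by omega⟩
          simp only at hu hu'
          rw [hu, hu', Int.mul_ediv_cancel_left _ (pow_pos hp0 _).ne',
            Int.mul_ediv_cancel_left _ (pow_pos hp0 _).ne'] at hv'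
          obtain ⟨t, ht⟩ := (Int.ModEq.symm hv').dvd
          refine ⟨t, ?_⟩
          have hpk : (p : ℤ) ^ k = (p : ℤ) ^ (j + 1) * (p : ℤ) ^ (k - (j + 1)) := by
            rw [← pow_add]
            congr 1
            omega
          rw [hpk, mul_assoc, ← ht]
          linear_combination hu - hu') a
      refine ⟨i, ?_⟩
      have hlt := (mem_Ico.1 ((hB x hx.1).1 a))
      have hlt' := (mem_Ico.1 ((hB x₀ hx₀.1).1 i))
      have hXp : (X : ℤ) ≤ (p : ℤ) ^ k := by exact_mod_cast hX
      have habs : |x a - x₀ i| < (p : ℤ) ^ k := by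
        rw [abs_lt]; constructor <;> linarith
      have := Int.eq_zero_of_abs_lt_dvd (by simpa using hi) habs
      linarith
    choose! g hg using hroot
    calc #{x ∈ B | w x = v} ≤ #(univ : Finset (Fin k → Fin k)) := by
          refine card_le_card_of_injOn (fun x a => g x a) (fun _ _ => mem_univ _) ?_
          intro x hx y hy hxy
          funext a
          rw [hg x hx a, hg y hy a]
          exact congrArg x₀ (congrFun hxy a)
      _ = k ^ k := by simp
  calc #B = ∑ v ∈ W, #{x ∈ B | w x = v} := card_eq_sum_card_fiberwise fun x hx => hw x hx
    _ ≤ ∑ v ∈ W, k ^ k := sum_le_sum hfib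
    _ = _ := by rw [sum_const, hWcard, smul_eq_mul, mul_comm]

end Linnik

end Vinogradov

/-! ### Linnik's recursion for Vinogradov's mean value -/

namespace Vinogradov

/-- The vector `(x, x², …, x ^ k)`; the coordinate with index `j` is `x ^ (j + 1)`. -/
def powers (k : ℕ) (x : ℤ) : Fin k → ℤ := fun j => x ^ (j.val + 1)

/-- Vinogradov's mean value `J_{s,k}(X)`: the number of solutions of
`x₁ ^ j + ⋯ + x_s ^ j = y₁ ^ j + ⋯ + y_s ^ j` for `1 ≤ j ≤ k`, in integers `0 ≤ xᵢ, yᵢ < X`. -/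
noncomputable def meanValue (k s X : ℕ) : ℕ :=
  collisions (Fintype.piFinset fun _ : Fin s => Ico (0 : ℤ) X) (fun x => ∑ i, powers k (x i))

theorem sum_powers_apply {ι : Type*} [Fintype ι] (k : ℕ) (x : ι → ℤ) (j : Fin k) :
    (∑ i, powers k (x i)) j = ∑ i, x i ^ (j.val + 1) := by
  simp [powers]

theorem meanValue_le_pow (k s X : ℕ) : meanValue k s X ≤ X ^ (2 * s) := by
  refine (collisions_le_card_sq _ _).trans (le_of_eq ?_)
  rw [Fintype.card_piFinset]
  simp [← pow_mul, mul_comm]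

/-- Translation invariance of the system of power sums. -/
theorem sum_sub_pow_eq {ι : Type*} [Fintype ι] (k : ℕ) (x y : ι → ℤ)
    (h : ∑ i, powers k (x i) = ∑ i, powers k (y i)) (r : ℤ) (j : ℕ) (hj : j ≤ k) :
    ∑ i, (x i - r) ^ j = ∑ i, (y i - r) ^ j := by
  have hp : ∀ n ≤ k, ∑ i, x i ^ n = ∑ i, y i ^ n := by
    intro n hn
    rcases Nat.eq_zero_or_pos n with rfl | hpos
    · simp
    · have := congrFun h ⟨n - 1, by omega⟩
      rw [sum_powers_apply, sum_powers_apply] at this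
      simpa [Nat.sub_add_cancel hpos] using this
  have hexp : ∀ z : ι → ℤ, ∑ i, (z i - r) ^ j
      = ∑ n ∈ range (j + 1), (∑ i, z i ^ n) * ((-r) ^ (j - n) * (j.choose n : ℤ)) := by
    intro z
    simp_rw [sub_eq_add_neg, add_pow]
    rw [sum_comm]
    refine sum_congr rfl fun n _ => ?_
    rw [sum_mul]
    exact sum_congr rfl fun i _ => by ring
  rw [hexp x, hexp y]
  refine sum_congr rfl fun n hn => ?_
  rw [hp n (by have := mem_range.1 hn; omega)]

section Classes

/-- The integers of `[0, X)` in the residue class `r` modulo `p`. -/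
noncomputable def residueClass (p X : ℕ) (r : ZMod p) : Finset ℤ :=
  {a ∈ Ico (0 : ℤ) X | (a : ZMod p) = r}

theorem mem_residueClass {p X : ℕ} [NeZero p] {r : ZMod p} {a : ℤ} (ha : a ∈ residueClass p X r) :
    a ∈ Ico (0 : ℤ) X ∧ a = r.val + p * (a / p) := by
  obtain ⟨h1, h2⟩ := mem_filter.1 ha
  refine ⟨h1, ?_⟩
  rw [← h2, ZMod.val_intCast]
  exact (Int.emod_add_mul_ediv a p).symm

/-- A residue class contributes at most the mean value of a shorter interval, by invariance under
affine maps. -/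
theorem collisions_residueClass_le (k s p X Y : ℕ) [NeZero p] (hXY : X ≤ p * Y) (r : ZMod p) :
    collisions (Fintype.piFinset fun _ : Fin s => residueClass p X r)
      (fun x => ∑ i, powers k (x i)) ≤ meanValue k s Y := by
  have hp : (0 : ℤ) < p := by exact_mod_cast NeZero.pos p
  refine collisions_le_of_injOn (fun x i => x i / (p : ℤ)) ?_ ?_ ?_
  · intro x hx
    rw [Fintype.mem_piFinset] at hx ⊢
    intro i
    obtain ⟨h1, -⟩ := mem_residueClass (hx i)
    rw [mem_Ico] at h1 ⊢
    refine ⟨Int.ediv_nonneg h1.1 hp.le, Int.ediv_lt_of_lt_mul hp ?_⟩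
    have : (X : ℤ) ≤ p * Y := by exact_mod_cast hXY
    linarith [mul_comm (p : ℤ) Y]
  · intro x hx y hy hxy
    have hx := Fintype.mem_piFinset.1 (mem_coe.1 hx)
    have hy := Fintype.mem_piFinset.1 (mem_coe.1 hy)
    funext i
    rw [(mem_residueClass (hx i)).2, (mem_residueClass (hy i)).2]
    rw [show x i / (p : ℤ) = y i / (p : ℤ) from congrFun hxy i]
  · intro x hx y hy hxy
    rw [Fintype.mem_piFinset] at hx hy
    funext j
    rw [sum_powers_apply, sum_powers_apply]
    have := sum_sub_pow_eq k x y hxy r.val (j.val + 1) (by omega)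
    have hz : ∀ z : Fin s → ℤ, (∀ i, z i ∈ residueClass p X r) →
        ∑ i, (z i - (r.val : ℤ)) ^ (j.val + 1)
          = (p : ℤ) ^ (j.val + 1) * ∑ i, (z i / (p : ℤ)) ^ (j.val + 1) := by
      intro z hz
      rw [mul_sum]
      refine sum_congr rfl fun i _ => ?_
      rw [← mul_pow]
      congr 1
      linarith [(mem_residueClass (hz i)).2]
    rw [hz x hx, hz y hy] at this
    exact mul_left_cancel₀ (pow_pos hp _).ne' this

end Classes

section Recursion

/-- The `k`-tuples from `[0, X)` that are pairwise incongruent modulo `p`. -/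
noncomputable def incongruentTuples (k p X : ℕ) : Finset (Fin k → ℤ) :=
  {x ∈ Fintype.piFinset fun _ : Fin k => Ico (0 : ℤ) X | ∀ i j, (p : ℤ) ∣ x i - x j → i = j}

/-- The energy of the tuples consisting of `k` entries `x` that are incongruent modulo `p` and `m`
entries in one residue class `r`. After the shift by `r` the `j`-th power sums of the latter are
divisible by `p ^ j`, so those of the two tuples `x` occurring in a solution agree modulo `p ^ j`,
which `card_psum_modEq_le` controls. -/
theorem collisions_incongruent_class_le (k m p X Y : ℕ) (hp : p.Prime) (hk : 0 < k) (hkp : k < p)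
    (hX : X ≤ p ^ k) (hXY : X ≤ p * Y) (r : ZMod p) :
    collisions (incongruentTuples k p X ×ˢ Fintype.piFinset fun _ : Fin m => residueClass p X r)
      (fun z => ∑ i, powers k (z.1 i) + ∑ j, powers k (z.2 j))
      ≤ meanValue k m Y * (X ^ k * (k ^ k * p ^ (k * (k - 1) / 2))) := by
  classical
  have : NeZero p := ⟨hp.ne_zero⟩
  set B := incongruentTuples k p X with hB
  set A := Fintype.piFinset fun _ : Fin m => residueClass p X r with hA
  set P : Finset ((Fin k → ℤ) × (Fin k → ℤ)) := {z ∈ B ×ˢ B | ∀ j : Fin k,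
    (p : ℤ) ^ (j.val + 1) ∣ ∑ i, (z.1 i - (r.val : ℤ)) ^ (j.val + 1)
      - ∑ i, (z.2 i - (r.val : ℤ)) ^ (j.val + 1)} with hP
  have hPcard : #P ≤ X ^ k * (k ^ k * p ^ (k * (k - 1) / 2)) := by
    rw [mul_comm]
    have hBX : #B ≤ X ^ k := by
      refine (card_filter_le _ _).trans (le_of_eq ?_)
      rw [Fintype.card_piFinset]
      simp
    refine le_trans (card_le_mul_card_image_of_maps_to (f := Prod.snd) (t := B) ?_
      (k ^ k * p ^ (k * (k - 1) / 2)) ?_) (Nat.mul_le_mul_left _ hBX)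
    · intro z hz
      exact (mem_product.1 (mem_filter.1 hz).1).2
    · intro y hy
      refine le_trans (card_le_card_of_injOn (t := {x ∈ B | ∀ j : Fin k,
        (p : ℤ) ^ (j.val + 1) ∣ ∑ i, (x i - (r.val : ℤ)) ^ (j.val + 1)
          - ∑ i, (y i - (r.val : ℤ)) ^ (j.val + 1)}) Prod.fst ?_ ?_)
        (card_psum_modEq_le k p X hp hk hkp hX (r.val : ℤ)
          (fun j => ∑ i, (y i - (r.val : ℤ)) ^ (j.val + 1)) _ ?_ ?_)
      · rintro ⟨x, y'⟩ hz
        obtain ⟨hz1, rfl⟩ := mem_filter.1 (mem_coe.1 hz)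
        obtain ⟨hz2, hz3⟩ := mem_filter.1 hz1
        exact mem_coe.2 (mem_filter.2 ⟨(mem_product.1 hz2).1, hz3⟩)
      · rintro ⟨x, y'⟩ hz ⟨x', y''⟩ hz' h
        obtain ⟨-, h1⟩ := mem_filter.1 (mem_coe.1 hz)
        obtain ⟨-, h2⟩ := mem_filter.1 (mem_coe.1 hz')
        exact Prod.ext h (h1.trans h2.symm)
      · intro x hx
        obtain ⟨h1, h2⟩ := mem_filter.1 (mem_filter.1 hx).1
        exact ⟨Fintype.mem_piFinset.1 h1, h2⟩
      · intro x hx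
        exact (mem_filter.1 hx).2
  refine le_trans (card_le_mul_card_image_of_maps_to
    (f := fun z => (z.1.1, z.2.1)) (t := P) ?_ (meanValue k m Y) ?_)
    (Nat.mul_le_mul_left _ hPcard)
  · rintro ⟨⟨x, u⟩, ⟨y, v⟩⟩ hz
    obtain ⟨hz1, hz2⟩ := mem_filter.1 hz
    simp only [mem_product] at hz1 hz2
    refine mem_filter.2 ⟨mem_product.2 ⟨hz1.1.1, hz1.2.1⟩, fun j => ?_⟩
    have h1 := sum_sub_pow_eq k (Sum.elim x u) (Sum.elim y v) (by
      simpa only [Fintype.sum_sum_type, Sum.elim_inl, Sum.elim_inr] using hz2)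
      r.val (j.val + 1) (by omega)
    simp only [Fintype.sum_sum_type, Sum.elim_inl, Sum.elim_inr] at h1
    have h2 : ∀ u ∈ A, (p : ℤ) ^ (j.val + 1) ∣ ∑ i, (u i - (r.val : ℤ)) ^ (j.val + 1) := by
      intro u hu
      refine dvd_sum fun i _ => pow_dvd_pow_of_dvd ?_ _
      have := (mem_residueClass (Fintype.mem_piFinset.1 hu i)).2
      exact ⟨u i / p, by linarith⟩
    have h3 : ∑ i, (x i - (r.val : ℤ)) ^ (j.val + 1) - ∑ i, (y i - (r.val : ℤ)) ^ (j.val + 1)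
        = ∑ i, (v i - (r.val : ℤ)) ^ (j.val + 1) - ∑ i, (u i - (r.val : ℤ)) ^ (j.val + 1) := by
      linarith
    simp only
    rw [h3]
    exact dvd_sub (h2 v hz1.2.2) (h2 u hz1.1.2)
  · rintro ⟨x, y⟩ -
    refine le_trans ?_ ((card_shifted_le_collisions A (fun u => ∑ i, powers k (u i))
      (∑ i, powers k (y i) - ∑ i, powers k (x i))).trans
        (collisions_residueClass_le k m p X Y hXY r))
    refine card_le_card_of_injOn (fun z => (z.1.2, z.2.2)) ?_ ?_
    · rintro ⟨⟨x', u⟩, ⟨y', v⟩⟩ hz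
      obtain ⟨hz1, hz2⟩ := mem_filter.1 (mem_coe.1 hz)
      obtain ⟨hz3, hz4⟩ := mem_filter.1 hz1
      simp only [mem_product, Prod.mk.injEq] at hz2 hz3 hz4
      obtain ⟨rfl, rfl⟩ := hz2
      refine mem_coe.2 (mem_filter.2 ⟨mem_product.2 ⟨hz3.1.2, hz3.2.2⟩, ?_⟩)
      simp only
      rw [← sub_eq_zero] at hz4 ⊢
      rw [← hz4]
      abel
    · rintro ⟨⟨x', u⟩, ⟨y', v⟩⟩ hz ⟨⟨x'', u'⟩, ⟨y'', v'⟩⟩ hz' h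
      have h1 := (mem_filter.1 (mem_coe.1 hz)).2
      have h2 := (mem_filter.1 (mem_coe.1 hz')).2
      simp only [Prod.mk.injEq] at h h1 h2 ⊢
      exact ⟨⟨h1.1.trans h2.1.symm, h.1⟩, h1.2.trans h2.2.symm, h.2⟩

/-- The residue classes of the `m` unrestricted entries are made equal by `collisions_prod_le`,
after a covering by `p ^ m` patterns. -/
theorem collisions_incongruent_le (k m p X Y : ℕ) (hp : p.Prime) (hk : 0 < k) (hkp : k < p)
    (hm : 0 < m) (hX : X ≤ p ^ k) (hXY : X ≤ p * Y) :
    collisions (incongruentTuples k p X ×ˢ Fintype.piFinset fun _ : Fin m => Ico (0 : ℤ) X)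
      (fun z => ∑ i, powers k (z.1 i) + ∑ j, powers k (z.2 j))
      ≤ p ^ (2 * m) * (meanValue k m Y * (X ^ k * (k ^ k * p ^ (k * (k - 1) / 2)))) := by
  classical
  have : NeZero p := ⟨hp.ne_zero⟩
  have : Nonempty (Fin m) := ⟨⟨0, hm⟩⟩
  refine (collisions_cover_le _ _ (univ : Finset (Fin m → ZMod p))
    (fun ρ => incongruentTuples k p X ×ˢ Fintype.piFinset fun i => residueClass p X (ρ i))
    ?_).trans ?_
  · rintro ⟨x, u⟩ hz
    obtain ⟨h1, h2⟩ := mem_product.1 hz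
    rw [Fintype.mem_piFinset] at h2
    refine ⟨fun i => (u i : ZMod p), mem_univ _, mem_product.2 ⟨h1, ?_⟩⟩
    rw [Fintype.mem_piFinset]
    exact fun i => mem_filter.2 ⟨h2 i, rfl⟩
  · calc _ ≤ #(univ : Finset (Fin m → ZMod p)) * ∑ _ρ : Fin m → ZMod p,
          (meanValue k m Y * (X ^ k * (k ^ k * p ^ (k * (k - 1) / 2)))) := by
          refine Nat.mul_le_mul_left _ (sum_le_sum fun ρ _ => ?_)
          exact collisions_prod_le (incongruentTuples k p X) (fun i => residueClass p X (ρ i))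
            (fun x => ∑ i, powers k (x i)) (powers k) _ fun i =>
              collisions_incongruent_class_le k m p X Y hp hk hkp hX hXY (ρ i)
      _ = _ := by
          rw [sum_const, smul_eq_mul, card_univ, Fintype.card_fun, ZMod.card, Fintype.card_fin]
          ring

/-- `k` chosen positions among `k + m` can be moved to the front. -/
theorem exists_sumEquiv (k m : ℕ) (T : Fin k ↪ Fin (k + m)) :
    ∃ e : Fin k ⊕ Fin m ≃ Fin (k + m), ∀ i, e (Sum.inl i) = T i := by
  classical
  have hcard : Fintype.card {i // i ∉ Set.range T} = m := by
    rw [Fintype.card_subtype_compl, Fintype.card_fin]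
    have : Fintype.card {i // i ∈ Set.range T} = k := by
      have h := Fintype.card_congr (Equiv.ofInjective T T.injective)
      rw [Fintype.card_fin] at h
      exact h.symm
    omega
  refine ⟨(Equiv.sumCongr (Equiv.ofInjective T T.injective)
    (Fintype.equivFinOfCardEq hcard).symm).trans
      (Equiv.sumCompl (fun i => i ∈ Set.range T)), fun i => ?_⟩
  simp

/-- The same bound when the `k` incongruent entries stand at prescribed positions. -/
theorem collisions_position_le (k m p X Y : ℕ) (hp : p.Prime) (hk : 0 < k) (hkp : k < p)
    (hm : 0 < m) (hX : X ≤ p ^ k) (hXY : X ≤ p * Y) (T : Fin k ↪ Fin (k + m)) :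
    collisions {x ∈ Fintype.piFinset fun _ : Fin (k + m) => Ico (0 : ℤ) X |
        ∀ i j, (p : ℤ) ∣ x (T i) - x (T j) → i = j} (fun x => ∑ i, powers k (x i))
      ≤ p ^ (2 * m) * (meanValue k m Y * (X ^ k * (k ^ k * p ^ (k * (k - 1) / 2)))) := by
  obtain ⟨e, he⟩ := exists_sumEquiv k m T
  refine le_trans ?_ (collisions_incongruent_le k m p X Y hp hk hkp hm hX hXY)
  have hsum : ∀ x : Fin (k + m) → ℤ, ∑ i, powers k (x i)
      = ∑ i, powers k (x (e (Sum.inl i))) + ∑ j, powers k (x (e (Sum.inr j))) := by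
    intro x
    rw [← Fintype.sum_sum_type (f := fun i => powers k (x (e i)))]
    exact (Equiv.sum_comp e fun i => powers k (x i)).symm
  refine collisions_le_of_injOn
    (fun x => (fun i => x (e (Sum.inl i)), fun j => x (e (Sum.inr j)))) ?_ ?_ ?_
  · intro x hx
    obtain ⟨h1, h2⟩ := mem_filter.1 hx
    rw [Fintype.mem_piFinset] at h1
    refine mem_product.2 ⟨mem_filter.2 ⟨Fintype.mem_piFinset.2 fun i => h1 _, ?_⟩,
      Fintype.mem_piFinset.2 fun i => h1 _⟩
    intro i j hij
    simp only [he] at hij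
    exact h2 i j hij
  · intro x _ y _ hxy
    simp only [Prod.mk.injEq] at hxy
    funext i
    obtain ⟨z, rfl⟩ := e.surjective i
    rcases z with z | z
    · exact congrFun hxy.1 z
    · exact congrFun hxy.2 z
  · intro x _ y _ hxy
    simp only
    rw [← hsum, ← hsum, hxy]

/-- Prescribing the residue class of every entry reduces to a mean value of a shorter interval. -/
theorem collisions_pattern_le (k s p X Y : ℕ) (hp : p.Prime) (hs : 0 < s) (hXY : X ≤ p * Y)
    (ρ : Fin s → ZMod p) :
    collisions (Fintype.piFinset fun i => residueClass p X (ρ i))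
      (fun x => ∑ i, powers k (x i)) ≤ meanValue k s Y := by
  classical
  have : NeZero p := ⟨hp.ne_zero⟩
  have : Nonempty (Fin s) := ⟨⟨0, hs⟩⟩
  have hred : ∀ (r : Fin s → ZMod p) (r' : Fin s → ZMod p), r = r' →
      collisions (({()} : Finset Unit) ×ˢ Fintype.piFinset fun i => residueClass p X (r i))
      (fun z => (fun _ => 0 : Unit → Fin k → ℤ) z.1 + ∑ j, powers k (z.2 j))
      ≤ collisions (Fintype.piFinset fun i => residueClass p X (r' i))
      (fun x => ∑ i, powers k (x i)) := by
    rintro r _ rfl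
    refine collisions_le_of_injOn Prod.snd (fun z hz => (mem_product.1 hz).2) ?_ ?_
    · intro x _ y _ h
      exact Prod.ext rfl h
    · intro x _ y _ h
      simpa using h
  refine le_trans ?_ (collisions_prod_le ({()} : Finset Unit) (fun i => residueClass p X (ρ i))
    (fun _ => 0) (powers k) _ fun i => (hred (fun _ => ρ i) _ rfl).trans
      (collisions_residueClass_le k s p X Y hXY (ρ i)))
  refine collisions_le_of_injOn (fun x => ((), x)) (fun x hx => mem_product.2 ⟨by simp, hx⟩) ?_ ?_
  · intro x _ y _ h
    exact (Prod.mk.injEq _ _ _ _ ▸ h).2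
  · intro x _ y _ h
    simpa using h

/-- Linnik's recursion for the mean value. Tuples that meet at least `k` residue classes modulo
`p` are covered by the choices of `k` incongruent positions; the others are covered by the
comparatively few patterns with at most `k` residues. -/
theorem meanValue_recursion (k m p X Y : ℕ) (hp : p.Prime) (hk : 0 < k) (hkp : k < p)
    (hm : 0 < m) (hX : X ≤ p ^ k) (hXY : X ≤ p * Y) :
    meanValue k (k + m) X ≤ 2 * ((k + m) ^ (2 * k) *
        (p ^ (2 * m) * (meanValue k m Y * (X ^ k * (k ^ k * p ^ (k * (k - 1) / 2)))))
      + (p ^ k * k ^ (k + m)) ^ 2 * meanValue k (k + m) Y) := by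
  classical
  have : NeZero p := ⟨hp.ne_zero⟩
  set A := Fintype.piFinset fun _ : Fin (k + m) => Ico (0 : ℤ) X with hA
  set F : (Fin (k + m) → ℤ) → Fin k → ℤ := fun x => ∑ i, powers k (x i)
  set G : Finset (Fin (k + m) → ℤ) := {x ∈ A | ∃ T : Fin k ↪ Fin (k + m),
    ∀ i j, (p : ℤ) ∣ x (T i) - x (T j) → i = j} with hG
  set G' : Finset (Fin (k + m) → ℤ) := {x ∈ A | ¬ ∃ T : Fin k ↪ Fin (k + m),
    ∀ i j, (p : ℤ) ∣ x (T i) - x (T j) → i = j} with hG'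
  have hun : A = G ∪ G' := (filter_union_filter_not_eq _ _).symm
  have hgood : collisions G F ≤ (k + m) ^ (2 * k) *
      (p ^ (2 * m) * (meanValue k m Y * (X ^ k * (k ^ k * p ^ (k * (k - 1) / 2))))) := by
    refine (collisions_cover_le G F (univ : Finset (Fin k ↪ Fin (k + m)))
      (fun T => {x ∈ A | ∀ i j, (p : ℤ) ∣ x (T i) - x (T j) → i = j}) ?_).trans ?_
    · intro x hx
      obtain ⟨h1, T, h2⟩ := mem_filter.1 hx
      exact ⟨T, mem_univ _, mem_filter.2 ⟨h1, h2⟩⟩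
    · have hc : #(univ : Finset (Fin k ↪ Fin (k + m))) ≤ (k + m) ^ k := by
        rw [card_univ, Fintype.card_embedding_eq, Fintype.card_fin, Fintype.card_fin]
        exact Nat.descFactorial_le_pow _ _
      calc _ ≤ #(univ : Finset (Fin k ↪ Fin (k + m))) * ∑ _T : Fin k ↪ Fin (k + m),
            (p ^ (2 * m) * (meanValue k m Y * (X ^ k * (k ^ k * p ^ (k * (k - 1) / 2))))) :=
            Nat.mul_le_mul_left _ (sum_le_sum fun T _ =>
              collisions_position_le k m p X Y hp hk hkp hm hX hXY T)
        _ = #(univ : Finset (Fin k ↪ Fin (k + m))) * #(univ : Finset (Fin k ↪ Fin (k + m))) *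
            (p ^ (2 * m) * (meanValue k m Y * (X ^ k * (k ^ k * p ^ (k * (k - 1) / 2))))) := by
            rw [sum_const, smul_eq_mul, mul_assoc]
        _ ≤ ((k + m) ^ k * (k + m) ^ k) * _ :=
            Nat.mul_le_mul_right _ (Nat.mul_le_mul hc hc)
        _ = _ := by rw [← pow_add, ← two_mul]
  have hbad : collisions G' F ≤ (p ^ k * k ^ (k + m)) ^ 2 * meanValue k (k + m) Y := by
    refine (collisions_cover_le G' F
      (univ : Finset ((Fin k → ZMod p) × (Fin (k + m) → Fin k)))
      (fun t => Fintype.piFinset fun i => residueClass p X (t.1 (t.2 i))) ?_).trans ?_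
    · intro x hx
      obtain ⟨h1, h2⟩ := mem_filter.1 hx
      rw [hA, Fintype.mem_piFinset] at h1
      set ρ : Fin (k + m) → ZMod p := fun i => (x i : ZMod p)
      set R := univ.image ρ
      have hR : #R < k := by
        by_contra hge
        push Not at hge
        refine h2 ?_
        obtain ⟨f⟩ : Nonempty (Fin k ↪ R) :=
          Function.Embedding.nonempty_of_card_le (by simpa using hge)
        have hpre : ∀ z : R, ∃ i, ρ i = z := fun z => by
          obtain ⟨i, -, hi⟩ := mem_image.1 z.2
          exact ⟨i, hi⟩
        choose g hg using hpre
        have hTi : ∀ i j, ρ (g (f i)) = ρ (g (f j)) → i = j := by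
          intro i j hij
          rw [hg, hg] at hij
          exact f.injective (Subtype.ext hij)
        refine ⟨⟨fun i => g (f i), fun i j hij => hTi i j (congrArg ρ hij)⟩, fun i j hij => ?_⟩
        refine hTi i j ?_
        have := (ZMod.intCast_zmod_eq_zero_iff_dvd _ p).2 hij
        push_cast at this
        exact sub_eq_zero.1 this
      obtain ⟨f⟩ : Nonempty (R ↪ Fin k) :=
        Function.Embedding.nonempty_of_card_le (by simpa using hR.le)
      have : Nonempty R := ⟨⟨ρ ⟨0, by omega⟩, mem_image_of_mem _ (mem_univ _)⟩⟩
      refine ⟨(fun a => ((Function.invFun (fun z : R => f z) a : R) : ZMod p),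
        fun i => f ⟨ρ i, mem_image_of_mem _ (mem_univ _)⟩), mem_univ _, ?_⟩
      rw [Fintype.mem_piFinset]
      intro i
      refine mem_filter.2 ⟨h1 i, ?_⟩
      simp only
      exact (congrArg Subtype.val (Function.leftInverse_invFun f.injective
        ⟨ρ i, mem_image_of_mem _ (mem_univ _)⟩)).symm
    · calc _ ≤ #(univ : Finset ((Fin k → ZMod p) × (Fin (k + m) → Fin k))) *
            ∑ _t : (Fin k → ZMod p) × (Fin (k + m) → Fin k), meanValue k (k + m) Y :=
            Nat.mul_le_mul_left _ (sum_le_sum fun t _ =>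
              collisions_pattern_le k (k + m) p X Y hp (by omega) hXY fun i => t.1 (t.2 i))
        _ = _ := by
            rw [sum_const, smul_eq_mul, card_univ, Fintype.card_prod, Fintype.card_fun,
              Fintype.card_fun, ZMod.card, Fintype.card_fin, Fintype.card_fin]
            ring
  calc meanValue k (k + m) X = collisions (G ∪ G') F := by rw [meanValue, ← hA, ← hun]
    _ ≤ 2 * (collisions G F + collisions G' F) := collisions_union_le G G' F
    _ ≤ _ := Nat.mul_le_mul_left _ (Nat.add_le_add hgood hbad)

end Recursion

end Vinogradov

/-! ### Vinogradov's mean value theorem -/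

namespace Vinogradov

section VinogradovBound

/-- The exponent in the bound for the mean value with `s = 2 k ^ 2 + k l`: it exceeds the optimal
`2 s - k (k + 1) / 2` by `(k (k + 1) / 2) (1 - 1 / k) ^ l`. -/
noncomputable def meanExponent (k l : ℕ) : ℝ :=
  2 * (2 * k ^ 2 + k * l : ℝ) - k * (k + 1) / 2 + k * (k + 1) / 2 * (1 - 1 / (k : ℝ)) ^ l

/-- The factor by which the constant grows in one step of the recursion. -/
def meanStep (k S : ℕ) : ℕ := 4 * S ^ (2 * k) * k ^ k * 4 ^ k ^ 2 * 4 ^ S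

theorem excess_bounds {k : ℕ} (hk : 2 ≤ k) (l : ℕ) :
    0 ≤ (k : ℝ) * (k + 1) / 2 * (1 - 1 / (k : ℝ)) ^ l ∧
      (k : ℝ) * (k + 1) / 2 * (1 - 1 / (k : ℝ)) ^ l ≤ k * (k + 1) / 2 := by
  have hk' : (2 : ℝ) ≤ k := by exact_mod_cast hk
  have h1 : 1 / (k : ℝ) ≤ 1 := by rw [div_le_one (by linarith)]; linarith
  have h0 : 0 ≤ 1 / (k : ℝ) := by positivity
  have h2 : (1 - 1 / (k : ℝ)) ^ l ≤ 1 := pow_le_one₀ (by linarith) (by linarith)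
  have h3 : 0 ≤ (1 - 1 / (k : ℝ)) ^ l := pow_nonneg (by linarith) l
  constructor
  · positivity
  · have : 0 ≤ (k : ℝ) * (k + 1) / 2 := by positivity
    nlinarith

theorem meanExponent_succ {k : ℕ} (hk : 2 ≤ k) (l : ℕ) :
    meanExponent k (l + 1) = meanExponent k l + 2 * k
      - k * (k + 1) / 2 * (1 - 1 / (k : ℝ)) ^ l / k := by
  have hk' : (k : ℝ) ≠ 0 := by positivity
  unfold meanExponent
  push_cast
  rw [pow_succ (1 - 1 / (k : ℝ)) l]
  generalize (1 - 1 / (k : ℝ)) ^ l = t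
  field_simp
  ring

/-- A prime `p` with `p ^ k ≥ X` and `p ≤ 4 X ^ (1 / k)`, by Bertrand's postulate. -/
theorem exists_prime_root {k X : ℕ} (hk : 2 ≤ k) (hX : (16 * k ^ 2) ^ k ≤ X) :
    ∃ p : ℕ, p.Prime ∧ 16 * k ^ 2 ≤ p ∧ X ≤ p ^ k ∧ p ≤ X ∧
      (p : ℝ) ≤ 4 * (X : ℝ) ^ (1 / (k : ℝ)) := by
  have hk0 : (k : ℝ) ≠ 0 := by positivity
  set y : ℝ := (X : ℝ) ^ (1 / (k : ℝ)) with hy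
  have hyk : y ^ k = X := by
    rw [hy, one_div]
    exact Real.rpow_inv_natCast_pow (by positivity) (by omega)
  have hy0 : 0 ≤ y := by positivity
  have hk16 : (16 * (k : ℝ) ^ 2) ≤ y := by
    refine le_of_pow_le_pow_left₀ (n := k) (by omega) hy0 ?_
    rw [hyk]
    exact_mod_cast hX
  have hkk : (4 : ℝ) ≤ (k : ℝ) ^ 2 := by
    have : (2 : ℝ) ≤ k := by exact_mod_cast hk
    nlinarith
  obtain ⟨p, hp, h1, h2⟩ := Nat.exists_prime_lt_and_le_two_mul ⌈y⌉₊ (by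
    have : 0 < y := by nlinarith
    exact (Nat.ceil_pos.2 this).ne')
  have hyp : y ≤ p := (Nat.le_ceil y).trans (by exact_mod_cast h1.le)
  have hp4 : (p : ℝ) ≤ 4 * y := by
    have h3 : (p : ℝ) ≤ 2 * ⌈y⌉₊ := by exact_mod_cast h2
    have h4 := Nat.ceil_lt_add_one hy0
    linarith
  refine ⟨p, hp, ?_, ?_, ?_, hp4⟩
  · have : (16 * (k : ℝ) ^ 2) ≤ p := hk16.trans hyp
    exact_mod_cast this
  · have : (X : ℝ) ≤ (p : ℝ) ^ k := by
      rw [← hyk]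
      exact pow_le_pow_left₀ hy0 hyp k
    exact_mod_cast this
  · have : (p : ℝ) ≤ X := by
      calc (p : ℝ) ≤ 4 * y := hp4
        _ ≤ y ^ 2 := by nlinarith
        _ ≤ y ^ k := pow_le_pow_right₀ (by linarith) hk
        _ = X := hyk
    exact_mod_cast this

theorem rpow_le_of_prime_bound {k X p l : ℕ} (hk : 2 ≤ k) (hX : 1 ≤ X) (hp1 : 1 ≤ p)
    (hp : (p : ℝ) ≤ 4 * (X : ℝ) ^ (1 / (k : ℝ))) (m : ℕ) (hm : m = 2 * k ^ 2 + k * l) :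
    (p : ℝ) ^ (2 * m) * (p : ℝ) ^ (k * (k - 1) / 2) * (X / p : ℝ) ^ meanExponent k l
      ≤ 4 ^ k ^ 2 * (X : ℝ) ^ (meanExponent k (l + 1) - k) := by
  have hX0 : (0 : ℝ) < X := by exact_mod_cast hX
  have hp0 : (0 : ℝ) < p := by exact_mod_cast hp1
  have hk0 : (k : ℝ) ≠ 0 := by positivity
  obtain ⟨he0, he1⟩ := excess_bounds hk l
  set η := (k : ℝ) * (k + 1) / 2 * (1 - 1 / (k : ℝ)) ^ l with hη
  have hchoose : ((k * (k - 1) / 2 : ℕ) : ℝ) = k * (k - 1) / 2 := by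
    rw [Nat.cast_div (Nat.even_mul_pred_self k).two_dvd (by norm_num)]
    push_cast [Nat.cast_sub (show 1 ≤ k by omega)]
    ring
  have hexp : (2 * m : ℕ) + ((k * (k - 1) / 2 : ℕ) : ℝ) - meanExponent k l = k ^ 2 - η := by
    rw [hchoose, hm, meanExponent, ← hη]
    push_cast
    ring
  have hη2 : η ≤ k ^ 2 := by
    have : (2 : ℝ) ≤ k := by exact_mod_cast hk
    nlinarith
  calc (p : ℝ) ^ (2 * m) * (p : ℝ) ^ (k * (k - 1) / 2) * (X / p : ℝ) ^ meanExponent k l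
      = (X : ℝ) ^ meanExponent k l * (p : ℝ) ^ ((k : ℝ) ^ 2 - η) := by
        rw [← hexp, Real.rpow_sub hp0, Real.rpow_add hp0, Real.rpow_natCast, Real.rpow_natCast,
          Real.div_rpow hX0.le hp0.le]
        field_simp
    _ ≤ (X : ℝ) ^ meanExponent k l * (4 * (X : ℝ) ^ (1 / (k : ℝ))) ^ ((k : ℝ) ^ 2 - η) := by
        gcongr
    _ = (4 : ℝ) ^ ((k : ℝ) ^ 2 - η) * (X : ℝ) ^ (meanExponent k (l + 1) - k) := by
        rw [Real.mul_rpow (by norm_num) (by positivity), ← Real.rpow_mul hX0.le,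
          mul_left_comm, ← Real.rpow_add hX0]
        congr 2
        rw [meanExponent_succ hk, ← hη]
        field_simp
        ring
    _ ≤ (4 : ℝ) ^ ((k : ℝ) ^ 2) * (X : ℝ) ^ (meanExponent k (l + 1) - k) := by
        gcongr
        · norm_num
        · linarith
    _ = _ := by
        congr 1
        rw [← Nat.cast_pow, Real.rpow_natCast]

/-- The contribution to the recursion of the tuples with at least `k` residues. -/
theorem wellConditioned_le {k X p l m S : ℕ} {Y J C : ℝ} (hk : 2 ≤ k) (hX : 1 ≤ X) (hp1 : 1 ≤ p)
    (hp : (p : ℝ) ≤ 4 * (X : ℝ) ^ (1 / (k : ℝ))) (hY0 : 0 ≤ Y) (hY : Y ≤ 2 * (X / p))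
    (hm : m = 2 * k ^ 2 + k * l) (hS : k + m ≤ S) (hJ : J ≤ C * Y ^ meanExponent k l)
    (hJ0 : 0 ≤ J) (hC : 0 ≤ C) :
    ((k + m : ℕ) : ℝ) ^ (2 * k) * ((p : ℝ) ^ (2 * m) * (J * ((X : ℝ) ^ k *
        ((k : ℝ) ^ k * (p : ℝ) ^ (k * (k - 1) / 2)))))
      ≤ C * meanStep k S * (X : ℝ) ^ meanExponent k (l + 1) / 4 := by
  have hX0 : (0 : ℝ) < X := by exact_mod_cast hX
  have hk2 : (2 : ℝ) ≤ k := by exact_mod_cast hk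
  obtain ⟨hl0, hl1⟩ := excess_bounds hk l
  have hEl : meanExponent k l = 2 * (m : ℝ) - k * (k + 1) / 2
      + k * (k + 1) / 2 * (1 - 1 / (k : ℝ)) ^ l := by
    rw [meanExponent, hm]
    push_cast
    ring
  have hms : (2 * (k : ℝ) ^ 2) ≤ m := by
    have : 2 * k ^ 2 ≤ m := by rw [hm]; omega
    exact_mod_cast this
  have hSr : ((k + m : ℕ) : ℝ) ≤ S := by exact_mod_cast hS
  have hE2S : meanExponent k l ≤ ((2 * S : ℕ) : ℝ) := by
    push_cast at hSr ⊢
    rw [hEl]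
    linarith
  have hEl0 : 0 ≤ meanExponent k l := by rw [hEl]; nlinarith
  have h2 := rpow_le_of_prime_bound (l := l) hk hX hp1 hp m hm
  set D := meanExponent k l
  set E := meanExponent k (l + 1)
  have h1 : J ≤ C * (4 ^ S * (X / p : ℝ) ^ D) := by
    refine hJ.trans (mul_le_mul_of_nonneg_left ?_ hC)
    calc Y ^ D ≤ (2 * (X / p) : ℝ) ^ D := Real.rpow_le_rpow hY0 hY hEl0
      _ = (2 : ℝ) ^ D * (X / p : ℝ) ^ D := Real.mul_rpow (by norm_num) (by positivity)
      _ ≤ (2 : ℝ) ^ ((2 * S : ℕ) : ℝ) * (X / p : ℝ) ^ D :=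
          mul_le_mul_of_nonneg_right
            (Real.rpow_le_rpow_of_exponent_le (by norm_num) hE2S) (by positivity)
      _ = _ := by rw [Real.rpow_natCast, pow_mul]; norm_num
  have h3 : ((k + m : ℕ) : ℝ) ^ (2 * k) ≤ (S : ℝ) ^ (2 * k) :=
    pow_le_pow_left₀ (by positivity) hSr _
  have h4 : (X : ℝ) ^ k * (X : ℝ) ^ (E - k) = (X : ℝ) ^ E := by
    rw [← Real.rpow_natCast, ← Real.rpow_add hX0]
    congr 1
    ring
  have h5 : (meanStep k S : ℝ) = 4 * (S : ℝ) ^ (2 * k) * (k : ℝ) ^ k * 4 ^ k ^ 2 * 4 ^ S := by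
    rw [meanStep]
    push_cast
    ring
  calc _ ≤ (S : ℝ) ^ (2 * k) * ((p : ℝ) ^ (2 * m) * ((C * (4 ^ S * (X / p : ℝ) ^ D)) *
        ((X : ℝ) ^ k * ((k : ℝ) ^ k * (p : ℝ) ^ (k * (k - 1) / 2))))) := by
        refine mul_le_mul h3 (mul_le_mul_of_nonneg_left
          (mul_le_mul_of_nonneg_right h1 (by positivity)) (by positivity)) ?_ (by positivity)
        exact mul_nonneg (by positivity) (mul_nonneg hJ0 (by positivity))
    _ = (S : ℝ) ^ (2 * k) * C * 4 ^ S * (k : ℝ) ^ k * (X : ℝ) ^ k * ((p : ℝ) ^ (2 * m) *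
        (p : ℝ) ^ (k * (k - 1) / 2) * (X / p : ℝ) ^ D) := by ring
    _ ≤ (S : ℝ) ^ (2 * k) * C * 4 ^ S * (k : ℝ) ^ k * (X : ℝ) ^ k *
        (4 ^ k ^ 2 * (X : ℝ) ^ (E - k)) := mul_le_mul_of_nonneg_left h2 (by positivity)
    _ = C * (4 * (S : ℝ) ^ (2 * k) * (k : ℝ) ^ k * 4 ^ k ^ 2 * 4 ^ S) *
        ((X : ℝ) ^ k * (X : ℝ) ^ (E - k)) / 4 := by ring
    _ = _ := by rw [h4, h5]

/-- The contribution to the recursion of the tuples with fewer than `k` residues. -/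
theorem illConditioned_le {k s p : ℕ} {X Y J C E : ℝ} (hk : 2 ≤ k) (hp0 : (0 : ℝ) < p)
    (hp16 : 16 * k ^ 2 ≤ p) (hX : 0 ≤ X) (hY0 : 0 ≤ Y) (hY : Y ≤ 2 * (X / p))
    (hs : k ^ 2 + 2 * k ≤ s) (hE : 2 * s - k ^ 2 ≤ E) (hE2 : E ≤ 2 * s) (hC : 0 ≤ C)
    (hJ : J ≤ C * Y ^ E) :
    ((p : ℝ) ^ k * (k : ℝ) ^ s) ^ 2 * J ≤ C * X ^ E / 4 := by
  have hk2 : (2 : ℝ) ≤ k := by exact_mod_cast hk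
  have hsr : (k : ℝ) ^ 2 + 2 * k ≤ s := by exact_mod_cast hs
  have hE0 : 0 ≤ E := by nlinarith
  have hp1 : (1 : ℝ) ≤ p := by exact_mod_cast Nat.one_le_iff_ne_zero.2 (by rintro rfl; simp at hp0)
  have h1 : (4 : ℝ) * ((p : ℝ) ^ k * (k : ℝ) ^ s) ^ 2 * 2 ^ E ≤ (p : ℝ) ^ E := by
    have h2 : (2 : ℝ) ^ E ≤ 4 ^ s := by
      calc (2 : ℝ) ^ E ≤ (2 : ℝ) ^ ((2 * s : ℕ) : ℝ) := by
            refine Real.rpow_le_rpow_of_exponent_le (by norm_num) ?_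
            push_cast
            exact hE2
        _ = _ := by rw [Real.rpow_natCast, pow_mul]; norm_num
    have h3 : (p : ℝ) ^ (2 * k + s) ≤ (p : ℝ) ^ E := by
      rw [← Real.rpow_natCast]
      refine Real.rpow_le_rpow_of_exponent_le hp1 ?_
      push_cast
      linarith
    have h4 : ((16 * k ^ 2 : ℕ) : ℝ) ^ s ≤ (p : ℝ) ^ s :=
      pow_le_pow_left₀ (Nat.cast_nonneg _) (by exact_mod_cast hp16) _
    have h5 : (4 : ℝ) ≤ 4 ^ s := le_self_pow₀ (by norm_num) (by rintro rfl; nlinarith)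
    calc (4 : ℝ) * ((p : ℝ) ^ k * (k : ℝ) ^ s) ^ 2 * 2 ^ E
        ≤ 4 ^ s * ((p : ℝ) ^ k * (k : ℝ) ^ s) ^ 2 * 4 ^ s := by gcongr
      _ = (p : ℝ) ^ (2 * k) * ((16 * k ^ 2 : ℕ) : ℝ) ^ s := by
          push_cast
          rw [mul_pow, mul_pow (16 : ℝ), show (16 : ℝ) = 4 * 4 by norm_num, mul_pow (4 : ℝ)]
          ring
      _ ≤ (p : ℝ) ^ (2 * k) * (p : ℝ) ^ s := by gcongr
      _ = (p : ℝ) ^ (2 * k + s) := by rw [pow_add]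
      _ ≤ _ := h3
  have h2 : Y ^ E ≤ (2 : ℝ) ^ E * (X ^ E / (p : ℝ) ^ E) := by
    rw [← Real.div_rpow hX hp0.le, ← Real.mul_rpow (by norm_num) (by positivity)]
    exact Real.rpow_le_rpow hY0 hY hE0
  have hpE : (0 : ℝ) < (p : ℝ) ^ E := Real.rpow_pos_of_pos hp0 _
  have hXE : 0 ≤ X ^ E := Real.rpow_nonneg hX _
  calc _ ≤ ((p : ℝ) ^ k * (k : ℝ) ^ s) ^ 2 * (C * ((2 : ℝ) ^ E * (X ^ E / (p : ℝ) ^ E))) :=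
        mul_le_mul_of_nonneg_left (hJ.trans (mul_le_mul_of_nonneg_left h2 hC)) (by positivity)
    _ = (4 * ((p : ℝ) ^ k * (k : ℝ) ^ s) ^ 2 * 2 ^ E) * (C * X ^ E / 4 / (p : ℝ) ^ E) := by ring
    _ ≤ (p : ℝ) ^ E * (C * X ^ E / 4 / (p : ℝ) ^ E) :=
        mul_le_mul_of_nonneg_right h1 (by positivity)
    _ = _ := by field_simp

/-- Vinogradov's mean value theorem, with explicit constants. -/
theorem meanValue_le {k : ℕ} (hk : 2 ≤ k) (S l : ℕ) (hS : 2 * k ^ 2 + k * l ≤ S) (X : ℕ)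
    (hX : 1 ≤ X) :
    (meanValue k (2 * k ^ 2 + k * l) X : ℝ)
      ≤ ((16 * k ^ 2) ^ k ^ 3 * meanStep k S ^ l : ℕ) * (X : ℝ) ^ meanExponent k l := by
  have hstep : 1 ≤ meanStep k S := by
    have : 0 < S := by nlinarith
    have : 0 < k := by omega
    unfold meanStep
    exact Nat.one_le_iff_ne_zero.2 (by positivity)
  induction l generalizing X with
  | zero =>
    have h1 := meanValue_le_pow k (2 * k ^ 2 + k * 0) X
    have h2 : meanExponent k 0 = ((2 * (2 * k ^ 2 + k * 0) : ℕ) : ℝ) := by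
      unfold meanExponent
      push_cast
      ring
    rw [h2, Real.rpow_natCast]
    have h3 : 1 ≤ (16 * k ^ 2) ^ k ^ 3 * meanStep k S ^ 0 := by
      rw [pow_zero, mul_one]
      exact Nat.one_le_pow _ _ (by positivity)
    exact_mod_cast h1.trans (Nat.le_mul_of_pos_left _ h3)
  | succ l ih =>
    induction X using Nat.strong_induction_on with
    | _ X ihX =>
    have hX0 : (0 : ℝ) < X := by exact_mod_cast hX
    have hX1 : (1 : ℝ) ≤ X := by exact_mod_cast hX
    have hk2 : (2 : ℝ) ≤ k := by exact_mod_cast hk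
    set m := 2 * k ^ 2 + k * l with hm
    have hs : 2 * k ^ 2 + k * (l + 1) = k + m := by rw [hm]; ring
    rw [hs] at hS ihX ⊢
    set E := meanExponent k (l + 1) with hE
    obtain ⟨he0, he1⟩ := excess_bounds hk (l + 1)
    have hEs : E = 2 * ((k + m : ℕ) : ℝ) - k * (k + 1) / 2
        + k * (k + 1) / 2 * (1 - 1 / (k : ℝ)) ^ (l + 1) := by
      rw [hE, meanExponent, hm]
      push_cast
      ring
    set C : ℝ := (((16 * k ^ 2) ^ k ^ 3 * meanStep k S ^ (l + 1) : ℕ) : ℝ) with hC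
    have hC0 : 0 ≤ C := Nat.cast_nonneg _
    have hCstep : C = (((16 * k ^ 2) ^ k ^ 3 * meanStep k S ^ l : ℕ) : ℝ) * meanStep k S := by
      rw [hC, pow_succ (meanStep k S) l, ← mul_assoc, Nat.cast_mul]
    have hsk : k ^ 2 + 2 * k ≤ k + m := by nlinarith [Nat.zero_le (k * l)]
    have hm0 : 0 < m := by positivity
    have hKk : (k : ℝ) * (k + 1) / 2 ≤ (k : ℝ) ^ 2 := by nlinarith
    have hE1 : 2 * ((k + m : ℕ) : ℝ) - (k : ℝ) ^ 2 ≤ E := by linarith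
    have hE2 : E ≤ 2 * ((k + m : ℕ) : ℝ) := by linarith
    clear_value C E m
    rcases lt_or_ge X ((16 * k ^ 2) ^ k) with hsmall | hlarge
    · -- For small `X` the trivial bound is absorbed by the constant.
      have h1 : (meanValue k (k + m) X : ℝ) ≤ (X : ℝ) ^ (2 * (k + m)) := by
        exact_mod_cast meanValue_le_pow k (k + m) X
      have h2 : (X : ℝ) ^ (2 * (k + m)) ≤ (X : ℝ) ^ (E + ((k ^ 2 : ℕ) : ℝ)) := by
        rw [← Real.rpow_natCast]
        refine Real.rpow_le_rpow_of_exponent_le hX1 ?_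
        push_cast at hE1 ⊢
        linarith
      have h3 : (X : ℝ) ^ (k ^ 2) ≤ C := by
        have : X ^ (k ^ 2) ≤ (16 * k ^ 2) ^ k ^ 3 * meanStep k S ^ (l + 1) := by
          calc X ^ (k ^ 2) ≤ ((16 * k ^ 2) ^ k) ^ (k ^ 2) := Nat.pow_le_pow_left hsmall.le _
            _ = (16 * k ^ 2) ^ k ^ 3 := by rw [← pow_mul]; congr 1; ring
            _ ≤ _ := Nat.le_mul_of_pos_right _ (Nat.pow_pos hstep)
        rw [hC]
        exact_mod_cast this
      rw [Real.rpow_add hX0, Real.rpow_natCast] at h2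
      calc _ ≤ _ := h1
        _ ≤ _ := h2
        _ ≤ (X : ℝ) ^ E * C := by gcongr
        _ = _ := mul_comm _ _
    · obtain ⟨p, hp, hp16, hXp, hpX, hp4⟩ := exists_prime_root hk hlarge
      have hp0 : (0 : ℝ) < p := by exact_mod_cast hp.pos
      have hkp : k < p := by nlinarith
      set Y := (X + p - 1) / p with hY
      have hXY : X ≤ p * Y := by
        have h1 := Nat.lt_mul_div_succ (X + p - 1) hp.pos
        rw [← hY, mul_add] at h1
        omega
      have hYX' : p * Y ≤ X + p - 1 := Nat.mul_div_le _ _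
      have hp2 : 64 ≤ p := by nlinarith
      have hYlt : Y < X := by
        by_contra hge
        push Not at hge
        have : p * X ≤ p * Y := Nat.mul_le_mul_left _ hge
        nlinarith [Nat.sub_le (X + p) 1]
      have hY1 : 1 ≤ Y := by
        by_contra h
        have h0 : Y = 0 := Nat.lt_one_iff.1 (not_le.1 h)
        rw [h0, mul_zero] at hXY
        omega
      have hYr : (Y : ℝ) ≤ 2 * (X / p) := by
        have h1 : p * Y ≤ 2 * X := by omega
        have h2 : (p : ℝ) * Y ≤ 2 * X := by exact_mod_cast h1
        rw [← mul_div_assoc, le_div_iff₀ hp0]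
        linarith
      have hrec := meanValue_recursion k m p X Y hp (by omega) hkp hm0 hXp hXY
      have ihl := ih (by omega) Y hY1
      have ihY := ihX Y hYlt hY1
      have hgood := wellConditioned_le hk hX hp.one_le hp4 (Nat.cast_nonneg Y) hYr hm hS ihl
        (Nat.cast_nonneg _) (Nat.cast_nonneg _)
      have hbad := illConditioned_le (s := k + m) (E := E) hk hp0 hp16 hX0.le
        (Nat.cast_nonneg Y) hYr hsk hE1 hE2 hC0 ihY
      have hrec' : (meanValue k (k + m) X : ℝ) ≤ 2 * (((k + m : ℕ) : ℝ) ^ (2 * k) *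
          ((p : ℝ) ^ (2 * m) * ((meanValue k m Y : ℝ) * ((X : ℝ) ^ k *
            ((k : ℝ) ^ k * (p : ℝ) ^ (k * (k - 1) / 2)))))
          + ((p : ℝ) ^ k * (k : ℝ) ^ (k + m)) ^ 2 * (meanValue k (k + m) Y : ℝ)) := by
        exact_mod_cast hrec
      rw [← hCstep, ← hE] at hgood
      linarith

end VinogradovBound

end Vinogradov

/-! ### Bilinear polynomial sums and their dual sums -/

namespace Vinogradov

section Bilinear

variable {q : ℕ}

/-- The `s`-tuples of integers from `[0, X)`. -/
noncomputable def tuples (s X : ℕ) : Finset (Fin s → ℤ) :=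
  Fintype.piFinset fun _ => Ico (0 : ℤ) X

theorem card_tuples (s X : ℕ) : #(tuples s X) = X ^ s := by
  rw [tuples, Fintype.card_piFinset]
  simp

/-- The difference of the power sums of two tuples. -/
def powerDiff {s : ℕ} (k : ℕ) (z : (Fin s → ℤ) × (Fin s → ℤ)) : Fin k → ℤ :=
  ∑ i, powers k (z.1 i) - ∑ i, powers k (z.2 i)

/-- The box containing all differences of power sums of `s`-tuples from `[0, X)`. -/
noncomputable def powerBox (k s X : ℕ) : Finset (Fin k → ℤ) :=
  Fintype.piFinset fun j => Icc (-((s * X ^ (j.val + 1) : ℕ) : ℤ)) ((s * X ^ (j.val + 1) : ℕ) : ℤ)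

theorem powerDiff_mem_powerBox {k s X : ℕ} {z : (Fin s → ℤ) × (Fin s → ℤ)}
    (hz : z ∈ tuples s X ×ˢ tuples s X) : powerDiff k z ∈ powerBox k s X := by
  obtain ⟨h1, h2⟩ := mem_product.1 hz
  rw [tuples, Fintype.mem_piFinset] at h1 h2
  rw [powerBox, Fintype.mem_piFinset]
  intro j
  have hb : ∀ w : Fin s → ℤ, (∀ i, w i ∈ Ico (0 : ℤ) X) →
      0 ≤ (∑ i, powers k (w i)) j ∧ (∑ i, powers k (w i)) j ≤ s * (X : ℤ) ^ (j.val + 1) := by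
    intro w hw
    rw [sum_powers_apply]
    constructor
    · exact sum_nonneg fun i _ => pow_nonneg (mem_Ico.1 (hw i)).1 _
    · calc ∑ i, w i ^ (j.val + 1) ≤ ∑ _i : Fin s, (X : ℤ) ^ (j.val + 1) :=
            sum_le_sum fun i _ => pow_le_pow_left₀ (mem_Ico.1 (hw i)).1 (mem_Ico.1 (hw i)).2.le _
        _ = _ := by simp
  have b1 := hb z.1 h1
  have b2 := hb z.2 h2
  rw [mem_Icc, powerDiff, Pi.sub_apply]
  push_cast
  constructor <;> linarith

/-- Each difference of power sums is attained at most `J_{s,k}(X)` times. -/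
theorem sum_powerDiff_le (k s X : ℕ) (f : (Fin k → ℤ) → ℝ) (hf : ∀ v, 0 ≤ f v) :
    ∑ z ∈ tuples s X ×ˢ tuples s X, f (powerDiff k z)
      ≤ meanValue k s X * ∑ v ∈ powerBox k s X, f v := by
  rw [← sum_fiberwise_of_maps_to (fun z hz => powerDiff_mem_powerBox (k := k) hz), mul_sum]
  refine sum_le_sum fun v _ => ?_
  rw [sum_congr rfl fun z hz => by rw [(mem_filter.1 hz).2], sum_const, nsmul_eq_mul]
  refine mul_le_mul_of_nonneg_right ?_ (hf v)
  have := card_shifted_le_collisions (tuples s X) (fun x => ∑ i, powers k (x i)) v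
  have h2 : #{z ∈ tuples s X ×ˢ tuples s X | powerDiff k z = v} ≤ meanValue k s X := by
    refine le_trans (le_of_eq ?_) this
    congr 1
    ext z
    simp only [mem_filter, powerDiff, sub_eq_iff_eq_add, add_comm v]
  exact_mod_cast h2

/-- The `2 s`-th moment of a Weyl sum, expanded into power sums of pairs of `s`-tuples. -/
theorem norm_sum_pow_eq [NeZero q] (ψ : AddChar (ZMod q) ℂ) (k s X : ℕ) (b : Fin k → ZMod q) :
    ((‖∑ x ∈ Ico (0 : ℤ) X, ψ (∑ j, b j * (x : ZMod q) ^ (j.val + 1))‖ ^ (2 * s) : ℝ) : ℂ)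
      = ∑ z ∈ tuples s X ×ˢ tuples s X, ψ (∑ j, b j * (powerDiff k z j : ZMod q)) := by
  set w := ∑ x ∈ Ico (0 : ℤ) X, ψ (∑ j, b j * (x : ZMod q) ^ (j.val + 1)) with hw
  have hws : w ^ s = ∑ x ∈ tuples s X, ψ (∑ j, b j * ((∑ i, powers k (x i)) j : ZMod q)) := by
    rw [hw, ← Fin.prod_const s, prod_univ_sum, tuples]
    refine sum_congr rfl fun x _ => ?_
    rw [← addChar_map_sum, sum_comm]
    congr 1
    refine sum_congr rfl fun j _ => ?_
    rw [sum_powers_apply, ← mul_sum]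
    push_cast
    rfl
  rw [mul_comm 2 s, pow_mul, ← norm_pow]
  push_cast
  rw [← Complex.mul_conj', hws, map_sum, sum_mul_sum, sum_product]
  refine sum_congr rfl fun x _ => sum_congr rfl fun y _ => ?_
  rw [← AddChar.map_neg_eq_conj, ← AddChar.map_add_eq_mul, ← sub_eq_add_neg, ← sum_sub_distrib]
  congr 1
  refine sum_congr rfl fun j _ => ?_
  rw [powerDiff, Pi.sub_apply]
  push_cast
  ring

/-- The sum `∑_{|μ| ≤ M} |∑_{|l| ≤ M} ψ (a l μ)|` that remains for each degree in Vinogradov's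
bilinear method. -/
noncomputable def dualSum (ψ : AddChar (ZMod q) ℂ) (a : ZMod q) (M : ℕ) : ℝ :=
  ∑ μ ∈ Icc (-(M : ℤ)) M, ‖∑ l ∈ Icc (-(M : ℤ)) M, ψ (a * l * μ)‖

theorem dualSum_nonneg (ψ : AddChar (ZMod q) ℂ) (a : ZMod q) (M : ℕ) : 0 ≤ dualSum ψ a M :=
  sum_nonneg fun _ _ => norm_nonneg _

/-- Vinogradov's estimate of bilinear polynomial sums. Hölder's inequality, applied to each of the
two variables, replaces the powers of `x` and `y` by differences of power sums; each value of
these is attained at most `meanValue k s X` times, and dropping all other information on them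
leaves the product of the dual sums. -/
theorem norm_bilinear_pow_le [NeZero q] (ψ : AddChar (ZMod q) ℂ) (k s X : ℕ) (hs : 1 ≤ s)
    (a : Fin k → ZMod q) :
    ‖∑ x ∈ Ico (0 : ℤ) X, ∑ y ∈ Ico (0 : ℤ) X,
        ψ (∑ j, a j * (x : ZMod q) ^ (j.val + 1) * (y : ZMod q) ^ (j.val + 1))‖ ^ (2 * s * (2 * s))
      ≤ (X : ℝ) ^ (2 * (2 * s * (2 * s - 1))) * (meanValue k s X : ℝ) ^ 2
        * ∏ j : Fin k, dualSum ψ (a j) (s * X ^ (j.val + 1)) := by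
  set Z := tuples s X ×ˢ tuples s X with hZ
  have hZcard : (#Z : ℝ) = (X : ℝ) ^ (2 * s) := by
    rw [hZ, card_product, card_tuples, ← pow_add, ← two_mul]
    push_cast
    rfl
  obtain ⟨t, ht⟩ : ∃ t, 2 * s = t + 1 := ⟨2 * s - 1, by omega⟩
  have ht1 : 2 * s - 1 = t := by omega
  set g : (Fin k → ℤ) → ℂ := fun v =>
    ∑ x ∈ Ico (0 : ℤ) X, ψ (∑ j, (a j * (v j : ZMod q)) * (x : ZMod q) ^ (j.val + 1)) with hg
  -- Hölder in `x`.
  have h1 : ‖∑ x ∈ Ico (0 : ℤ) X, ∑ y ∈ Ico (0 : ℤ) X,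
        ψ (∑ j, a j * (x : ZMod q) ^ (j.val + 1) * (y : ZMod q) ^ (j.val + 1))‖ ^ (2 * s)
      ≤ (X : ℝ) ^ t * ∑ z ∈ Z, ‖g (powerDiff k z)‖ := by
    calc _ ≤ (∑ x ∈ Ico (0 : ℤ) X, ‖∑ y ∈ Ico (0 : ℤ) X,
          ψ (∑ j, a j * (x : ZMod q) ^ (j.val + 1) * (y : ZMod q) ^ (j.val + 1))‖) ^ (2 * s) :=
          pow_le_pow_left₀ (norm_nonneg _) (norm_sum_le _ _) _
      _ ≤ (X : ℝ) ^ t * ∑ x ∈ Ico (0 : ℤ) X, ‖∑ y ∈ Ico (0 : ℤ) X,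
          ψ (∑ j, a j * (x : ZMod q) ^ (j.val + 1) * (y : ZMod q) ^ (j.val + 1))‖ ^ (2 * s) := by
          rw [ht]
          simpa using pow_sum_le_card_mul_sum_pow (s := Ico (0 : ℤ) X)
            (f := fun x => ‖∑ y ∈ Ico (0 : ℤ) X,
              ψ (∑ j, a j * (x : ZMod q) ^ (j.val + 1) * (y : ZMod q) ^ (j.val + 1))‖)
            (fun i _ => norm_nonneg _) t
      _ ≤ _ := by
          refine mul_le_mul_of_nonneg_left ?_ (by positivity)
          have hc : ((∑ x ∈ Ico (0 : ℤ) X, ‖∑ y ∈ Ico (0 : ℤ) X,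
              ψ (∑ j, a j * (x : ZMod q) ^ (j.val + 1) * (y : ZMod q) ^ (j.val + 1))‖ ^ (2 * s)
                : ℝ) : ℂ) = ∑ z ∈ Z, g (powerDiff k z) := by
            rw [Complex.ofReal_sum]
            simp_rw [norm_sum_pow_eq ψ k s X]
            rw [sum_comm]
            refine sum_congr rfl fun z _ => sum_congr rfl fun x _ => ?_
            congr 1
            exact sum_congr rfl fun j _ => by ring
          calc _ = ‖((∑ x ∈ Ico (0 : ℤ) X, ‖∑ y ∈ Ico (0 : ℤ) X,
              ψ (∑ j, a j * (x : ZMod q) ^ (j.val + 1) * (y : ZMod q) ^ (j.val + 1))‖ ^ (2 * s)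
                : ℝ) : ℂ)‖ := by
                rw [Complex.norm_real, Real.norm_of_nonneg
                  (sum_nonneg fun _ _ => pow_nonneg (norm_nonneg _) _)]
            _ ≤ _ := by
                rw [hc]
                exact norm_sum_le _ _
  -- Hölder over the pairs of `s`-tuples.
  have h2 : (∑ z ∈ Z, ‖g (powerDiff k z)‖) ^ (2 * s)
      ≤ ((X : ℝ) ^ (2 * s)) ^ t * ∑ z ∈ Z, ‖g (powerDiff k z)‖ ^ (2 * s) := by
    rw [← hZcard, ht]
    exact pow_sum_le_card_mul_sum_pow (fun i _ => norm_nonneg _) t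
  have h3 := sum_powerDiff_le k s X (fun v => ‖g v‖ ^ (2 * s)) (fun v => by positivity)
  set h : (Fin k → ℤ) → ℝ := fun v => ∏ j : Fin k,
    ‖∑ l ∈ Icc (-((s * X ^ (j.val + 1) : ℕ) : ℤ)) ((s * X ^ (j.val + 1) : ℕ) : ℤ),
      ψ (a j * l * v j)‖ with hh
  have h4 : ∑ v ∈ powerBox k s X, ‖g v‖ ^ (2 * s) ≤ ∑ z ∈ Z, h (powerDiff k z) := by
    have hc : ((∑ v ∈ powerBox k s X, ‖g v‖ ^ (2 * s) : ℝ) : ℂ) = ∑ z ∈ Z, ∏ j : Fin k,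
        ∑ l ∈ Icc (-((s * X ^ (j.val + 1) : ℕ) : ℤ)) ((s * X ^ (j.val + 1) : ℕ) : ℤ),
          ψ (a j * l * powerDiff k z j) := by
      rw [Complex.ofReal_sum]
      simp_rw [hg, norm_sum_pow_eq ψ k s X]
      rw [sum_comm]
      refine sum_congr rfl fun z _ => ?_
      rw [prod_univ_sum, powerBox]
      refine sum_congr rfl fun v _ => ?_
      rw [addChar_map_sum]
    calc _ = ‖((∑ v ∈ powerBox k s X, ‖g v‖ ^ (2 * s) : ℝ) : ℂ)‖ := by
          rw [Complex.norm_real, Real.norm_of_nonneg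
            (sum_nonneg fun _ _ => pow_nonneg (norm_nonneg _) _)]
      _ ≤ _ := by
          rw [hc]
          refine (norm_sum_le _ _).trans (le_of_eq ?_)
          exact sum_congr rfl fun z _ => norm_prod _ _
  have h5 := sum_powerDiff_le k s X h (fun v => prod_nonneg fun _ _ => norm_nonneg _)
  have h6 : ∑ v ∈ powerBox k s X, h v = ∏ j : Fin k, dualSum ψ (a j) (s * X ^ (j.val + 1)) := by
    simp only [dualSum]
    rw [prod_univ_sum, powerBox]
  rw [h6] at h5
  have hJ0 : (0 : ℝ) ≤ meanValue k s X := Nat.cast_nonneg _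
  calc _ = (‖∑ x ∈ Ico (0 : ℤ) X, ∑ y ∈ Ico (0 : ℤ) X,
        ψ (∑ j, a j * (x : ZMod q) ^ (j.val + 1) * (y : ZMod q) ^ (j.val + 1))‖ ^ (2 * s))
          ^ (2 * s) := by rw [← pow_mul]
    _ ≤ ((X : ℝ) ^ t * ∑ z ∈ Z, ‖g (powerDiff k z)‖) ^ (2 * s) :=
        pow_le_pow_left₀ (by positivity) h1 _
    _ = ((X : ℝ) ^ t) ^ (2 * s) * (∑ z ∈ Z, ‖g (powerDiff k z)‖) ^ (2 * s) := mul_pow _ _ _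
    _ ≤ ((X : ℝ) ^ t) ^ (2 * s) * (((X : ℝ) ^ (2 * s)) ^ t * (meanValue k s X *
          (meanValue k s X * ∏ j : Fin k, dualSum ψ (a j) (s * X ^ (j.val + 1))))) := by
        refine mul_le_mul_of_nonneg_left (h2.trans (mul_le_mul_of_nonneg_left
          (h3.trans (mul_le_mul_of_nonneg_left (h4.trans h5) hJ0)) ?_)) ?_ <;> positivity
    _ = _ := by
        rw [ht1]
        ring

end Bilinear

section DualSum

variable {q : ℕ}

theorem dualSum_le_sq [NeZero q] (ψ : AddChar (ZMod q) ℂ) (a : ZMod q) (M : ℕ) :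
    dualSum ψ a M ≤ (2 * M + 1 : ℝ) ^ 2 := by
  have hc : (#(Icc (-(M : ℤ)) M) : ℝ) = 2 * M + 1 := by
    rw [Int.card_Icc]
    have : ((M : ℤ) + 1 - -(M : ℤ)).toNat = 2 * M + 1 := by omega
    rw [this]
    push_cast
    ring
  calc dualSum ψ a M ≤ ∑ μ ∈ Icc (-(M : ℤ)) M, (2 * M + 1 : ℝ) := by
        refine sum_le_sum fun μ _ => (norm_sum_le _ _).trans (le_of_eq ?_)
        rw [sum_congr rfl fun l _ => AddChar.norm_apply ψ _, sum_const, nsmul_eq_mul, hc, mul_one]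
    _ = _ := by rw [sum_const, nsmul_eq_mul, hc, sq]

/-- Orthogonality over `n` complete periods of `i ↦ ψ (b i)`. -/
theorem sum_range_addChar (ψ : AddChar (ZMod q) ℂ) (b : ZMod q) (Q : ℕ) (hb : b * Q = 0) (n : ℕ)
    (c : ℤ) : ∑ i ∈ range (Q * n), ψ (b * ((c + i : ℤ) : ZMod q))
      = if ψ b = 1 then ((Q * n : ℕ) : ℂ) * ψ (b * c) else 0 := by
  have h1 : ∀ i : ℕ, ψ (b * ((c + i : ℤ) : ZMod q)) = ψ (b * c) * ψ b ^ i := by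
    intro i
    rw [← AddChar.map_nsmul_eq_pow, ← AddChar.map_add_eq_mul]
    congr 1
    rw [nsmul_eq_mul]
    push_cast
    ring
  simp_rw [h1]
  rw [← mul_sum]
  split_ifs with h
  · simp [h, mul_comm]
  · rw [geom_sum_eq h]
    have : ψ b ^ (Q * n) = 1 := by
      rw [← AddChar.map_nsmul_eq_pow, nsmul_eq_mul, mul_comm]
      push_cast
      rw [← mul_assoc, hb, zero_mul, AddChar.map_zero_eq_one]
    rw [this]
    simp

/-- If `a` has additive order `Q` modulo `q`, large-sieve type orthogonality saves a factor of about
`min (√Q) (M / √Q)` in the dual sum. -/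
theorem dualSum_le_of_order [NeZero q] (a : ℤ) (M : ℕ) :
    dualSum (ZMod.stdAddChar : AddChar (ZMod q) ℂ) (a : ZMod q) M
      ≤ (2 * M + 1) * ((2 * M + 1) + (q / Int.gcd a q : ℕ))
        / √((q / Int.gcd a q : ℕ) : ℝ) := by
  set ψ : AddChar (ZMod q) ℂ := ZMod.stdAddChar with hψ
  set Q := q / Int.gcd a q with hQ
  have hq0 : 0 < q := NeZero.pos q
  have hg : Int.gcd a q ∣ q := by exact_mod_cast Int.gcd_dvd_right a (q : ℤ)
  have hg0 : 0 < Int.gcd a q := Nat.pos_of_dvd_of_pos hg hq0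
  have hQg : Q * Int.gcd a q = q := Nat.div_mul_cancel hg
  have hQ0 : 0 < Q := Nat.pos_of_ne_zero fun h => by rw [h] at hQg; omega
  have haQ : (a : ZMod q) * Q = 0 := by
    obtain ⟨c, hc⟩ := Int.gcd_dvd_left a (q : ℤ)
    have : ((a * Q : ℤ) : ZMod q) = 0 := by
      rw [ZMod.intCast_zmod_eq_zero_iff_dvd]
      refine ⟨c, ?_⟩
      have : (Q : ℤ) * Int.gcd a q = q := by exact_mod_cast hQg
      rw [← this]
      calc a * Q = (Int.gcd a q * c) * Q := by rw [← hc]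
        _ = _ := by ring
    push_cast at this
    exact this
  have hdvd : ∀ d : ℤ, ψ (a * d) = 1 → (Q : ℤ) ∣ d := by
    intro d hd
    have h1 : (a : ZMod q) * d = 0 := by
      refine ZMod.injective_stdAddChar ?_
      rw [AddChar.map_zero_eq_one]
      exact hd
    have h2 : (q : ℤ) ∣ a * d := by
      rw [← ZMod.intCast_zmod_eq_zero_iff_dvd]
      push_cast
      exact h1
    have hgz : (Int.gcd a q : ℤ) ≠ 0 := by exact_mod_cast hg0.ne'
    have h3 : (Q : ℤ) = (q : ℤ) / Int.gcd a q := by rw [hQ]; push_cast; rfl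
    have hco : IsCoprime (Q : ℤ) (a / Int.gcd a q) := by
      rw [h3, Int.isCoprime_iff_gcd_eq_one, Int.gcd_comm]
      exact Int.gcd_div_gcd_div_gcd hg0
    refine hco.dvd_of_dvd_mul_left ?_
    obtain ⟨c, hc⟩ := Int.gcd_dvd_left a (q : ℤ)
    have h4 : (Q : ℤ) * Int.gcd a q = q := by exact_mod_cast hQg
    have h5 : a / (Int.gcd a q : ℤ) = c := Int.ediv_eq_of_eq_mul_right hgz hc
    rw [h5]
    obtain ⟨t, ht⟩ := h2
    refine ⟨t, mul_left_cancel₀ hgz ?_⟩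
    calc (Int.gcd a q : ℤ) * (c * d) = (Int.gcd a q * c) * d := by ring
      _ = a * d := by rw [← hc]
      _ = (Q * Int.gcd a q) * t := by rw [ht, h4]
      _ = _ := by ring
  set K := 2 * M + 1 with hK
  set I := Icc (-(M : ℤ)) M with hI
  have hcard : #I = K := by
    rw [hI, Int.card_Icc]
    omega
  set n := K / Q + 1 with hn
  have hKn : K ≤ Q * n := by
    rw [hn]
    exact (Nat.lt_mul_div_succ K hQ0).le
  -- Parseval over a union of complete periods that covers `I`.
  have h1 : ∑ μ ∈ I, ‖∑ l ∈ I, ψ (a * l * μ)‖ ^ 2 ≤ (K * n * (Q * n : ℕ) : ℝ) := by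
    have hc : ((∑ i ∈ range (Q * n), ‖∑ l ∈ I, ψ (a * l * ((-M + i : ℤ) : ZMod q))‖ ^ 2 : ℝ) : ℂ)
        = ∑ z ∈ I ×ˢ I, if ψ (a * ((z.1 - z.2 : ℤ) : ZMod q)) = 1 then
          ((Q * n : ℕ) : ℂ) * ψ (a * ((z.1 - z.2 : ℤ) : ZMod q) * ((-M : ℤ) : ZMod q)) else 0 := by
      push_cast
      have : ∀ i : ℕ, ((‖∑ l ∈ I, ψ (a * l * (-M + i : ZMod q))‖ : ℂ)) ^ 2
          = ∑ z ∈ I ×ˢ I, ψ ((a * ((z.1 - z.2 : ℤ) : ZMod q)) * ((-M + i : ℤ) : ZMod q)) := by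
        intro i
        rw [← Complex.mul_conj', map_sum, sum_mul_sum, sum_product]
        refine sum_congr rfl fun x _ => sum_congr rfl fun y _ => ?_
        rw [← AddChar.map_neg_eq_conj, ← AddChar.map_add_eq_mul]
        congr 1
        push_cast
        ring
      simp_rw [this]
      rw [sum_comm]
      refine sum_congr rfl fun z _ => ?_
      have := sum_range_addChar ψ (a * ((z.1 - z.2 : ℤ) : ZMod q)) Q (by
        rw [mul_right_comm, haQ, zero_mul]) n (-M)
      rw [this]
      push_cast
      rfl
    have hle : ∑ μ ∈ I, ‖∑ l ∈ I, ψ (a * l * μ)‖ ^ 2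
        ≤ ∑ i ∈ range (Q * n), ‖∑ l ∈ I, ψ (a * l * ((-M + i : ℤ) : ZMod q))‖ ^ 2 := by
      rw [← sum_image (s := range (Q * n)) (g := fun i : ℕ => (-M + i : ℤ))
        (f := fun μ : ℤ => ‖∑ l ∈ I, ψ (a * l * (μ : ZMod q))‖ ^ 2)]
      · refine sum_le_sum_of_subset_of_nonneg ?_ fun _ _ _ => by positivity
        intro μ hμ
        rw [hI, mem_Icc] at hμ
        refine mem_image.2 ⟨(μ + M).toNat, ?_, ?_⟩
        · rw [mem_range]
          omega
        · omega
      · intro i _ j _ hij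
        simpa using hij
    refine hle.trans ?_
    have hnorm : ∑ i ∈ range (Q * n), ‖∑ l ∈ I, ψ (a * l * ((-M + i : ℤ) : ZMod q))‖ ^ 2
        = ‖((∑ i ∈ range (Q * n), ‖∑ l ∈ I, ψ (a * l * ((-M + i : ℤ) : ZMod q))‖ ^ 2 : ℝ) : ℂ)‖ := by
      rw [Complex.norm_real, Real.norm_of_nonneg (sum_nonneg fun _ _ => by positivity)]
    rw [hnorm, hc, ← sum_filter]
    refine (norm_sum_le _ _).trans ?_
    have hterm : ∀ z : ℤ × ℤ, ‖((Q * n : ℕ) : ℂ) *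
        ψ (a * ((z.1 - z.2 : ℤ) : ZMod q) * ((-M : ℤ) : ZMod q))‖ = ((Q * n : ℕ) : ℝ) := by
      intro z
      rw [norm_mul, AddChar.norm_apply, mul_one, Complex.norm_natCast]
    rw [sum_congr rfl fun z _ => hterm z, sum_const, nsmul_eq_mul]
    refine mul_le_mul_of_nonneg_right ?_ (Nat.cast_nonneg _)
    have hpairs : #{z ∈ I ×ˢ I | ψ (a * ((z.1 - z.2 : ℤ) : ZMod q)) = 1} ≤ n * K := by
      rw [← hcard]
      refine card_le_mul_card_image_of_maps_to (f := Prod.fst)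
        (fun z hz => (mem_product.1 (mem_filter.1 hz).1).1) n fun x hx => ?_
      rw [hn, ← card_range (K / Q + 1)]
      refine card_le_card_of_injOn (fun z => ((z.2 + M) / Q).toNat) ?_ ?_
      · intro z hz
        obtain ⟨hz1, rfl⟩ := mem_filter.1 (mem_coe.1 hz)
        have hz2 := (mem_product.1 (mem_filter.1 hz1).1).2
        rw [hI, mem_Icc] at hz2
        rw [mem_coe, mem_range, Nat.lt_succ_iff]
        have h6 : (z.2 + M) / (Q : ℤ) ≤ (K : ℤ) / Q :=
          Int.ediv_le_ediv (by exact_mod_cast hQ0) (by rw [hK]; push_cast; omega)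
        have h7 : ((K / Q : ℕ) : ℤ) = (K : ℤ) / Q := by push_cast; rfl
        refine Int.toNat_le.2 ?_
        rw [h7]
        exact h6
      · intro z hz w hw hzw
        obtain ⟨hz1, hzx⟩ := mem_filter.1 (mem_coe.1 hz)
        obtain ⟨hw1, hwx⟩ := mem_filter.1 (mem_coe.1 hw)
        have hz2 := (mem_product.1 (mem_filter.1 hz1).1).2
        have hw2 := (mem_product.1 (mem_filter.1 hw1).1).2
        rw [hI, mem_Icc] at hz2 hw2
        have hQz : (0 : ℤ) < Q := by exact_mod_cast hQ0
        have h8 := Int.ediv_nonneg (a := z.2 + M) (b := (Q : ℤ)) (by omega) hQz.le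
        have h9 := Int.ediv_nonneg (a := w.2 + M) (b := (Q : ℤ)) (by omega) hQz.le
        have h10 : (z.2 + M) / (Q : ℤ) = (w.2 + M) / Q := by
          simp only at hzw
          omega
        obtain ⟨u, hu⟩ := hdvd _ (mem_filter.1 hz1).2
        obtain ⟨v, hv⟩ := hdvd _ (mem_filter.1 hw1).2
        have h11 : (z.2 + M) % (Q : ℤ) = (w.2 + M) % Q := by
          have : z.2 + M = w.2 + M + Q * (v - u) := by
            rw [hzx] at hu
            rw [hwx] at hv
            linear_combination hv - hu
          rw [this, Int.add_mul_emod_self_left]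
        have h12 := Int.emod_add_mul_ediv (z.2 + M) (Q : ℤ)
        have h13 := Int.emod_add_mul_ediv (w.2 + M) (Q : ℤ)
        refine Prod.ext (hzx.trans hwx.symm) ?_
        rw [h10, h11] at h12
        linarith
    calc _ ≤ ((n * K : ℕ) : ℝ) := by exact_mod_cast hpairs
      _ = _ := by push_cast; ring
  have hQr : (0 : ℝ) < Q := by exact_mod_cast hQ0
  have hnr : (n : ℝ) ≤ (K + Q) / Q := by
    rw [le_div_iff₀ hQr]
    have : n * Q ≤ K + Q := by
      rw [hn, add_mul, one_mul]
      exact Nat.add_le_add_right (Nat.div_mul_le_self K Q) Q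
    exact_mod_cast this
  have hKr : ((K : ℕ) : ℝ) = 2 * M + 1 := by rw [hK]; push_cast; ring
  have h2 : dualSum ψ (a : ZMod q) M ^ 2 ≤ K * (K * n * (Q * n : ℕ)) := by
    have := sq_sum_le_card_mul_sum_sq (s := I) (f := fun μ : ℤ => ‖∑ l ∈ I, ψ (a * l * μ)‖)
    rw [hcard] at this
    exact this.trans (mul_le_mul_of_nonneg_left h1 (Nat.cast_nonneg _))
  have h3 : (K * (K * n * (Q * n : ℕ)) : ℝ) ≤ (K * (K + Q) / √(Q : ℝ)) ^ 2 := by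
    rw [div_pow, Real.sq_sqrt hQr.le, le_div_iff₀ hQr]
    have h4 : (n : ℝ) * Q ≤ K + Q := (le_div_iff₀ hQr).1 hnr
    push_cast
    calc (K * (K * n * (Q * n)) * Q : ℝ) = (K : ℝ) ^ 2 * (n * Q) ^ 2 := by ring
      _ ≤ (K : ℝ) ^ 2 * (K + Q) ^ 2 := by gcongr
      _ = _ := by ring
  rw [← hKr]
  exact le_of_sq_le_sq (h2.trans h3) (by positivity)

end DualSum

end Vinogradov

/-! ### Shifts of Kloosterman sums and polynomial phases -/

namespace ShortKloosterman

section Shift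

/-- A shift by `h` changes a sum of bounded terms over an interval by at most `2 h`. -/
theorem norm_sum_shift_sub_le (f : ℤ → ℂ) (hf : ∀ m, ‖f m‖ ≤ 1) (c : ℤ) (N h : ℕ) :
    ‖∑ n ∈ Ioc c (c + N), f n - ∑ n ∈ Ioc c (c + N), f (n + h)‖ ≤ 2 * h := by
  induction h with
  | zero => simp
  | succ h ih =>
    have hstep : ∑ n ∈ Ioc c (c + N), f (n + h) - ∑ n ∈ Ioc c (c + N), f (n + (h + 1 : ℕ))
        = f (c + 1 + h) - f (c + N + 1 + h) := by
      have hI : ∀ g : ℤ → ℂ, ∑ n ∈ Ioc c (c + N), g n = ∑ i ∈ range N, g (c + 1 + i) := by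
        intro g
        rw [← sum_image (s := range N) (g := fun i : ℕ => c + 1 + (i : ℤ)) (f := g)]
        · congr 1
          ext n
          simp only [mem_Ioc, mem_image, mem_range]
          constructor
          · intro hn
            exact ⟨(n - c - 1).toNat, by omega, by omega⟩
          · rintro ⟨i, hi, rfl⟩
            omega
        · intro i _ j _ hij
          simpa using hij
      rw [hI, hI, ← sum_sub_distrib]
      have := sum_range_sub' (fun i : ℕ => f (c + 1 + i + h)) N
      simp only [Nat.cast_zero, add_zero] at this
      rw [show c + N + 1 + (h : ℤ) = c + 1 + N + h by ring, ← this]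
      refine sum_congr rfl fun i _ => ?_
      congr 2
      push_cast
      ring
    calc _ = ‖(∑ n ∈ Ioc c (c + N), f n - ∑ n ∈ Ioc c (c + N), f (n + h))
          + (f (c + 1 + h) - f (c + N + 1 + h))‖ := by rw [← hstep]; congr 1; ring
      _ ≤ 2 * h + (1 + 1) := by
          refine (norm_add_le _ _).trans (add_le_add ih ((norm_sub_le _ _).trans ?_))
          exact add_le_add (hf _) (hf _)
      _ = _ := by push_cast; ring

/-- Averaging over the shifts `n ↦ n + D x y` bounds a sum over an interval by double sums. -/
theorem norm_sum_le_of_shift (f : ℤ → ℂ) (hf : ∀ m, ‖f m‖ ≤ 1) (c : ℤ) (N D X : ℕ) (hX : 1 ≤ X)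
    (T : ℝ) (hT : ∀ n : ℤ, ‖∑ x ∈ Ico (0 : ℤ) X, ∑ y ∈ Ico (0 : ℤ) X, f (n + D * (x * y))‖ ≤ T) :
    ‖∑ n ∈ Ioc c (c + N), f n‖ ≤ N * (T / (X : ℝ) ^ 2) + 2 * D * (X : ℝ) ^ 2 := by
  have hX0 : (0 : ℝ) < (X : ℝ) ^ 2 := by
    have : (0 : ℝ) < X := by exact_mod_cast hX
    positivity
  set s := ∑ n ∈ Ioc c (c + N), f n with hs
  have hcard : #(Ico (0 : ℤ) X) = X := by simp
  have hcI : #(Ioc c (c + N)) = N := by simp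
  have key : (X : ℂ) ^ 2 * s = ∑ x ∈ Ico (0 : ℤ) X, ∑ y ∈ Ico (0 : ℤ) X,
      (s - ∑ n ∈ Ioc c (c + N), f (n + D * (x * y)))
      + ∑ n ∈ Ioc c (c + N), ∑ x ∈ Ico (0 : ℤ) X, ∑ y ∈ Ico (0 : ℤ) X, f (n + D * (x * y)) := by
    have h1 : ∑ n ∈ Ioc c (c + N), ∑ x ∈ Ico (0 : ℤ) X, ∑ y ∈ Ico (0 : ℤ) X, f (n + D * (x * y))
        = ∑ x ∈ Ico (0 : ℤ) X, ∑ y ∈ Ico (0 : ℤ) X, ∑ n ∈ Ioc c (c + N), f (n + D * (x * y)) := by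
      rw [sum_comm]
      exact sum_congr rfl fun x _ => sum_comm
    rw [h1]
    simp_rw [sum_sub_distrib, sum_const, hcard, nsmul_eq_mul]
    ring
  have hb1 : ‖∑ x ∈ Ico (0 : ℤ) X, ∑ y ∈ Ico (0 : ℤ) X,
      (s - ∑ n ∈ Ioc c (c + N), f (n + D * (x * y)))‖ ≤ (X : ℝ) ^ 2 * (2 * D * (X : ℝ) ^ 2) := by
    calc _ ≤ ∑ x ∈ Ico (0 : ℤ) X, ∑ y ∈ Ico (0 : ℤ) X, (2 * D * (X : ℝ) ^ 2) := by
          refine norm_sum_le_of_le _ fun x hx => norm_sum_le_of_le _ fun y hy => ?_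
          rw [mem_Ico] at hx hy
          obtain ⟨x', rfl⟩ := Int.eq_ofNat_of_zero_le hx.1
          obtain ⟨y', rfl⟩ := Int.eq_ofNat_of_zero_le hy.1
          have := norm_sum_shift_sub_le f hf c N (D * (x' * y'))
          push_cast at this
          refine this.trans ?_
          have hx' : (x' : ℝ) ≤ X := by exact_mod_cast hx.2.le
          have hy' : (y' : ℝ) ≤ X := by exact_mod_cast hy.2.le
          calc (2 * (D * (x' * y')) : ℝ) ≤ 2 * (D * (X * X)) := by gcongr
            _ = _ := by ring
      _ = _ := by
          simp_rw [sum_const, hcard, nsmul_eq_mul]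
          ring
  have hb2 : ‖∑ n ∈ Ioc c (c + N), ∑ x ∈ Ico (0 : ℤ) X, ∑ y ∈ Ico (0 : ℤ) X,
      f (n + D * (x * y))‖ ≤ N * T := by
    calc _ ≤ ∑ _n ∈ Ioc c (c + N), T := norm_sum_le_of_le _ fun n _ => hT n
      _ = _ := by rw [sum_const, hcI, nsmul_eq_mul]
  have hnorm : (X : ℝ) ^ 2 * ‖s‖ ≤ (X : ℝ) ^ 2 * (2 * D * (X : ℝ) ^ 2) + N * T := by
    have : (X : ℝ) ^ 2 * ‖s‖ = ‖(X : ℂ) ^ 2 * s‖ := by simp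
    rw [this, key]
    exact (norm_add_le _ _).trans (add_le_add hb1 hb2)
  have h3 : ‖s‖ ≤ ((X : ℝ) ^ 2 * (2 * D * (X : ℝ) ^ 2) + N * T) / (X : ℝ) ^ 2 := by
    rw [le_div_iff₀ hX0, mul_comm]
    exact hnorm
  refine h3.trans (le_of_eq ?_)
  field_simp
  ring

end Shift

section Phase

variable {q : ℕ}

theorem e_eq_stdAddChar [NeZero q] (v : ℤ) : e q v = ZMod.stdAddChar (v : ZMod q) := by
  rw [ZMod.stdAddChar_coe, e]

theorem intCast_invMod [NeZero q] (n : ℤ) : ((invMod q n : ℤ) : ZMod q) = (n : ZMod q)⁻¹ := by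
  rw [invMod, Int.cast_natCast, ZMod.natCast_zmod_val]

/-- The expansion of `(n + v)⁻¹` modulo `q` in powers of a nilpotent element
`v`. -/
theorem inv_add_nilpotent (n v : ZMod q) (hn : n * n⁻¹ = 1) (r : ℕ) (hv : v ^ r = 0) :
    (n + v)⁻¹ = ∑ i ∈ range r, (-1) ^ i * n⁻¹ ^ (i + 1) * v ^ i := by
  set t := ∑ i ∈ range r, (-1) ^ i * n⁻¹ ^ (i + 1) * v ^ i with ht
  have h1 : (n + v) * t = 1 := by
    have h2 : t = n⁻¹ * ∑ i ∈ range r, (-(n⁻¹ * v)) ^ i := by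
      rw [ht, mul_sum]
      refine sum_congr rfl fun i _ => ?_
      rw [neg_pow (n⁻¹ * v), mul_pow]
      ring
    have h3 : n + v = n * (1 - -(n⁻¹ * v)) := by
      rw [sub_neg_eq_add, mul_add, mul_one, ← mul_assoc, hn, one_mul]
    rw [h2, h3]
    calc n * (1 - -(n⁻¹ * v)) * (n⁻¹ * ∑ i ∈ range r, (-(n⁻¹ * v)) ^ i)
        = (n * n⁻¹) * ((1 - -(n⁻¹ * v)) * ∑ i ∈ range r, (-(n⁻¹ * v)) ^ i) := by ring
      _ = 1 := by
          rw [hn, mul_neg_geom_sum, neg_pow (n⁻¹ * v), mul_pow, hv]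
          ring
  exact ZMod.inv_eq_of_mul_eq_one q _ _ h1

/-- On a progression `n + D u` with `q ∣ D ^ (k + 1)` the Kloosterman phase is a polynomial in `u`
of degree `k`, whose coefficients beyond the linear one share their common factor with `q` with
the powers of `D`. -/
theorem exists_phase [NeZero q] (a b n : ℤ) (ha : Int.gcd a q = 1) (hn : Int.gcd n q = 1) (D k : ℕ)
    (hk : 1 ≤ k) (hD : q ∣ D ^ (k + 1)) :
    ∃ (A : Fin k → ℤ) (β : ZMod q),
      (∀ j : Fin k, 1 ≤ j.val → Int.gcd (A j) q = Nat.gcd (D ^ (j.val + 1)) q) ∧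
      ∀ u : ℤ, e q (a * invMod q (n + D * u) + b * (n + D * u))
        = ZMod.stdAddChar β * ZMod.stdAddChar (∑ j, (A j : ZMod q) * (u : ZMod q) ^ (j.val + 1)) := by
  have hq1 : 1 ≤ q := NeZero.one_le
  have hinv : (n : ZMod q) * (n : ZMod q)⁻¹ = 1 := by
    have := (ZMod.intCast_eq_intCast_iff _ _ _).2 (mul_invMod q hq1 n hn)
    push_cast at this
    rwa [intCast_invMod] at this
  refine ⟨fun j => a * (-1) ^ (j.val + 1) * invMod q n ^ (j.val + 2) * D ^ (j.val + 1)
    + if j.val = 0 then b * D else 0, a * (n : ZMod q)⁻¹ + b * n, ?_, ?_⟩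
  · intro j hj
    simp only [show j.val ≠ 0 by omega, if_false, add_zero]
    have hco : IsCoprime (a * (-1) ^ (j.val + 1) * invMod q n ^ (j.val + 2)) (q : ℤ) := by
      refine IsCoprime.mul_left (IsCoprime.mul_left ?_ ?_) ?_
      · exact Int.isCoprime_iff_gcd_eq_one.2 ha
      · exact IsCoprime.pow_left (isCoprime_one_left.neg_left)
      · refine IsCoprime.pow_left ?_
        obtain ⟨t, ht⟩ := (mul_invMod q hq1 n hn).dvd
        exact ⟨n, t, by linarith⟩
    rw [Int.gcd_mul_right_left_of_gcd_eq_one (Int.isCoprime_iff_gcd_eq_one.1 hco)]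
    exact_mod_cast Int.gcd_natCast_natCast (D ^ (j.val + 1)) q
  · intro u
    rw [e_eq_stdAddChar, ← AddChar.map_add_eq_mul]
    congr 1
    push_cast
    simp only [intCast_invMod]
    push_cast
    have hnil : ((D : ZMod q) * u) ^ (k + 1) = 0 := by
      rw [mul_pow]
      have : ((D ^ (k + 1) : ℕ) : ZMod q) = 0 := (ZMod.natCast_eq_zero_iff _ _).2 hD
      push_cast at this
      rw [this, zero_mul]
    rw [inv_add_nilpotent (n : ZMod q) (D * u) hinv (k + 1) hnil, sum_range_succ',
      ← Fin.sum_univ_eq_sum_range (fun i => (-1 : ZMod q) ^ (i + 1) * (n : ZMod q)⁻¹ ^ (i + 1 + 1)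
        * (D * u) ^ (i + 1)) k]
    have hlin : ∑ j : Fin k, (if j.val = 0 then (b : ZMod q) * D else 0) * (u : ZMod q) ^ (j.val + 1)
        = b * D * u := by
      rw [sum_eq_single (⟨0, hk⟩ : Fin k)]
      · simp
      · intro j _ hj
        rw [if_neg fun h => hj (Fin.ext h), zero_mul]
      · simp
    simp_rw [add_mul]
    rw [sum_add_distrib, hlin, mul_add, mul_sum]
    have : ∀ j : Fin k, (a : ZMod q) * ((-1) ^ (j.val + 1) * (n : ZMod q)⁻¹ ^ (j.val + 1 + 1)
        * (D * u) ^ (j.val + 1)) = a * (-1) ^ (j.val + 1) * (n : ZMod q)⁻¹ ^ (j.val + 2)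
          * D ^ (j.val + 1) * u ^ (j.val + 1) := by
      intro j
      rw [mul_pow]
      ring
    simp_rw [this]
    ring

/-- The incomplete Kloosterman sum is bounded by double sums of polynomial phases. -/
theorem norm_S_le [NeZero q] (N D k X : ℕ) (hX : 1 ≤ X) (hk : 1 ≤ k) (hD : q ∣ D ^ (k + 1))
    (hDk : kernel q ∣ D) (T : ℝ) (hT0 : 0 ≤ T)
    (hT : ∀ A : Fin k → ℤ,
      (∀ j : Fin k, 1 ≤ j.val → Int.gcd (A j) q = Nat.gcd (D ^ (j.val + 1)) q) →
      ‖∑ x ∈ Ico (0 : ℤ) X, ∑ y ∈ Ico (0 : ℤ) X, (ZMod.stdAddChar : AddChar (ZMod q) ℂ)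
        (∑ j, (A j : ZMod q) * (x : ZMod q) ^ (j.val + 1) * (y : ZMod q) ^ (j.val + 1))‖ ≤ T)
    (a b c : ℤ) (ha : Int.gcd a q = 1) :
    ‖S q N a b c‖ ≤ N * (T / (X : ℝ) ^ 2) + 2 * D * (X : ℝ) ^ 2 := by
  have hq0 : q ≠ 0 := NeZero.ne q
  rw [S, sum_filter]
  refine norm_sum_le_of_shift
    (fun n => if Int.gcd n q = 1 then e q (a * invMod q n + b * n) else 0) ?_ c N D X hX T ?_
  · intro m
    split_ifs
    · rw [e_eq_stdAddChar, AddChar.norm_apply]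
    · simp
  · intro n
    have hgcd : ∀ u : ℤ, Int.gcd (n + D * u) q = 1 ↔ Int.gcd n q = 1 := by
      intro u
      have hpr : ∀ m : ℤ, Int.gcd m q = 1 ↔ ∀ p ∈ q.primeFactors, ¬ (p : ℤ) ∣ m := by
        intro m
        constructor
        · intro h p hp hd
          have hpp := Nat.prime_of_mem_primeFactors hp
          have : (p : ℤ) ∣ Int.gcd m q :=
            Int.dvd_coe_gcd hd (by exact_mod_cast Nat.dvd_of_mem_primeFactors hp)
          rw [h] at this
          exact hpp.one_lt.ne' (Nat.dvd_one.1 (by exact_mod_cast this))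
        · intro h
          by_contra hne
          obtain ⟨p, hpp, hpd⟩ := Nat.exists_prime_and_dvd hne
          refine h p (Nat.mem_primeFactors.2 ⟨hpp, ?_, hq0⟩) ?_
          · have := (Int.natCast_dvd_natCast.2 hpd).trans (Int.gcd_dvd_right m (q : ℤ))
            exact_mod_cast this
          · exact (Int.natCast_dvd_natCast.2 hpd).trans (Int.gcd_dvd_left m (q : ℤ))
      rw [hpr, hpr]
      refine forall₂_congr fun p hp => ?_
      have hpD : (p : ℤ) ∣ D := by
        exact_mod_cast (dvd_prod_of_mem (fun p => p) hp).trans hDk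
      rw [dvd_add_left (hpD.mul_right u)]
    simp_rw [hgcd]
    by_cases hn : Int.gcd n q = 1
    · simp only [hn, if_true]
      obtain ⟨A, β, hA, hph⟩ := exists_phase (q := q) a b n ha hn D k hk hD
      simp_rw [hph, ← mul_sum]
      rw [norm_mul, AddChar.norm_apply, one_mul]
      refine le_trans (le_of_eq ?_) (hT A hA)
      congr 1
      refine sum_congr rfl fun x _ => sum_congr rfl fun y _ => ?_
      congr 1
      refine sum_congr rfl fun j _ => ?_
      push_cast
      ring
    · simp only [hn, if_false, sum_const_zero, norm_zero]
      exact hT0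

end Phase

end ShortKloosterman

/-! ### A modulus whose power is divisible by `q` -/

namespace ShortKloosterman

section Modulus

/-- For `q = ∏ p ^ v` the number `∏ p ^ (⌈v / r⌉ - 1)`; the exponent is written `(v - 1) / r` with
truncated division. -/
def rootExcess (q r : ℕ) : ℕ := ∏ p ∈ q.primeFactors, p ^ ((q.factorization p - 1) / r)

/-- The least `D ≥ 1` with `q ∣ D ^ r`, where `r ≥ 1`: for `q = ∏ p ^ v` it is `∏ p ^ ⌈v / r⌉`. -/
def rootModulus (q r : ℕ) : ℕ := kernel q * rootExcess q r

theorem rootModulus_eq (q r : ℕ) :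
    rootModulus q r = ∏ p ∈ q.primeFactors, p ^ ((q.factorization p - 1) / r + 1) := by
  rw [rootModulus, kernel, rootExcess, ← prod_mul_distrib]
  exact prod_congr rfl fun p _ => by rw [pow_succ']

theorem prod_primeFactors_pow_eq (q : ℕ) (hq : q ≠ 0) :
    ∏ p ∈ q.primeFactors, p ^ q.factorization p = q := by
  conv_rhs => rw [← Nat.prod_factorization_pow_eq_self hq]
  rfl

theorem one_le_factorization {q p : ℕ} (hp : p ∈ q.primeFactors) : 1 ≤ q.factorization p := by
  obtain ⟨h1, h2, h3⟩ := Nat.mem_primeFactors.1 hp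
  exact (h1.dvd_iff_one_le_factorization h3).1 h2

theorem dvd_rootModulus_pow (q r : ℕ) (hq : q ≠ 0) (hr : 1 ≤ r) : q ∣ rootModulus q r ^ r := by
  rw [rootModulus_eq, ← prod_pow]
  conv_lhs => rw [← prod_primeFactors_pow_eq q hq]
  refine prod_dvd_prod_of_dvd _ _ fun p hp => ?_
  rw [← pow_mul]
  refine pow_dvd_pow p ?_
  have := Nat.lt_mul_div_succ (q.factorization p - 1) hr
  rw [mul_comm]
  omega

theorem rootExcess_pow_le (q r : ℕ) (hq : q ≠ 0) : rootExcess q r ^ r ≤ q := by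
  rw [rootExcess, ← prod_pow]
  conv_rhs => rw [← prod_primeFactors_pow_eq q hq]
  refine prod_le_prod' fun p hp => ?_
  rw [← pow_mul]
  refine Nat.pow_le_pow_right (Nat.prime_of_mem_primeFactors hp).pos ?_
  exact (Nat.div_mul_le_self _ _).trans (Nat.sub_le _ _)

theorem rootExcess_eq_one {q r : ℕ} (hq : q ≠ 0) (hr : q ≤ r) : rootExcess q r = 1 := by
  refine prod_eq_one fun p _ => ?_
  have := Nat.factorization_lt p hq
  rw [Nat.div_eq_of_lt (by omega), pow_zero]

/-- A minimal degree: the excess is small for the exponent `k + 1`, and, unless `k` is the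
prescribed lower bound, it is large for the exponent `k`. -/
theorem exists_minimal_degree {q : ℕ} (hq : q ≠ 0) (k₀ : ℕ) {V : ℝ} (hV : 1 ≤ V) :
    ∃ k, k₀ ≤ k ∧ (rootExcess q (k + 1) : ℝ) ≤ V ∧ (k = k₀ ∨ V < rootExcess q k) := by
  classical
  have hex : ∃ k, k₀ ≤ k ∧ (rootExcess q (k + 1) : ℝ) ≤ V :=
    ⟨max k₀ q, le_max_left _ _, by
      rw [rootExcess_eq_one hq (by omega)]
      exact_mod_cast hV⟩
  obtain ⟨h1, h2⟩ := Nat.find_spec hex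
  refine ⟨Nat.find hex, h1, h2, ?_⟩
  rcases h1.eq_or_lt with h | h
  · exact Or.inl h.symm
  · right
    have := Nat.find_min hex (m := Nat.find hex - 1) (by omega)
    rw [not_and, Nat.sub_add_cancel (by omega)] at this
    exact not_le.1 (this (by omega))

theorem rootModulus_pos (q r : ℕ) : 0 < rootModulus q r := by
  rw [rootModulus_eq]
  exact prod_pos fun p hp => Nat.pow_pos (Nat.prime_of_mem_primeFactors hp).pos

theorem factorization_rootModulus (q r : ℕ) {p : ℕ} (hp : p ∈ q.primeFactors) :
    (rootModulus q r).factorization p = (q.factorization p - 1) / r + 1 := by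
  rw [rootModulus_eq, Nat.factorization_prod
    (fun p hp => (Nat.pow_pos (Nat.prime_of_mem_primeFactors hp).pos).ne'), Finsupp.finsetSum_apply,
    sum_eq_single p]
  · rw [(Nat.prime_of_mem_primeFactors hp).factorization_pow, Finsupp.single_eq_same]
  · intro p' hp' hne
    rw [(Nat.prime_of_mem_primeFactors hp').factorization_pow, Finsupp.single_eq_of_ne hne.symm]
  · exact fun h => absurd hp h

/-- If `j ≤ (ρ + 1) / 4`, the primes dividing `q` to a power larger than `ρ` keep at least half of
their exponent in `q / gcd (D ^ j, q)`. -/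
theorem gcd_rootModulus_sq_mul_le (q ρ j : ℕ) (hq : q ≠ 0) (hj : 4 * j ≤ ρ + 1) :
    Nat.gcd (rootModulus q (ρ + 1) ^ j) q ^ 2 * rootExcess q ρ ^ ρ ≤ q ^ 2 := by
  set g := Nat.gcd (rootModulus q (ρ + 1) ^ j) q with hg
  have hg0 : g ≠ 0 := (Nat.gcd_pos_of_pos_right _ (Nat.pos_of_ne_zero hq)).ne'
  have hDj : rootModulus q (ρ + 1) ^ j ≠ 0 := (Nat.pow_pos (rootModulus_pos q _)).ne'
  have hgprod : g = ∏ p ∈ q.primeFactors, p ^ g.factorization p := by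
    conv_lhs => rw [← Nat.prod_factorization_pow_eq_self hg0]
    refine Finsupp.prod_of_support_subset _ ?_ _ fun _ _ => pow_zero _
    exact Nat.primeFactors_mono (Nat.gcd_dvd_right _ _) hq
  rw [hgprod, rootExcess, ← prod_pow, ← prod_pow, ← prod_mul_distrib]
  conv_rhs => rw [← prod_primeFactors_pow_eq q hq, ← prod_pow]
  refine prod_le_prod' fun p hp => ?_
  rw [← pow_mul, ← pow_mul, ← pow_mul, ← pow_add]
  refine Nat.pow_le_pow_right (Nat.prime_of_mem_primeFactors hp).pos ?_
  have hmin : g.factorization p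
      = min (j * ((q.factorization p - 1) / (ρ + 1) + 1)) (q.factorization p) := by
    rw [hg, Nat.factorization_gcd hDj hq, Finsupp.inf_apply, Nat.factorization_pow,
      Finsupp.smul_apply, factorization_rootModulus q _ hp, smul_eq_mul]
  rw [hmin]
  have hv := one_le_factorization hp
  set v := q.factorization p
  rcases le_or_gt v ρ with h | h
  · have : (v - 1) / ρ = 0 := Nat.div_eq_of_lt (by omega)
    rw [this]
    have := min_le_right (j * ((v - 1) / (ρ + 1) + 1)) v
    omega
  · have h1 := Nat.div_mul_le_self (v - 1) ρ
    have h2 := Nat.div_mul_le_self (v - 1) (ρ + 1)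
    have h3 := min_le_left (j * ((v - 1) / (ρ + 1) + 1)) v
    have h4 : 4 * (j * ((v - 1) / (ρ + 1) + 1)) ≤ 2 * v := by
      calc 4 * (j * ((v - 1) / (ρ + 1) + 1)) = (4 * j) * ((v - 1) / (ρ + 1) + 1) := by ring
        _ ≤ (ρ + 1) * ((v - 1) / (ρ + 1) + 1) := Nat.mul_le_mul_right _ hj
        _ = (v - 1) / (ρ + 1) * (ρ + 1) + (ρ + 1) := by ring
        _ ≤ 2 * v := by omega
    omega

end Modulus

end ShortKloosterman

/-! ### The saving from a window of degrees -/

namespace Vinogradov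

section Saving

variable {q : ℕ}

/-- The constant in `norm_bilinear_pow_le_of_window`. -/
noncomputable def bilinearConst (k l s : ℕ) : ℝ :=
  ((16 * k ^ 2) ^ k ^ 3 * meanStep k s ^ l : ℕ) ^ 2 * (12 * (s : ℝ) ^ 2) ^ k

theorem one_le_bilinearConst {k l s : ℕ} (hk : 2 ≤ k) (hs : 1 ≤ s) : 1 ≤ bilinearConst k l s := by
  have h1 : 1 ≤ (16 * k ^ 2) ^ k ^ 3 * meanStep k s ^ l := by
    have : 0 < k := by omega
    have : 0 < s := by omega
    unfold meanStep
    exact Nat.one_le_iff_ne_zero.2 (by positivity)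
  have h1' : (1 : ℝ) ≤ ((16 * k ^ 2) ^ k ^ 3 * meanStep k s ^ l : ℕ) := by exact_mod_cast h1
  have h2 : (1 : ℝ) ≤ 12 * (s : ℝ) ^ 2 := by
    have : (1 : ℝ) ≤ s := by exact_mod_cast hs
    nlinarith
  exact one_le_mul_of_one_le_of_one_le (one_le_pow₀ h1') (one_le_pow₀ h2)

theorem dualSum_le_general [NeZero q] (a : ℤ) (s X j : ℕ) (hs : 1 ≤ s) (hX : 1 ≤ X) :
    dualSum (ZMod.stdAddChar : AddChar (ZMod q) ℂ) (a : ZMod q) (s * X ^ j)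
      ≤ 12 * (s : ℝ) ^ 2 * (X : ℝ) ^ (2 * j) := by
  have h1 : (1 : ℝ) ≤ s * (X : ℝ) ^ j := by
    have h2 : (1 : ℝ) ≤ s := by exact_mod_cast hs
    have h3 : (1 : ℝ) ≤ X := by exact_mod_cast hX
    exact one_le_mul_of_one_le_of_one_le h2 (one_le_pow₀ h3)
  refine (dualSum_le_sq _ _ _).trans ?_
  push_cast
  calc (2 * (s * (X : ℝ) ^ j) + 1) ^ 2 ≤ (3 * (s * (X : ℝ) ^ j)) ^ 2 := by
        gcongr
        linarith
    _ = 9 * (s : ℝ) ^ 2 * (X : ℝ) ^ (2 * j) := by ring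
    _ ≤ _ := by gcongr; norm_num

theorem dualSum_le_window [NeZero q] (a : ℤ) (s X j : ℕ) (hs : 1 ≤ s) (hX : 1 ≤ X) (V : ℝ)
    (hV : 0 < V) (h1 : V ≤ √((q / Int.gcd a q : ℕ) : ℝ))
    (h2 : √((q / Int.gcd a q : ℕ) : ℝ) * V ≤ (X : ℝ) ^ j) :
    dualSum (ZMod.stdAddChar : AddChar (ZMod q) ℂ) (a : ZMod q) (s * X ^ j)
      ≤ 12 * (s : ℝ) ^ 2 * (X : ℝ) ^ (2 * j) * V⁻¹ := by
  refine (dualSum_le_of_order a (s * X ^ j)).trans ?_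
  set w := √((q / Int.gcd a q : ℕ) : ℝ) with hw
  have hw2 : ((q / Int.gcd a q : ℕ) : ℝ) = w ^ 2 := (Real.sq_sqrt (Nat.cast_nonneg _)).symm
  have hw0 : 0 < w := hV.trans_le h1
  have hs1 : (1 : ℝ) ≤ s := by exact_mod_cast hs
  have hX1 : (1 : ℝ) ≤ (X : ℝ) ^ j := one_le_pow₀ (by exact_mod_cast hX)
  have hb : (1 : ℝ) ≤ s * (X : ℝ) ^ j := one_le_mul_of_one_le_of_one_le hs1 hX1
  rw [hw2]
  push_cast
  set Z := (X : ℝ) ^ j with hZ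
  have hZ2 : (X : ℝ) ^ (2 * j) = Z ^ 2 := by rw [hZ, ← pow_mul, mul_comm]
  rw [hZ2]
  have hK : 2 * (s * Z) + 1 ≤ 3 * (s * Z) := by linarith
  have hZ0 : 0 < Z := by linarith
  calc (2 * (s * Z) + 1) * (2 * (s * Z) + 1 + w ^ 2) / w
      ≤ (3 * (s * Z)) * (3 * (s * Z) + w ^ 2) / w := by gcongr
    _ = 9 * (s * Z) ^ 2 * w⁻¹ + 3 * (s * Z) * w := by field_simp; ring
    _ ≤ 9 * (s * Z) ^ 2 * V⁻¹ + 3 * (s * Z) * (Z * V⁻¹) := by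
        gcongr
        rw [← div_eq_mul_inv, le_div_iff₀ hV]
        exact h2
    _ ≤ 9 * (s * Z) ^ 2 * V⁻¹ + 3 * (s * Z) * (s * Z * V⁻¹) := by
        gcongr
        exact le_mul_of_one_le_left hZ0.le hs1
    _ = _ := by ring

/-- The bilinear sum with the saving `V` for each coefficient in the window `W`. -/
theorem norm_bilinear_pow_le_of_window [NeZero q] {k : ℕ} (hk : 2 ≤ k) (l s X : ℕ)
    (hs : s = 2 * k ^ 2 + k * l) (hX : 1 ≤ X) (A : Fin k → ℤ) (W : Finset (Fin k)) (V : ℝ)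
    (hV : 0 < V)
    (h1 : ∀ j ∈ W, V ≤ √((q / Int.gcd (A j) q : ℕ) : ℝ))
    (h2 : ∀ j ∈ W, √((q / Int.gcd (A j) q : ℕ) : ℝ) * V ≤ (X : ℝ) ^ (j.val + 1)) :
    ‖∑ x ∈ Ico (0 : ℤ) X, ∑ y ∈ Ico (0 : ℤ) X, (ZMod.stdAddChar : AddChar (ZMod q) ℂ)
        (∑ j, (A j : ZMod q) * (x : ZMod q) ^ (j.val + 1) * (y : ZMod q) ^ (j.val + 1))‖
          ^ (2 * s * (2 * s))
      ≤ (X : ℝ) ^ (8 * s ^ 2) * (bilinearConst k l s *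
        (X : ℝ) ^ (2 * ((k : ℝ) * (k + 1) / 2 * (1 - 1 / (k : ℝ)) ^ l))) * V⁻¹ ^ #W := by
  have hk0 : 0 < k := by omega
  have hs1 : 1 ≤ s := by
    rw [hs]
    have : 0 < 2 * k ^ 2 := by positivity
    omega
  have hX0 : (0 : ℝ) < X := by exact_mod_cast hX
  refine (norm_bilinear_pow_le _ k s X hs1 fun j => (A j : ZMod q)).trans ?_
  have hJ : (meanValue k s X : ℝ)
      ≤ ((16 * k ^ 2) ^ k ^ 3 * meanStep k s ^ l : ℕ) * (X : ℝ) ^ meanExponent k l := by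
    have := meanValue_le hk s l hs.ge X hX
    rwa [← hs] at this
  have hprod : ∏ j : Fin k, dualSum (ZMod.stdAddChar : AddChar (ZMod q) ℂ) (A j : ZMod q)
      (s * X ^ (j.val + 1)) ≤ (12 * (s : ℝ) ^ 2) ^ k * (X : ℝ) ^ (k * (k + 1)) * V⁻¹ ^ #W := by
    calc _ ≤ ∏ j : Fin k, (12 * (s : ℝ) ^ 2 * (X : ℝ) ^ (2 * (j.val + 1))
          * if j ∈ W then V⁻¹ else 1) := by
          refine prod_le_prod (fun j _ => dualSum_nonneg _ _ _) fun j _ => ?_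
          split_ifs with hj
          · exact dualSum_le_window (A j) s X _ hs1 hX V hV (h1 j hj) (h2 j hj)
          · rw [mul_one]
            exact dualSum_le_general (A j) s X _ hs1 hX
      _ = _ := by
          rw [prod_mul_distrib, prod_mul_distrib, prod_const, card_univ, Fintype.card_fin,
            prod_pow_eq_pow_sum, prod_ite_mem, univ_inter, prod_const]
          congr 3
          rw [← mul_sum, Fin.sum_univ_eq_sum_range (fun i => i + 1) k, sum_add_distrib,
            sum_const, card_range, smul_eq_mul, mul_one, mul_add, mul_comm 2 (∑ i ∈ range k, i),
            Finset.sum_range_id_mul_two]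
          obtain ⟨m, rfl⟩ : ∃ m, k = m + 1 := ⟨k - 1, by omega⟩
          simp only [Nat.add_sub_cancel]
          ring
  have hdual0 : 0 ≤ ∏ j : Fin k, dualSum (ZMod.stdAddChar : AddChar (ZMod q) ℂ) (A j : ZMod q)
      (s * X ^ (j.val + 1)) := prod_nonneg fun j _ => dualSum_nonneg _ _ _
  set C : ℝ := (((16 * k ^ 2) ^ k ^ 3 * meanStep k s ^ l : ℕ) : ℝ) with hC
  set η := (k : ℝ) * (k + 1) / 2 * (1 - 1 / (k : ℝ)) ^ l with hη
  have hE : meanExponent k l = 2 * s - k * (k + 1) / 2 + η := by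
    rw [meanExponent, hs]
    push_cast
    ring
  have hXpow : (X : ℝ) ^ (2 * (2 * s * (2 * s - 1))) * ((X : ℝ) ^ meanExponent k l) ^ 2
      * (X : ℝ) ^ (k * (k + 1)) = (X : ℝ) ^ (8 * s ^ 2) * (X : ℝ) ^ (2 * η) := by
    rw [← Real.rpow_natCast, ← Real.rpow_natCast _ (k * (k + 1)), ← Real.rpow_natCast _ 2,
      ← Real.rpow_natCast _ (8 * s ^ 2), ← Real.rpow_mul hX0.le, ← Real.rpow_add hX0,
      ← Real.rpow_add hX0, ← Real.rpow_add hX0, hE]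
    congr 1
    push_cast [Nat.cast_sub (show 1 ≤ 2 * s by omega)]
    ring
  have hC0 : 0 ≤ C := Nat.cast_nonneg _
  calc _ ≤ (X : ℝ) ^ (2 * (2 * s * (2 * s - 1))) * (C * (X : ℝ) ^ meanExponent k l) ^ 2
        * ((12 * (s : ℝ) ^ 2) ^ k * (X : ℝ) ^ (k * (k + 1)) * V⁻¹ ^ #W) := by
        refine mul_le_mul (mul_le_mul_of_nonneg_left
          (pow_le_pow_left₀ (Nat.cast_nonneg _) hJ 2) (by positivity)) hprod hdual0 (by positivity)
    _ = ((X : ℝ) ^ (2 * (2 * s * (2 * s - 1))) * ((X : ℝ) ^ meanExponent k l) ^ 2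
      * (X : ℝ) ^ (k * (k + 1))) * (C ^ 2 * (12 * (s : ℝ) ^ 2) ^ k) * V⁻¹ ^ #W := by ring
    _ = _ := by
        rw [hXpow, bilinearConst]
        ring

end Saving

end Vinogradov

/-! ### Numerical bounds for the constants -/

namespace Vinogradov

section Constants

/-- The bounds for `L = log (1 / δ)` that make the constants fit. -/
theorem log_one_div_bounds {δ : ℝ} (h0 : 0 < δ) (h1 : δ < 0.1) :
    2.2 ≤ Real.log (1 / δ) ∧ δ * Real.log (1 / δ) ^ 2 ≤ 1 := by
  have h10 : (10 : ℝ) ≤ 1 / δ := by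
    rw [le_div_iff₀ h0]
    norm_num at h1 ⊢
    linarith
  have hlog2 := Real.log_two_gt_d9
  have hlog2' := Real.log_two_lt_d9
  constructor
  · have h2 : Real.log 10 ≤ Real.log (1 / δ) := Real.log_le_log (by norm_num) h10
    have h3 : (33 : ℝ) * Real.log 2 ≤ 10 * Real.log 10 := by
      have : Real.log ((2 : ℝ) ^ 33) ≤ Real.log ((10 : ℝ) ^ 10) :=
        Real.log_le_log (by norm_num) (by norm_num)
      rw [Real.log_pow, Real.log_pow] at this
      exact_mod_cast this
    linarith
  · -- With `t = δ ^ (-1 / 2)` the claim is `2 log t ≤ t`.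
    set t := √(1 / δ) with ht
    have ht0 : 0 < t := Real.sqrt_pos.2 (by positivity)
    have htt : t ^ 2 = 1 / δ := Real.sq_sqrt (by positivity)
    have h4 : Real.log (1 / δ) = 2 * Real.log t := by
      rw [← htt, Real.log_pow]
      norm_num
    have h5 : Real.log t ≤ t / 2 := by
      have := Real.log_le_sub_one_of_pos (show 0 < t / 2 by positivity)
      rw [Real.log_div ht0.ne' (by norm_num)] at this
      linarith
    have h6 : 0 ≤ Real.log (1 / δ) := Real.log_nonneg (by linarith)
    have h7 : Real.log (1 / δ) ^ 2 ≤ t ^ 2 := pow_le_pow_left₀ h6 (by linarith) 2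
    calc δ * Real.log (1 / δ) ^ 2 ≤ δ * t ^ 2 := by gcongr
      _ = 1 := by rw [htt]; field_simp

variable {k l s : ℕ} {L : ℝ}

theorem tuple_length_le (hL : 2.2 ≤ L) (hl : (l : ℝ) ≤ k * (2 * L + 13))
    (hs : s = 2 * k ^ 2 + k * l) : (s : ℝ) ≤ 9 * L * k ^ 2 := by
  rw [hs]
  push_cast
  norm_num at hL
  have hk : (0 : ℝ) ≤ k := Nat.cast_nonneg _
  have h1 : (k : ℝ) * l ≤ k * (k * (2 * L + 13)) := by gcongr
  nlinarith [mul_nonneg hk hk]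

theorem log_bilinearConst_le (hk : 2 ≤ k) (hL : 2.2 ≤ L) (hl : (l : ℝ) ≤ k * (2 * L + 13))
    (hs : s = 2 * k ^ 2 + k * l) :
    Real.log (bilinearConst k l s) ≤ 690 * L ^ 2 * k ^ 4 := by
  have hs9 := tuple_length_le hL hl hs
  norm_num at hL
  have hk2 : (2 : ℝ) ≤ k := by exact_mod_cast hk
  have hk0 : (0 : ℝ) < k := by linarith
  have hs1 : 1 ≤ s := by
    rw [hs]
    have : 0 < 2 * k ^ 2 := by positivity
    omega
  have hs0 : (0 : ℝ) < s := by exact_mod_cast hs1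
  have hlog2 := Real.log_two_lt_d9
  have hlog2' := Real.log_two_gt_d9
  have hlogk : Real.log k ≤ k := (Real.log_le_sub_one_of_pos hk0).trans (by linarith)
  have hlogk0 : 0 ≤ Real.log k := Real.log_nonneg (by linarith)
  have hlog4 : Real.log 4 = 2 * Real.log 2 := by
    rw [show (4 : ℝ) = 2 ^ 2 by norm_num, Real.log_pow]
    norm_num
  have hlog16 : Real.log 16 = 4 * Real.log 2 := by
    rw [show (16 : ℝ) = 2 ^ 4 by norm_num, Real.log_pow]
    norm_num
  have hlog12 : Real.log 12 ≤ 4 * Real.log 2 := by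
    rw [← hlog16]
    exact Real.log_le_log (by norm_num) (by norm_num)
  have hlogs : Real.log s ≤ 9 * L + 2 * k := by
    have h1 : Real.log s ≤ Real.log (9 * L * k ^ 2) := Real.log_le_log hs0 hs9
    rw [Real.log_mul (by positivity) (by positivity), Real.log_pow] at h1
    have h2 := Real.log_le_sub_one_of_pos (show 0 < 9 * L by positivity)
    push_cast at h1
    linarith
  have hstep : Real.log (meanStep k s) ≤ 26 * L * k ^ 2 := by
    have h1 : Real.log (meanStep k s) = Real.log 4 + 2 * k * Real.log s + k * Real.log k
        + k ^ 2 * Real.log 4 + s * Real.log 4 := by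
      rw [meanStep]
      push_cast
      rw [Real.log_mul (by positivity) (by positivity), Real.log_mul (by positivity) (by positivity),
        Real.log_mul (by positivity) (by positivity), Real.log_mul (by positivity) (by positivity),
        Real.log_pow, Real.log_pow, Real.log_pow, Real.log_pow]
      push_cast
      ring
    rw [h1, hlog4]
    have h2 : 2 * k * Real.log s ≤ 2 * k * (9 * L + 2 * k) := by gcongr
    have h3 : (k : ℝ) * Real.log k ≤ k * k := by gcongr
    have h4 : (s : ℝ) * (2 * Real.log 2) ≤ (9 * L * k ^ 2) * 1.4 := by
      refine mul_le_mul hs9 (by norm_num; linarith) (by linarith) (by positivity)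
    have h5 : (k : ℝ) ^ 2 * (2 * Real.log 2) ≤ k ^ 2 * 1.4 := by
      refine mul_le_mul_of_nonneg_left (by norm_num; linarith) (by positivity)
    norm_num at h4 h5
    nlinarith [mul_nonneg (show (0 : ℝ) ≤ L by linarith) hk0.le]
  have hstep0 : (0 : ℝ) < meanStep k s := by
    unfold meanStep
    have : 0 < k := by omega
    exact_mod_cast (by positivity)
  have hl8 : (l : ℝ) ≤ 8 * L * k := by nlinarith
  have hmain : Real.log (bilinearConst k l s) = 2 * (k ^ 3 * (Real.log 16 + 2 * Real.log k)
      + l * Real.log (meanStep k s)) + k * (Real.log 12 + 2 * Real.log s) := by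
    rw [bilinearConst]
    push_cast
    rw [Real.log_mul (by positivity) (by positivity), Real.log_pow,
      Real.log_mul (by positivity) (by positivity), Real.log_pow, Real.log_pow, Real.log_pow,
      Real.log_mul (by norm_num) (by positivity), Real.log_pow,
      Real.log_mul (by norm_num) (by positivity), Real.log_pow]
    push_cast
    ring
  rw [hmain, hlog16]
  have h1 : (k : ℝ) ^ 3 * (4 * Real.log 2 + 2 * Real.log k) ≤ k ^ 3 * (4 * k) := by
    refine mul_le_mul_of_nonneg_left ?_ (by positivity)
    have : Real.log k ≤ k - 1 := Real.log_le_sub_one_of_pos hk0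
    linarith
  have h2 : (l : ℝ) * Real.log (meanStep k s) ≤ (8 * L * k) * (26 * L * k ^ 2) := by
    have : (1 : ℝ) ≤ meanStep k s := by
      exact_mod_cast Nat.one_le_iff_ne_zero.2 (by rintro h; rw [h] at hstep0; simp at hstep0)
    exact mul_le_mul hl8 hstep (Real.log_nonneg this) (by positivity)
  have h3 : (k : ℝ) * (Real.log 12 + 2 * Real.log s) ≤ k * (20 * L + 4 * k) := by
    refine mul_le_mul_of_nonneg_left ?_ hk0.le
    linarith
  have hL4 : (4 : ℝ) ≤ L ^ 2 := by nlinarith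
  have h4 : (k : ℝ) ^ 3 ≤ k ^ 4 := pow_le_pow_right₀ (by linarith) (by norm_num)
  have h5 : (k : ℝ) ≤ k ^ 4 := le_self_pow₀ (by linarith) (by norm_num)
  have h6 : (k : ℝ) ^ 2 ≤ k ^ 4 := pow_le_pow_right₀ (by linarith) (by norm_num)
  have hL1 : L ≤ L ^ 2 := by nlinarith
  have hk4 : (0 : ℝ) ≤ (k : ℝ) ^ 4 := by positivity
  have e1 : L ^ 2 * (k : ℝ) ^ 3 ≤ L ^ 2 * k ^ 4 := by gcongr
  have e2 : L * (k : ℝ) ≤ L ^ 2 * k ^ 4 := by gcongr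
  have e3 : (k : ℝ) ^ 4 * 4 ≤ (k : ℝ) ^ 4 * L ^ 2 := by gcongr
  nlinarith

/-- After `k (2 log (1 / δ) + 12)` steps the excess exponent in the mean value theorem is
negligible against `δ ^ 2 k ^ 2`. -/
theorem excess_le {δ : ℝ} (h0 : 0 < δ) (hk : 2 ≤ k)
    (hl : k * (2 * Real.log (1 / δ) + 12) ≤ (l : ℝ)) :
    (k : ℝ) * (k + 1) / 2 * (1 - 1 / (k : ℝ)) ^ l ≤ δ ^ 2 * k ^ 2 / 160000 := by
  have hk2 : (2 : ℝ) ≤ k := by exact_mod_cast hk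
  have hk0 : (0 : ℝ) < k := by linarith
  have h1 : (1 - 1 / (k : ℝ)) ^ l ≤ Real.exp (-(1 / k)) ^ l := by
    refine pow_le_pow_left₀ ?_ ?_ l
    · rw [sub_nonneg, div_le_one hk0]
      linarith
    · have := Real.add_one_le_exp (-(1 / (k : ℝ)))
      linarith
  have h2 : Real.exp (-(1 / k)) ^ l ≤ δ ^ 2 / 160000 := by
    rw [← Real.exp_nat_mul]
    have h3 : (l : ℝ) * -(1 / k) ≤ 2 * Real.log δ - 12 := by
      have : 2 * Real.log (1 / δ) + 12 ≤ l / k := by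
        rw [le_div_iff₀ hk0]
        linarith
      rw [one_div, Real.log_inv] at this
      have e : (l : ℝ) * -(1 / k) = -(l / k) := by ring
      rw [e]
      linarith
    calc Real.exp ((l : ℝ) * -(1 / k)) ≤ Real.exp (2 * Real.log δ - 12) := Real.exp_le_exp.2 h3
      _ = δ ^ 2 / Real.exp 12 := by
          rw [Real.exp_sub, two_mul, Real.exp_add, Real.exp_log h0, sq]
      _ ≤ δ ^ 2 / 160000 := by
          refine div_le_div_of_nonneg_left (by positivity) (by norm_num) ?_
          have h4 : (2.718 : ℝ) ^ 12 ≤ Real.exp 1 ^ 12 :=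
            pow_le_pow_left₀ (by norm_num) (by linarith [Real.exp_one_gt_d9]) 12
          rw [← Real.exp_nat_mul] at h4
          norm_num at h4 ⊢
          linarith
  calc (k : ℝ) * (k + 1) / 2 * (1 - 1 / (k : ℝ)) ^ l ≤ k ^ 2 * (δ ^ 2 / 160000) := by
        refine mul_le_mul (by nlinarith) (h1.trans h2) ?_ (by positivity)
        refine pow_nonneg ?_ l
        rw [sub_nonneg, div_le_one hk0]
        linarith
    _ = _ := by ring

/-- The total cost of the constants, of rounding `X` and of the excess exponent is at most half of
the saving `σ`. -/
theorem bilinearConst_mul_le {δ σ N R : ℝ} {X : ℕ} (h0 : 0 < δ) (h1 : δ < 0.1) (hk : 2 ≤ k)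
    (hl : k * (2 * Real.log (1 / δ) + 12) ≤ (l : ℝ))
    (hl' : (l : ℝ) ≤ k * (2 * Real.log (1 / δ) + 13)) (hs : s = 2 * k ^ 2 + k * l)
    (hN : 1 < N) (hX1 : 1 ≤ X) (hX : (X : ℝ) ≤ 2 * N ^ (1 / 4 : ℝ))
    (hΛ : 1200 ^ 3 * Real.log (1 / δ) ^ 2 * R ^ 2 ≤ δ ^ 6 * Real.log N)
    (hR : δ ^ 2 * k ^ 2 ≤ 260 * R ^ 2) (hσ : δ ^ 2 * k ^ 2 / 63000 ≤ σ) :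
    bilinearConst k l s * (X : ℝ) ^ (2 * ((k : ℝ) * (k + 1) / 2 * (1 - 1 / (k : ℝ)) ^ l))
      ≤ N ^ (σ / 2) := by
  obtain ⟨hL, hδL⟩ := log_one_div_bounds h0 h1
  have hη := excess_le h0 hk hl
  obtain ⟨hη0, -⟩ := excess_bounds hk l
  have hC := log_bilinearConst_le hk hL hl' hs
  have hk2 : (2 : ℝ) ≤ k := by exact_mod_cast hk
  have hs1 : 1 ≤ s := by
    rw [hs]
    have : 0 < 2 * k ^ 2 := by positivity
    omega
  have hC1 := one_le_bilinearConst (l := l) hk hs1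
  set L := Real.log (1 / δ)
  set η := (k : ℝ) * (k + 1) / 2 * (1 - 1 / (k : ℝ)) ^ l
  set Λ := Real.log N with hΛdef
  have hX0 : (0 : ℝ) < X := by exact_mod_cast hX1
  have hN0 : 0 < N := by linarith
  have hΛ0 : 0 < Λ := Real.log_pos hN
  have hlogX : Real.log X ≤ 1 + Λ / 4 := by
    have h2 : Real.log X ≤ Real.log (2 * N ^ (1 / 4 : ℝ)) := Real.log_le_log hX0 hX
    rw [Real.log_mul (by norm_num) (by positivity), Real.log_rpow hN0] at h2
    linarith [Real.log_two_lt_d9]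
  norm_num at hL
  have hkk : 0 ≤ δ ^ 2 * (k : ℝ) ^ 2 := by positivity
  -- The lower bound for `log N` in terms of the degree.
  have hbudget : 690 * L ^ 2 * (k : ℝ) ^ 4 + k ^ 2 ≤ δ ^ 2 * k ^ 2 / 250000 * Λ := by
    have e1 : 1200 ^ 3 * L ^ 2 * (δ ^ 2 * k ^ 2) ≤ 260 * (δ ^ 6 * Λ) := by
      calc 1200 ^ 3 * L ^ 2 * (δ ^ 2 * k ^ 2) ≤ 1200 ^ 3 * L ^ 2 * (260 * R ^ 2) := by gcongr
        _ = 260 * (1200 ^ 3 * L ^ 2 * R ^ 2) := by ring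
        _ ≤ _ := by gcongr
    have e2 : 1200 ^ 3 * L ^ 2 * (k : ℝ) ^ 2 ≤ 260 * (δ ^ 4 * Λ) := by
      have : δ ^ 2 * (1200 ^ 3 * L ^ 2 * (k : ℝ) ^ 2) ≤ δ ^ 2 * (260 * (δ ^ 4 * Λ)) := by
        calc _ = 1200 ^ 3 * L ^ 2 * (δ ^ 2 * k ^ 2) := by ring
          _ ≤ _ := e1
          _ = _ := by ring
      exact le_of_mul_le_mul_left this (by positivity)
    have hδ2 : δ ^ 2 ≤ 1 / 100 := by
      norm_num at h1
      nlinarith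
    have e3 : δ ^ 4 * Λ ≤ δ ^ 2 / 100 * Λ := by
      have : δ ^ 4 = δ ^ 2 * δ ^ 2 := by ring
      rw [this]
      refine mul_le_mul_of_nonneg_right ?_ hΛ0.le
      nlinarith [sq_nonneg δ]
    have e4 : 1200 ^ 3 * L ^ 2 * (k : ℝ) ^ 2 ≤ 2.6 * (δ ^ 2 * Λ) := by
      norm_num
      linarith
    have e5 : 1200 ^ 3 * L ^ 2 * (k : ℝ) ^ 2 * k ^ 2 ≤ 2.6 * (δ ^ 2 * Λ) * k ^ 2 := by gcongr
    have e6 : (k : ℝ) ^ 2 ≤ L ^ 2 * k ^ 4 := by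
      have a1 : (1 : ℝ) ≤ L ^ 2 := by nlinarith
      have a2 : (k : ℝ) ^ 2 ≤ k ^ 4 := pow_le_pow_right₀ (by linarith) (by norm_num)
      nlinarith [pow_nonneg (show (0 : ℝ) ≤ k by linarith) 4]
    norm_num at e5
    have e7 : 0 ≤ L ^ 2 * (k : ℝ) ^ 4 := by positivity
    linarith
  have hηX : 2 * η * Real.log X ≤ k ^ 2 + δ ^ 2 * k ^ 2 / 320000 * Λ := by
    have e1 : 2 * η * Real.log X ≤ 2 * (δ ^ 2 * k ^ 2 / 160000) * (1 + Λ / 4) := by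
      have : 0 ≤ Real.log X := Real.log_nonneg (by exact_mod_cast hX1)
      gcongr
    have e2 : δ ^ 2 ≤ 1 := by
      norm_num at h1
      nlinarith
    have e3 := mul_le_mul_of_nonneg_right e2 (sq_nonneg (k : ℝ))
    have e4 : 2 * (δ ^ 2 * k ^ 2 / 160000) * (1 + Λ / 4)
        = δ ^ 2 * k ^ 2 / 80000 + δ ^ 2 * k ^ 2 / 320000 * Λ := by ring
    have e5 := sq_nonneg (k : ℝ)
    linarith
  rw [← Real.log_le_log_iff (by positivity) (by positivity),
    Real.log_mul (by positivity) (by positivity), Real.log_rpow hX0, Real.log_rpow hN0]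
  have hσΛ : δ ^ 2 * k ^ 2 / 63000 / 2 * Λ ≤ σ / 2 * Λ := by gcongr
  linarith [mul_nonneg hkk hΛ0.le]

end Constants

end Vinogradov

/-! ### The choice of the degree and of the window -/

namespace ShortKloosterman

section Window

/-- The degrees `j + 1` lying in `[a, b]`. -/
noncomputable def degreeWindow (k : ℕ) (a b : ℝ) : Finset (Fin k) :=
  {j : Fin k | a ≤ ((j.val + 1 : ℕ) : ℝ) ∧ ((j.val + 1 : ℕ) : ℝ) ≤ b}

theorem card_degreeWindow {k : ℕ} {a b : ℝ} (ha : 0 < a) (hb0 : 0 ≤ b) (hb : b ≤ k) :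
    b - a - 1 ≤ #(degreeWindow k a b) := by
  have h1 : #(Icc ⌈a⌉₊ ⌊b⌋₊) ≤ #(degreeWindow k a b) := by
    have hpos : ∀ n ∈ Icc ⌈a⌉₊ ⌊b⌋₊, 1 ≤ n ∧ n ≤ k := by
      intro n hn
      rw [mem_Icc] at hn
      have h2 : 0 < ⌈a⌉₊ := Nat.ceil_pos.2 ha
      have h3 : ⌊b⌋₊ ≤ k := Nat.floor_le_of_le hb
      omega
    refine card_le_card_of_surjOn (fun j => j.val + 1) ?_
    intro n hn
    obtain ⟨h2, h3⟩ := hpos n hn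
    rw [mem_coe, mem_Icc] at hn
    have hn1 : n - 1 + 1 = n := by omega
    refine ⟨⟨n - 1, by omega⟩, ?_, hn1⟩
    rw [degreeWindow, mem_coe, mem_filter]
    refine ⟨mem_univ _, ?_, ?_⟩
    · simp only [hn1]
      exact Nat.ceil_le.1 hn.1
    · simp only [hn1]
      exact (Nat.le_floor_iff hb0).1 hn.2
  have h2 : b - a - 1 ≤ (#(Icc ⌈a⌉₊ ⌊b⌋₊) : ℝ) := by
    rw [Nat.card_Icc]
    have h3 := Nat.lt_floor_add_one b
    have h4 := Nat.ceil_lt_add_one ha.le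
    have h5 : (⌊b⌋₊ : ℝ) + 1 ≤ ((⌊b⌋₊ + 1 - ⌈a⌉₊ : ℕ) : ℝ) + ⌈a⌉₊ := by
      have : ⌊b⌋₊ + 1 ≤ (⌊b⌋₊ + 1 - ⌈a⌉₊) + ⌈a⌉₊ := by omega
      exact_mod_cast this
    linarith
  exact h2.trans (by exact_mod_cast h1)

theorem rpow_le_sqrt {N τ Q : ℝ} (hN : 0 < N) (h : N ^ (2 * τ) ≤ Q) : N ^ τ ≤ √Q := by
  refine Real.le_sqrt_of_sq_le ?_
  rw [← Real.rpow_natCast, ← Real.rpow_mul hN.le, mul_comm τ]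
  exact_mod_cast h

variable {q k : ℕ} {N R δ : ℝ}

/-- The upper end of the range of denominators in which the dual sum saves; it uses only that a
denominator is at most `q`. -/
theorem sqrt_quotient_mul_le (hN : 1 < N) (hqN : (q : ℝ) = N ^ R) (g : ℕ) {τ x : ℝ}
    (h : R / 2 + τ ≤ x) : √((q / g : ℕ) : ℝ) * N ^ τ ≤ N ^ x := by
  have hN0 : 0 < N := by linarith
  have h1 : √((q / g : ℕ) : ℝ) ≤ N ^ (R / 2) := by
    refine Real.sqrt_le_iff.2 ⟨by positivity, ?_⟩
    rw [← Real.rpow_natCast, ← Real.rpow_mul hN0.le]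
    have h2 : ((q / g : ℕ) : ℝ) ≤ q := by exact_mod_cast Nat.div_le_self q g
    rw [hqN] at h2
    convert h2 using 2
    push_cast
    ring
  calc _ ≤ N ^ (R / 2) * N ^ τ := by gcongr
    _ = N ^ (R / 2 + τ) := (Real.rpow_add hN0 _ _).symm
    _ ≤ N ^ x := Real.rpow_le_rpow_of_exponent_le hN.le h

/-- If the excess for the exponent `k` is large, all degrees in `[3 R, (k + 1) / 4]` save, because
`q / gcd (D ^ j, q)` then retains a large part of `q`. The largeness also bounds `k`. -/
theorem window_of_large_excess (hq : q ≠ 0) (h0 : 0 < δ) (h1 : δ < 0.1) (hN : 1 < N)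
    (hqN : (q : ℝ) = N ^ R) (hR : 20 ≤ δ * R) (hk : 16 * R ≤ k)
    (hW : N ^ (δ / 8) < rootExcess q k) :
    δ * k ≤ 8 * R ∧ ∃ W : Finset (Fin k),
      δ * k ^ 2 / 544 ≤ δ * k / 32 * #W ∧ ∀ j ∈ W, 1 ≤ j.val ∧
        N ^ (δ * k / 32) ≤ √((q / Nat.gcd (rootModulus q (k + 1) ^ (j.val + 1)) q : ℕ) : ℝ) ∧
        √((q / Nat.gcd (rootModulus q (k + 1) ^ (j.val + 1)) q : ℕ) : ℝ) * N ^ (δ * k / 32)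
          ≤ N ^ (((j.val + 1 : ℕ) : ℝ) / 4) := by
  have hN0 : 0 < N := by linarith
  have hR200 : 200 < R := by
    norm_num at h1
    by_contra h
    push Not at h
    nlinarith
  have hWk : N ^ (δ * k / 8) ≤ (rootExcess q k : ℝ) ^ k := by
    calc N ^ (δ * k / 8) = (N ^ (δ / 8)) ^ k := by
          rw [← Real.rpow_natCast, ← Real.rpow_mul hN0.le]
          congr 1
          ring
      _ ≤ _ := by gcongr
  have hδk : δ * k ≤ 8 * R := by
    have h2 : ((rootExcess q k ^ k : ℕ) : ℝ) ≤ q := by exact_mod_cast rootExcess_pow_le q k hq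
    push_cast at h2
    rw [hqN] at h2
    have := (Real.rpow_le_rpow_left_iff hN).1 (hWk.trans h2)
    linarith
  refine ⟨hδk, degreeWindow k (3 * R) ((k + 1) / 4), ?_, ?_⟩
  · have hc := card_degreeWindow (k := k) (a := 3 * R) (b := (k + 1) / 4) (by linarith)
      (by positivity) (by linarith)
    have h3 : (k : ℝ) / 17 ≤ #(degreeWindow k (3 * R) ((k + 1) / 4)) := by linarith
    calc δ * k ^ 2 / 544 = δ * k / 32 * (k / 17) := by ring
      _ ≤ _ := by gcongr
  · intro j hj
    obtain ⟨-, hj1, hj2⟩ := mem_filter.1 hj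
    refine ⟨?_, ?_, sqrt_quotient_mul_le hN hqN _ (by linarith)⟩
    · have : (2 : ℝ) ≤ ((j.val + 1 : ℕ) : ℝ) := by linarith
      have : 2 ≤ j.val + 1 := by exact_mod_cast this
      omega
    · refine rpow_le_sqrt hN0 ?_
      have h4 : 4 * (j.val + 1) ≤ k + 1 := by
        have : (4 : ℝ) * ((j.val + 1 : ℕ) : ℝ) ≤ k + 1 := by linarith
        exact_mod_cast this
      have hmul := gcd_rootModulus_sq_mul_le q k (j.val + 1) hq h4
      set g := Nat.gcd (rootModulus q (k + 1) ^ (j.val + 1)) q with hg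
      have hgq : g ∣ q := Nat.gcd_dvd_right _ _
      have hg0 : (0 : ℝ) < g := by
        exact_mod_cast Nat.pos_of_ne_zero fun h => hq (Nat.eq_zero_of_zero_dvd (h ▸ hgq))
      rw [Nat.cast_div hgq hg0.ne']
      have h5 : (g : ℝ) ^ 2 * (rootExcess q k : ℝ) ^ k ≤ (q : ℝ) ^ 2 := by exact_mod_cast hmul
      have h6 : N ^ (2 * (δ * k / 32)) * g ≤ q := by
        refine le_of_sq_le_sq ?_ (Nat.cast_nonneg _)
        calc (N ^ (2 * (δ * k / 32)) * g) ^ 2 = (g : ℝ) ^ 2 * N ^ (δ * k / 8) := by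
              rw [mul_pow, ← Real.rpow_natCast (N ^ (2 * (δ * k / 32))),
                ← Real.rpow_mul hN0.le, mul_comm]
              congr 2
              push_cast
              ring
          _ ≤ (g : ℝ) ^ 2 * (rootExcess q k : ℝ) ^ k := by gcongr
          _ ≤ _ := h5
      rwa [le_div_iff₀ hg0]

/-- If the modulus is at most `N ^ (1 / 2 - δ / 9)`, the degrees slightly above `2 R` save: there
the common factor of `D ^ j` and `q` cannot reach `q = N ^ R`, while `j / 4` already exceeds
`R / 2`. -/
theorem window_of_modulus_le (hq : q ≠ 0) (h0 : 0 < δ) (h1 : δ < 0.1) (hN : 1 < N)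
    (hqN : (q : ℝ) = N ^ R) (hR : 20 ≤ δ * R) (hk : 16 * R ≤ k)
    (hD : (rootModulus q (k + 1) : ℝ) ≤ N ^ (1 / 2 - δ / 9)) :
    ∃ W : Finset (Fin k),
      δ ^ 2 * R ^ 2 / 240 ≤ δ * R / 40 * #W ∧ ∀ j ∈ W, 1 ≤ j.val ∧
        N ^ (δ * R / 40) ≤ √((q / Nat.gcd (rootModulus q (k + 1) ^ (j.val + 1)) q : ℕ) : ℝ) ∧
        √((q / Nat.gcd (rootModulus q (k + 1) ^ (j.val + 1)) q : ℕ) : ℝ) * N ^ (δ * R / 40)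
          ≤ N ^ (((j.val + 1 : ℕ) : ℝ) / 4) := by
  have hN0 : 0 < N := by linarith
  norm_num at h1
  have hR200 : 200 < R := by
    by_contra h
    push Not at h
    nlinarith
  have hδR : δ * R ≤ R / 10 := by nlinarith
  refine ⟨degreeWindow k (2 * R + δ * R / 10) (2 * R + δ * R / 3), ?_, ?_⟩
  · have hc := card_degreeWindow (k := k) (a := 2 * R + δ * R / 10) (b := 2 * R + δ * R / 3)
      (by positivity) (by positivity) (by linarith)
    have h3 : δ * R / 6 ≤ #(degreeWindow k (2 * R + δ * R / 10) (2 * R + δ * R / 3)) := by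
      linarith
    calc δ ^ 2 * R ^ 2 / 240 = δ * R / 40 * (δ * R / 6) := by ring
      _ ≤ _ := by gcongr
  · intro j hj
    obtain ⟨-, hj1, hj2⟩ := mem_filter.1 hj
    refine ⟨?_, ?_, sqrt_quotient_mul_le hN hqN _ (by linarith)⟩
    · have : (2 : ℝ) ≤ ((j.val + 1 : ℕ) : ℝ) := by linarith
      have : 2 ≤ j.val + 1 := by exact_mod_cast this
      omega
    · refine rpow_le_sqrt hN0 ?_
      have hgD : Nat.gcd (rootModulus q (k + 1) ^ (j.val + 1)) q
          ≤ rootModulus q (k + 1) ^ (j.val + 1) :=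
        Nat.gcd_le_left _ (Nat.pow_pos (rootModulus_pos q _))
      set g := Nat.gcd (rootModulus q (k + 1) ^ (j.val + 1)) q with hg
      have hgq : g ∣ q := Nat.gcd_dvd_right _ _
      have hg0 : (0 : ℝ) < g := by
        exact_mod_cast Nat.pos_of_ne_zero fun h => hq (Nat.eq_zero_of_zero_dvd (h ▸ hgq))
      rw [Nat.cast_div hgq hg0.ne', le_div_iff₀ hg0, hqN]
      have h5 : (g : ℝ) ≤ N ^ ((1 / 2 - δ / 9) * ((j.val + 1 : ℕ) : ℝ)) := by
        calc (g : ℝ) ≤ (rootModulus q (k + 1) : ℝ) ^ (j.val + 1) := by exact_mod_cast hgD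
          _ ≤ (N ^ (1 / 2 - δ / 9)) ^ (j.val + 1) := by gcongr
          _ = _ := by rw [← Real.rpow_natCast, ← Real.rpow_mul hN0.le]
      calc N ^ (2 * (δ * R / 40)) * g
          ≤ N ^ (2 * (δ * R / 40)) * N ^ ((1 / 2 - δ / 9) * ((j.val + 1 : ℕ) : ℝ)) := by gcongr
        _ = N ^ (2 * (δ * R / 40) + (1 / 2 - δ / 9) * ((j.val + 1 : ℕ) : ℝ)) :=
            (Real.rpow_add hN0 _ _).symm
        _ ≤ N ^ R := by
            refine Real.rpow_le_rpow_of_exponent_le hN.le ?_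
            have h6 : (1 / 2 - δ / 9) * ((j.val + 1 : ℕ) : ℝ)
                ≤ (1 / 2 - δ / 9) * (2 * R + δ * R / 3) := by
              refine mul_le_mul_of_nonneg_left hj2 (by linarith)
            nlinarith [mul_nonneg h0.le (mul_nonneg h0.le (show 0 ≤ R by linarith))]

/-- The degree `k` and the window of useful coefficients. In both alternatives the total saving
`σ` is large against the powers of `k` that are lost in the mean value theorem. -/
theorem exists_degree_and_window (hq : q ≠ 0) (h0 : 0 < δ) (h1 : δ < 0.1) (hN : 1 < N)
    (hqN : (q : ℝ) = N ^ R) (hR : 20 ≤ δ * R) (hker : (kernel q : ℝ) ^ (2 + δ) ≤ N) :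
    ∃ (k : ℕ) (W : Finset (Fin k)) (τ σ : ℝ), 2 ≤ k ∧
      (rootModulus q (k + 1) : ℝ) ≤ N ^ (1 / 2 - δ / 9) ∧ σ ≤ τ * #W ∧
      δ ^ 2 * k ^ 2 / 63000 ≤ σ ∧ δ ^ 2 * k ^ 2 ≤ 260 * R ^ 2 ∧
      1296 * Real.log (1 / δ) ^ 2 * gamma δ * k ^ 4 ≤ σ * R ^ 2 ∧
      ∀ j ∈ W, 1 ≤ j.val ∧
        N ^ τ ≤ √((q / Nat.gcd (rootModulus q (k + 1) ^ (j.val + 1)) q : ℕ) : ℝ) ∧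
        √((q / Nat.gcd (rootModulus q (k + 1) ^ (j.val + 1)) q : ℕ) : ℝ) * N ^ τ
          ≤ N ^ (((j.val + 1 : ℕ) : ℝ) / 4) := by
  have hN0 : 0 < N := by linarith
  obtain ⟨hL, hδL⟩ := Vinogradov.log_one_div_bounds h0 h1
  have h1' : δ < 1 / 10 := by norm_num at h1 ⊢; linarith
  have hR200 : 200 < R := by
    by_contra h
    push Not at h
    nlinarith
  obtain ⟨k, hk0, hWk, hor⟩ := exists_minimal_degree hq ⌈16 * R⌉₊ (V := N ^ (δ / 8))
    (Real.one_le_rpow hN.le (by positivity))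
  have hk : 16 * R ≤ k := Nat.ceil_le.1 hk0
  have hk2 : 2 ≤ k := by
    have : (2 : ℝ) ≤ k := by linarith
    exact_mod_cast this
  have hD : (rootModulus q (k + 1) : ℝ) ≤ N ^ (1 / 2 - δ / 9) := by
    have h2 : (kernel q : ℝ) ≤ N ^ (1 / (2 + δ)) := by
      have := Real.rpow_le_rpow (by positivity) hker (show 0 ≤ 1 / (2 + δ) by positivity)
      rwa [← Real.rpow_mul (Nat.cast_nonneg _), mul_one_div_cancel (by positivity),
        Real.rpow_one] at this
    rw [rootModulus]
    push_cast
    calc (kernel q : ℝ) * rootExcess q (k + 1) ≤ N ^ (1 / (2 + δ)) * N ^ (δ / 8) := by gcongr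
      _ = N ^ (1 / (2 + δ) + δ / 8) := (Real.rpow_add hN0 _ _).symm
      _ ≤ _ := by
          refine Real.rpow_le_rpow_of_exponent_le hN.le ?_
          have : 1 / (2 + δ) ≤ 1 / 2 - δ / 9 - δ / 8 := by
            rw [div_le_iff₀ (by positivity)]
            nlinarith
          linarith
  set L := Real.log (1 / δ) with hLdef
  have hL0 : 0 ≤ L := by norm_num at hL; linarith
  have hδL0 : 0 ≤ δ * L ^ 2 := by positivity
  have hδL2 : (δ * L ^ 2) ^ 2 ≤ 1 := pow_le_one₀ hδL0 hδL
  have hgam : 1296 * L ^ 2 * gamma δ ≤ δ ^ 4 / 1250000 := by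
    rw [gamma, ← hLdef]
    have : (1296 : ℝ) * L ^ 2 * ((201 ^ 4)⁻¹ * δ ^ 6 * L ^ 2)
        = 1296 / 201 ^ 4 * δ ^ 4 * (δ * L ^ 2) ^ 2 := by
      field_simp
    rw [this]
    calc 1296 / 201 ^ 4 * δ ^ 4 * (δ * L ^ 2) ^ 2 ≤ 1296 / 201 ^ 4 * δ ^ 4 * 1 := by gcongr
      _ ≤ _ := by
          have : (0 : ℝ) ≤ δ ^ 4 := by positivity
          norm_num
          linarith
  have hk4 : (0 : ℝ) ≤ (k : ℝ) ^ 4 := by positivity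
  have hgam4 : 1296 * L ^ 2 * gamma δ * k ^ 4 ≤ δ ^ 4 / 1250000 * k ^ 4 := by gcongr
  rcases hor with hkeq | hlarge
  · obtain ⟨W, hσ, hW⟩ := window_of_modulus_le hq h0 h1 hN hqN hR hk hD
    have hkR : (k : ℝ) ≤ 16.1 * R := by
      have := Nat.ceil_lt_add_one (show 0 ≤ 16 * R by linarith)
      rw [← hkeq] at this
      norm_num
      linarith
    have hk2R : (k : ℝ) ^ 2 ≤ 260 * R ^ 2 := by
      have : (k : ℝ) ^ 2 ≤ (16.1 * R) ^ 2 := by gcongr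
      norm_num at this
      nlinarith
    have hδ2 : δ ^ 2 ≤ 1 / 100 := by nlinarith
    refine ⟨k, W, _, _, hk2, hD, hσ, ?_, ?_, hgam4.trans ?_, hW⟩
    · have : δ ^ 2 * (k : ℝ) ^ 2 ≤ δ ^ 2 * (260 * R ^ 2) := by gcongr
      nlinarith [sq_nonneg (δ * R)]
    · nlinarith [sq_nonneg (k : ℝ)]
    · have h3 : (k : ℝ) ^ 4 ≤ (260 * R ^ 2) ^ 2 := by
        calc (k : ℝ) ^ 4 = ((k : ℝ) ^ 2) ^ 2 := by ring
          _ ≤ _ := by gcongr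
      calc δ ^ 4 / 1250000 * (k : ℝ) ^ 4 ≤ δ ^ 4 / 1250000 * (260 * R ^ 2) ^ 2 := by gcongr
        _ = δ ^ 2 * (δ ^ 2 * R ^ 4) * (67600 / 1250000) := by ring
        _ ≤ 1 / 100 * (δ ^ 2 * R ^ 4) * (67600 / 1250000) := by gcongr
        _ ≤ _ := by
            have : (0 : ℝ) ≤ δ ^ 2 * R ^ 4 := by positivity
            linarith
  · obtain ⟨hδk, W, hσ, hW⟩ := window_of_large_excess hq h0 h1 hN hqN hR hk hlarge
    have hδk2 : δ ^ 2 * (k : ℝ) ^ 2 ≤ 64 * R ^ 2 := by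
      calc δ ^ 2 * (k : ℝ) ^ 2 = (δ * k) ^ 2 := by ring
        _ ≤ (8 * R) ^ 2 := by gcongr
        _ = _ := by ring
    refine ⟨k, W, _, _, hk2, hD, hσ, ?_, by nlinarith [sq_nonneg R], hgam4.trans ?_, hW⟩
    · have : δ * (δ * (k : ℝ) ^ 2) ≤ 1 / 10 * (δ * (k : ℝ) ^ 2) := by gcongr
      have : (0 : ℝ) ≤ δ * (k : ℝ) ^ 2 := by positivity
      linarith
    · calc δ ^ 4 / 1250000 * (k : ℝ) ^ 4 = δ * (δ * k ^ 2) * (δ ^ 2 * k ^ 2) / 1250000 := by ring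
        _ ≤ 1 * (δ * k ^ 2) * (64 * R ^ 2) / 1250000 := by gcongr; linarith
        _ ≤ _ := by
            have : (0 : ℝ) ≤ δ * (k : ℝ) ^ 2 * R ^ 2 := by positivity
            linarith

end Window

end ShortKloosterman

/-! ### The incomplete Kloosterman sum -/

namespace ShortKloosterman

section Conclusion

theorem gamma_bounds {δ : ℝ} (h0 : 0 < δ) (h1 : δ < 0.1) : 0 < gamma δ ∧ gamma δ ≤ δ / 1000 := by
  obtain ⟨hL, hδL⟩ := Vinogradov.log_one_div_bounds h0 h1
  have hL0 : 0 < Real.log (1 / δ) := lt_of_lt_of_le (by norm_num) hL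
  norm_num at h1
  refine ⟨by unfold gamma; positivity, ?_⟩
  have hδ4 : δ ^ 4 ≤ 1 := pow_le_one₀ h0.le (by linarith)
  calc gamma δ = (201 ^ 4)⁻¹ * δ * (δ ^ 4 * (δ * Real.log (1 / δ) ^ 2)) := by
        unfold gamma
        ring
    _ ≤ (201 ^ 4)⁻¹ * δ * (1 * 1) := by gcongr
    _ ≤ δ / 1000 := by
        norm_num
        linarith

/-- The lower bound for `N` involves `γ₁` through `γ₁ ³`, which has no fractional powers. -/
theorem gamma1_pow_three {δ : ℝ} (h0 : 0 < δ) (h1 : δ < 0.1) :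
    δ ^ 6 * gamma1 δ ^ 3 = 1200 ^ 3 * Real.log (1 / δ) ^ 2 := by
  obtain ⟨hL, -⟩ := Vinogradov.log_one_div_bounds h0 h1
  have hL0 : 0 ≤ Real.log (1 / δ) := le_trans (by norm_num) hL
  have h2 : ((Real.log (1 / δ)) ^ ((2 : ℝ) / 3)) ^ 3 = Real.log (1 / δ) ^ 2 := by
    rw [← Real.rpow_natCast, ← Real.rpow_mul hL0, ← Real.rpow_natCast]
    norm_num
  unfold gamma1
  rw [mul_pow, h2]
  field_simp

/-- The bilinear sum with all parameters inserted: half of the saving `N ^ σ` pays for the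
constants, and the root of order `4 s ²` is taken. -/
theorem norm_bilinear_le {q k l s X : ℕ} [NeZero q] {N R δ τ σ : ℝ} (h0 : 0 < δ) (h1 : δ < 0.1)
    (hN : 1 < N) (hk : 2 ≤ k) (hl : k * (2 * Real.log (1 / δ) + 12) ≤ (l : ℝ))
    (hl' : (l : ℝ) ≤ k * (2 * Real.log (1 / δ) + 13)) (hs : s = 2 * k ^ 2 + k * l)
    (hX1 : 1 ≤ X) (hX : N ^ (1 / 4 : ℝ) ≤ X) (hX' : (X : ℝ) ≤ 2 * N ^ (1 / 4 : ℝ))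
    (hΛ : 1200 ^ 3 * Real.log (1 / δ) ^ 2 * R ^ 2 ≤ δ ^ 6 * Real.log N)
    (hR : δ ^ 2 * k ^ 2 ≤ 260 * R ^ 2) (hσ : δ ^ 2 * k ^ 2 / 63000 ≤ σ)
    (W : Finset (Fin k)) (hσW : σ ≤ τ * #W) (A : Fin k → ℤ)
    (hW : ∀ j ∈ W, N ^ τ ≤ √((q / Int.gcd (A j) q : ℕ) : ℝ) ∧
      √((q / Int.gcd (A j) q : ℕ) : ℝ) * N ^ τ ≤ N ^ (((j.val + 1 : ℕ) : ℝ) / 4)) :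
    ‖∑ x ∈ Ico (0 : ℤ) X, ∑ y ∈ Ico (0 : ℤ) X, (ZMod.stdAddChar : AddChar (ZMod q) ℂ)
        (∑ j, (A j : ZMod q) * (x : ZMod q) ^ (j.val + 1) * (y : ZMod q) ^ (j.val + 1))‖
      ≤ (X : ℝ) ^ 2 * N ^ (-(σ / (8 * s ^ 2))) := by
  have hN0 : 0 < N := by linarith
  have hs1 : 1 ≤ s := by
    rw [hs]
    have : 0 < 2 * k ^ 2 := by positivity
    omega
  have hs0 : (s : ℝ) ≠ 0 := by positivity
  have h2 := Vinogradov.norm_bilinear_pow_le_of_window hk l s X hs hX1 A W (N ^ τ) (by positivity)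
    (fun j hj => (hW j hj).1) (fun j hj => (hW j hj).2.trans (by
      calc N ^ (((j.val + 1 : ℕ) : ℝ) / 4) = (N ^ (1 / 4 : ℝ)) ^ (j.val + 1) := by
            rw [← Real.rpow_natCast, ← Real.rpow_mul hN0.le]
            congr 1
            ring
        _ ≤ _ := by gcongr))
  have h3 := Vinogradov.bilinearConst_mul_le h0 h1 hk hl hl' hs hN hX1 hX' hΛ hR hσ
  have h4 : (N ^ τ)⁻¹ ^ #W ≤ N ^ (-σ) := by
    rw [← Real.rpow_neg hN0.le, ← Real.rpow_natCast, ← Real.rpow_mul hN0.le]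
    exact Real.rpow_le_rpow_of_exponent_le hN.le (by linarith)
  refine le_of_pow_le_pow_left₀ (n := 2 * s * (2 * s)) (by positivity) (by positivity) ?_
  refine h2.trans ?_
  calc _ ≤ (X : ℝ) ^ (8 * s ^ 2) * N ^ (σ / 2) * N ^ (-σ) := by gcongr
    _ = (X : ℝ) ^ (8 * s ^ 2) * N ^ (-(σ / 2)) := by
        rw [mul_assoc, ← Real.rpow_add hN0]
        congr 2
        ring
    _ = _ := by
        rw [mul_pow, ← pow_mul, ← Real.rpow_natCast (N ^ _), ← Real.rpow_mul hN0.le]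
        congr 2
        · ring
        · push_cast
          field_simp
          ring

end Conclusion

end ShortKloosterman

theorem theorem2 (δ : ℝ) (hδ0 : 0 < δ) (hδ1 : δ < 0.1) :
    ∃ q₀ : ℕ, ∀ q : ℕ, q₀ ≤ q → ∀ N : ℕ,
      max ((ShortKloosterman.kernel q : ℝ) ^ (2 + δ))
          (Real.exp (ShortKloosterman.gamma1 δ * (Real.log (q : ℝ)) ^ ((2 : ℝ) / 3))) ≤ (N : ℝ) →
      (N : ℝ) ≤ (q : ℝ) ^ (δ / 20) →
      ∀ a b c : ℤ, Int.gcd a (q : ℤ) = 1 →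
        ‖ShortKloosterman.S q N a b c‖ <
          (N : ℝ) * Real.exp (-(ShortKloosterman.gamma δ *
            ((Real.log (N : ℝ)) ^ 3 / (Real.log (q : ℝ)) ^ 2))) := by
  -- The lower bound for `N` already dominates all constants; `q ≥ 3` ensures `log q > 0`.
  refine ⟨3, fun q hq N hmax hNq a b c ha => ?_⟩
  obtain ⟨hker, hexp⟩ := max_le_iff.1 hmax
  have hq0 : q ≠ 0 := by omega
  have : NeZero q := ⟨hq0⟩
  have hq3 : (3 : ℝ) ≤ q := by exact_mod_cast hq
  obtain ⟨hL, hδL⟩ := Vinogradov.log_one_div_bounds hδ0 hδ1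
  obtain ⟨hγ0, hγ⟩ := ShortKloosterman.gamma_bounds hδ0 hδ1
  have hγ1 := ShortKloosterman.gamma1_pow_three hδ0 hδ1
  have hγdef : ShortKloosterman.gamma δ
      = ((201 : ℝ) ^ 4)⁻¹ * δ ^ 6 * (Real.log (1 / δ)) ^ 2 := rfl
  have hδ1' : δ < 1 / 10 := by norm_num at hδ1 ⊢; linarith
  have hL' : 2.2 ≤ Real.log (1 / δ) := hL
  set L := Real.log (1 / δ)
  have hL2 : 2 ≤ L := le_trans (by norm_num) hL
  have hLsq : (4 : ℝ) ≤ L ^ 2 := by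
    have := pow_le_pow_left₀ (show (0 : ℝ) ≤ 2 by norm_num) hL2 2
    norm_num at this
    exact this
  set γ := ShortKloosterman.gamma δ
  have hγ1pos : 0 < ShortKloosterman.gamma1 δ := by
    unfold ShortKloosterman.gamma1
    have : 0 < L := by linarith
    positivity
  set M := Real.log (q : ℝ) with hM
  have hM0 : 0 < M := Real.log_pos (by linarith)
  have hM23 : 0 < M ^ ((2 : ℝ) / 3) := by positivity
  have hNpos : (1 : ℝ) < N := lt_of_lt_of_le (Real.one_lt_exp_iff.2 (by positivity)) hexp
  have hN0 : (0 : ℝ) < N := by linarith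
  set Λ := Real.log (N : ℝ) with hΛ
  have hΛ0 : 0 < Λ := Real.log_pos hNpos
  have hΛ1 : ShortKloosterman.gamma1 δ * M ^ ((2 : ℝ) / 3) ≤ Λ :=
    (Real.le_log_iff_exp_le hN0).2 hexp
  have hΛ3 : 1200 ^ 3 * L ^ 2 * M ^ 2 ≤ δ ^ 6 * Λ ^ 3 := by
    have h1 : (M ^ ((2 : ℝ) / 3)) ^ 3 = M ^ 2 := by
      rw [← Real.rpow_natCast, ← Real.rpow_mul hM0.le, ← Real.rpow_natCast]
      norm_num
    calc 1200 ^ 3 * L ^ 2 * M ^ 2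
        = δ ^ 6 * (ShortKloosterman.gamma1 δ * M ^ ((2 : ℝ) / 3)) ^ 3 := by
          rw [← hγ1, mul_pow, h1]
          ring
      _ ≤ δ ^ 6 * Λ ^ 3 := by gcongr
  -- From here on the size of `q` is measured by `q = N ^ R`.
  set R := M / Λ with hR
  have hR0 : 0 < R := div_pos hM0 hΛ0
  have hRΛ : R * Λ = M := div_mul_cancel₀ _ hΛ0.ne'
  have hqN : (q : ℝ) = (N : ℝ) ^ R := by
    rw [Real.rpow_def_of_pos hN0, ← hΛ, mul_comm, hRΛ, hM, Real.exp_log (by linarith)]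
  have hδR : 20 ≤ δ * R := by
    have h1 := Real.log_le_log hN0 hNq
    rw [Real.log_rpow (by linarith), ← hM, ← hΛ] at h1
    rw [hR, ← mul_div_assoc, le_div_iff₀ hΛ0]
    linarith
  have hΛR : 1200 ^ 3 * L ^ 2 * R ^ 2 ≤ δ ^ 6 * Λ := by
    rw [← hRΛ] at hΛ3
    have : Λ ^ 2 * (1200 ^ 3 * L ^ 2 * R ^ 2) ≤ Λ ^ 2 * (δ ^ 6 * Λ) := by linarith
    exact le_of_mul_le_mul_left this (by positivity)
  have hR200 : 200 < R := by
    have h1 : δ * R < 1 / 10 * R := mul_lt_mul_of_pos_right hδ1' hR0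
    linarith
  have hRsq : (1 : ℝ) ≤ R ^ 2 := one_le_pow₀ (by linarith)
  obtain ⟨k, W, τ, σ, hk2, hD, hσW, hσ, hkR, hσγ, hW⟩ :=
    ShortKloosterman.exists_degree_and_window hq0 hδ0 hδ1 hNpos hqN hδR hker
  have hkr : (2 : ℝ) ≤ k := by exact_mod_cast hk2
  -- Parameters of the mean value theorem and the length of the two variables.
  set l := ⌈(k : ℝ) * (2 * L + 12)⌉₊ with hl
  have hl1 : (k : ℝ) * (2 * L + 12) ≤ l := Nat.le_ceil _
  have hl2 : (l : ℝ) ≤ k * (2 * L + 13) := by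
    have := Nat.ceil_lt_add_one (show 0 ≤ (k : ℝ) * (2 * L + 12) by positivity)
    linarith
  set s := 2 * k ^ 2 + k * l with hs
  set X := ⌈(N : ℝ) ^ (1 / 4 : ℝ)⌉₊ with hX
  have hN4 : 1 ≤ (N : ℝ) ^ (1 / 4 : ℝ) := Real.one_le_rpow hNpos.le (by norm_num)
  have hX1 : (N : ℝ) ^ (1 / 4 : ℝ) ≤ X := Nat.le_ceil _
  have hX2 : (X : ℝ) ≤ 2 * (N : ℝ) ^ (1 / 4 : ℝ) := by
    have := Nat.ceil_lt_add_one (show 0 ≤ (N : ℝ) ^ (1 / 4 : ℝ) by linarith)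
    linarith
  have hX3 : 1 ≤ X := by
    have : (1 : ℝ) ≤ X := hN4.trans hX1
    exact_mod_cast this
  set D := ShortKloosterman.rootModulus q (k + 1) with hDdef
  have hX0 : (0 : ℝ) < X := by exact_mod_cast hX3
  have hS := ShortKloosterman.norm_S_le N D k X hX3 (by omega)
    (ShortKloosterman.dvd_rootModulus_pow q (k + 1) hq0 (by omega)) (Dvd.intro _ rfl)
    ((X : ℝ) ^ 2 * (N : ℝ) ^ (-(σ / (8 * s ^ 2)))) (by positivity) (fun A hA =>
      ShortKloosterman.norm_bilinear_le hδ0 hδ1 hNpos hk2 hl1 hl2 hs hX3 hX1 hX2 hΛR hkR hσ W hσW A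
        (fun j hj => by
          obtain ⟨h1, h2⟩ := hW j hj
          rw [hA j h1]
          exact h2)) a b c ha
  rw [mul_div_cancel_left₀ _ (by positivity)] at hS
  -- The target saving is `exp (-G)`.
  set G := γ * (Λ ^ 3 / M ^ 2) with hG
  have hGR : G = γ * Λ / R ^ 2 := by
    rw [hG, ← hRΛ]
    field_simp
  have hG3 : 3 ≤ G := by
    have h1 : 1200 ^ 3 * L ^ 2 ≤ δ ^ 6 * (Λ ^ 3 / M ^ 2) := by
      rw [← mul_div_assoc, le_div_iff₀ (by positivity)]
      exact hΛ3
    calc (3 : ℝ) ≤ (201 ^ 4)⁻¹ * (4 * (1200 ^ 3 * 4)) := by norm_num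
      _ ≤ (201 ^ 4)⁻¹ * (L ^ 2 * (1200 ^ 3 * L ^ 2)) := by gcongr
      _ ≤ (201 ^ 4)⁻¹ * (L ^ 2 * (δ ^ 6 * (Λ ^ 3 / M ^ 2))) := by gcongr
      _ = G := by rw [hG, hγdef]; ring
  have hmain : (N : ℝ) ^ (-(σ / (8 * s ^ 2))) ≤ Real.exp (-G) / 4 := by
    have hs9 : (s : ℝ) ≤ 9 * L * k ^ 2 := Vinogradov.tuple_length_le hL' hl2 hs
    have hs0 : (0 : ℝ) < s := by
      have : 0 < s := by rw [hs]; positivity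
      exact_mod_cast this
    have h1 : 2 * γ * (8 * (s : ℝ) ^ 2) ≤ σ * R ^ 2 := by
      calc 2 * γ * (8 * (s : ℝ) ^ 2) ≤ 2 * γ * (8 * (9 * L * k ^ 2) ^ 2) := by gcongr
        _ = 1296 * L ^ 2 * γ * k ^ 4 := by ring
        _ ≤ _ := hσγ
    have h2 : 2 * G ≤ σ / (8 * s ^ 2) * Λ := by
      rw [hGR]
      have : 2 * γ / R ^ 2 ≤ σ / (8 * s ^ 2) := by
        rw [div_le_div_iff₀ (by positivity) (by positivity)]
        exact h1
      calc 2 * (γ * Λ / R ^ 2) = 2 * γ / R ^ 2 * Λ := by ring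
        _ ≤ _ := by gcongr
    rw [Real.rpow_def_of_pos hN0, ← hΛ]
    calc Real.exp (Λ * -(σ / (8 * s ^ 2))) ≤ Real.exp (-G + -G) :=
          Real.exp_le_exp.2 (by linarith)
      _ = Real.exp (-G) * Real.exp (-G) := Real.exp_add _ _
      _ ≤ Real.exp (-G) * (1 / 4) := by
          have h3 : Real.exp (-G) ≤ 1 / 4 := by
            rw [Real.exp_neg, one_div]
            exact inv_anti₀ (by norm_num) (by linarith [Real.add_one_le_exp G])
          gcongr
      _ = _ := by ring
  have herr : 2 * (D : ℝ) * (X : ℝ) ^ 2 ≤ N * (Real.exp (-G) / 2) := by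
    have h1 : 3 + G ≤ δ / 9 * Λ := by
      have h2 : G ≤ δ / 1000 * Λ := by
        rw [hGR, div_le_iff₀ (by positivity)]
        calc γ * Λ ≤ δ / 1000 * Λ := by gcongr
          _ ≤ _ := le_mul_of_one_le_right (by positivity) hRsq
      have h3 : 1000 ≤ δ * Λ := by
        have h4 : δ ^ 6 * Λ ≤ δ * Λ := by
          refine mul_le_mul_of_nonneg_right ?_ hΛ0.le
          exact pow_le_of_le_one hδ0.le (by linarith) (by norm_num)
        have h7 : (1 : ℝ) ≤ L ^ 2 * R ^ 2 :=
          one_le_mul_of_one_le_of_one_le (by linarith) hRsq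
        have h8 : (1200 : ℝ) ^ 3 * 1 ≤ 1200 ^ 3 * (L ^ 2 * R ^ 2) := by gcongr
        norm_num at h8
        linarith
      linarith
    have h16 : (16 : ℝ) ≤ Real.exp 3 := by
      have h2 : (2.7 : ℝ) ^ 3 ≤ Real.exp 1 ^ 3 :=
        pow_le_pow_left₀ (by norm_num) (by linarith [Real.exp_one_gt_d9]) 3
      rw [← Real.exp_nat_mul] at h2
      norm_num at h2
      linarith
    calc 2 * (D : ℝ) * (X : ℝ) ^ 2
        ≤ 2 * (N : ℝ) ^ (1 / 2 - δ / 9) * (2 * (N : ℝ) ^ (1 / 4 : ℝ)) ^ 2 := by gcongr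
      _ = 8 * ((N : ℝ) ^ (1 / 2 - δ / 9) * (N : ℝ) ^ (1 / 4 : ℝ) * (N : ℝ) ^ (1 / 4 : ℝ)) := by
          ring
      _ = 8 * (N : ℝ) ^ (1 - δ / 9) := by
          rw [← Real.rpow_add hN0, ← Real.rpow_add hN0]
          congr 2
          ring
      _ = N * (8 * Real.exp (-(δ / 9 * Λ))) := by
          rw [sub_eq_add_neg, Real.rpow_add hN0, Real.rpow_one, Real.rpow_def_of_pos hN0 (-(δ / 9)),
            ← hΛ, mul_neg, mul_comm Λ]
          ring
      _ ≤ N * (8 * (Real.exp (-G) * Real.exp (-3))) := by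
          rw [← Real.exp_add]
          gcongr
          linarith
      _ ≤ N * (8 * (Real.exp (-G) * (1 / 16))) := by
          have : Real.exp (-3) ≤ 1 / 16 := by
            rw [Real.exp_neg, one_div]
            exact inv_anti₀ (by norm_num) h16
          gcongr
      _ = _ := by ring
  have hpos : 0 < N * Real.exp (-G) := by positivity
  have hfirst : (N : ℝ) * (N : ℝ) ^ (-(σ / (8 * s ^ 2))) ≤ N * (Real.exp (-G) / 4) := by gcongr
  linarith
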